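/- Let $(\Sigma,\omega)$ be a closed symplectic surface and let $\pi:V^3\to\Sigma$ be a prequantization bundle over it: a principal $S^1=\mathbb R/2\pi\mathbb Z$-bundle with a connection 1-form $\lambda$ ($S^1$-invariant, equal to $1$ on the generator $R$ of the action) such that $d\lambda=\pi^*\omega$. Thus $R$ is the Reeb vector field of $\lambda$, and its simple closed orbits are the fibres $\gamma$, of period $2\pi$. Let $H:\Sigma\to\mathbb R$ be a smooth Morse function (for example one with $|H|_{C^2}<1$; no bound on $H$ is needed) and let $T>0$. For $\varepsilon>0$ put $\lambda_\varepsilon=(1+\varepsilon\,\pi^*H)\lambda$. Then there is $\varepsilon_0>0$ such that for every $0<\varepsilon<\varepsilon_0$ the following hold. 1. $1+\varepsilon H>0$ and $\lambda_\varepsilon$ is a contact form; for each critical point $p$ of $H$ the fibre over $p$ is a simple closed Reeb orbit $\gamma_p$ of $\lambda_\varepsilon$, of period $2\pi(1+\varepsilon H(p))$. 2. Every closed Reeb orbit (possibly multiply covered) of $\lambda_\varepsilon$ of action $\int\lambda_\varepsilon<T$ projects to a critical point of $H$ and is nondegenerate, i.e. its linearized return map on $\ker\lambda_\varepsilon$ does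 not have the eigenvalue $1$. 3. Let $p$ be a critical point of $H$ and $k\ge1$ such that the $k$-fold iterate $\gamma_p^k$ has action $<T$, and let $\gamma$ be the fibre over $p$, regarded as a (degenerate) Reeb orbit of $\lambda$, with $k$-fold iterate $\gamma^k$. For every symplectic trivialization $\tau$ of $(\ker\lambda,d\lambda)$ over this fibre, $$\mu_{CZ}^{\tau}(\gamma_p^k)=\mu_{RS}^{\tau}(\gamma^k)-1+\operatorname{index}_p(H),$$ where on the left $\tau$ is rescaled by the constant that makes it symplectic for $d\lambda_\varepsilon$ on $\ker\lambda_\varepsilon=\ker\lambda$. Here $\operatorname{index}_p(H)$ is the Morse index. For a $C^1$ path $\Psi:[0,S]\to Sp(2)$ with $\Psi(0)=1$, a crossing is a time $t$ with $\det(\Psi(t)-1)=0$; it is regular if the crossing form $v\mapsto\omega_0(v,\dot\Psi(t)v)$ on $\ker(\Psi(t)-1)$, where $\omega_0=dx\wedge dy$, is nonsingular. If all crossings are regular, $\mu_{RS}(\Psi)$ is the sum of the signatures of the crossing forms, those at $t=0$ and $t=S$ being counted with weight $\tfrac12$; for a continuous path it is the value on any $C^1$ path with regular crossings homotopic to it with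 fixed end points. When $\det(1-\Psi(S))\neq0$ this number is an integer and equals the Conley-Zehnder index $\mu_{CZ}(\Psi)$. The index of a Reeb orbit is the index of its linearized Reeb flow on the contact planes, written in the given trivialization. -/

import Mathlib

open Set
open scoped Manifold ContDiff Topology

noncomputable section

/-! ## Differential forms and Hessians in charts

Manifolds are boundaryless and modelled on `EuclideanSpace ℝ (Fin n)`.  In Mathlib the tangent
space at `x` is the model space, identified through the preferred chart at `x`, so an object
written in the chart at `x` can be evaluated at `x` directly on tangent vectors. -/

section Forms

variable {n : ℕ} {M : Type*} [TopologicalSpace M] [ChartedSpace (EuclideanSpace ℝ (Fin n)) M]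

/-- The pull-back of a 1-form to the target of the chart centred at `c`. -/
def oneFormInChart (α : (x : M) → TangentSpace (𝓡 n) x →L[ℝ] ℝ) (c : M)
    (y : EuclideanSpace ℝ (Fin n)) : EuclideanSpace ℝ (Fin n) →L[ℝ] ℝ :=
  (α ((extChartAt (𝓡 n) c).symm y)).comp
    (mfderiv 𝓘(ℝ, EuclideanSpace ℝ (Fin n)) (𝓡 n) (extChartAt (𝓡 n) c).symm y)

/-- A 1-form is smooth if its coefficients are smooth in every chart. -/
def IsSmoothOneForm (α : (x : M) → TangentSpace (𝓡 n) x →L[ℝ] ℝ) : Prop :=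
  ∀ c : M, ContDiffOn ℝ ∞ (oneFormInChart α c) (extChartAt (𝓡 n) c).target

/-- The exterior derivative of a 1-form,
`dα(v, w) = D_v(α(w)) - D_w(α(v))` for constant `v`, `w` in the chart at `x`. -/
def dOneForm (α : (x : M) → TangentSpace (𝓡 n) x →L[ℝ] ℝ) (x : M)
    (v w : TangentSpace (𝓡 n) x) : ℝ :=
  fderiv ℝ (oneFormInChart α x) (extChartAt (𝓡 n) x x) v w
    - fderiv ℝ (oneFormInChart α x) (extChartAt (𝓡 n) x x) w v

/-- The coefficient of a bilinear form field in the chart centred at `c` on the constant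
vectors `v`, `w`. -/
def twoFormInChart (σ : (x : M) → TangentSpace (𝓡 n) x →L[ℝ] TangentSpace (𝓡 n) x →L[ℝ] ℝ)
    (c : M) (v w : EuclideanSpace ℝ (Fin n)) (y : EuclideanSpace ℝ (Fin n)) : ℝ :=
  σ ((extChartAt (𝓡 n) c).symm y)
    (mfderiv 𝓘(ℝ, EuclideanSpace ℝ (Fin n)) (𝓡 n) (extChartAt (𝓡 n) c).symm y v)
    (mfderiv 𝓘(ℝ, EuclideanSpace ℝ (Fin n)) (𝓡 n) (extChartAt (𝓡 n) c).symm y w)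

/-- A critical point of a function. -/
def IsCritPoint (H : M → ℝ) (p : M) : Prop :=
  mfderiv (𝓡 n) 𝓘(ℝ, ℝ) H p = 0

/-- The Hessian in the chart at `p` (coordinate independent at critical points). -/
def hessianAt (H : M → ℝ) (p : M) :
    EuclideanSpace ℝ (Fin n) →L[ℝ] EuclideanSpace ℝ (Fin n) →L[ℝ] ℝ :=
  fderiv ℝ (fderiv ℝ (H ∘ (extChartAt (𝓡 n) p).symm)) (extChartAt (𝓡 n) p p)

/-- A smooth function all of whose critical points are nondegenerate. -/
structure IsMorse (H : M → ℝ) : Prop where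
  smooth : ContMDiff (𝓡 n) 𝓘(ℝ, ℝ) ∞ H
  nondegenerate : ∀ p, IsCritPoint (n := n) H p →
    ∀ v, (∀ w, hessianAt (n := n) H p v w = 0) → v = 0

/-- The quadratic form `v ↦ Hess_p H (v, v)`. -/
def hessianQuadraticForm (H : M → ℝ) (p : M) : QuadraticForm ℝ (EuclideanSpace ℝ (Fin n)) :=
  LinearMap.BilinMap.toQuadraticMap (hessianAt (n := n) H p).toLinearMap₁₂

/-- The Morse index: the dimension of a maximal negative definite subspace of the Hessian. -/
def morseIndex (H : M → ℝ) (p : M) : ℕ :=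
  sigNeg (hessianQuadraticForm (n := n) H p)

/-! ## Contact forms, Reeb orbits and their flow -/

/-- `α` is smooth and nowhere zero, and `dα` is nondegenerate on `ker α`. -/
structure IsContactForm (α : (x : M) → TangentSpace (𝓡 n) x →L[ℝ] ℝ) : Prop where
  smooth : IsSmoothOneForm α
  ne_zero : ∀ x, α x ≠ 0
  nondegenerate : ∀ x v, α x v = 0 → (∀ w, α x w = 0 → dOneForm α x v w = 0) → v = 0

/-- `v` is the value at `x` of the Reeb vector field: `α(v) = 1` and `dα(v, ·) = 0`. -/
def IsReebVector (α : (x : M) → TangentSpace (𝓡 n) x →L[ℝ] ℝ) (x : M)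
    (v : TangentSpace (𝓡 n) x) : Prop :=
  α x v = 1 ∧ ∀ w, dOneForm α x v w = 0

/-- `γ` is a (globally defined) integral curve of the Reeb vector field. -/
def IsReebCurve (α : (x : M) → TangentSpace (𝓡 n) x →L[ℝ] ℝ) (γ : ℝ → M) : Prop :=
  ∀ t, ∃ v : TangentSpace (𝓡 n) (γ t), IsReebVector α (γ t) v ∧
    HasMFDerivAt 𝓘(ℝ, ℝ) (𝓡 n) γ t ((1 : ℝ →L[ℝ] ℝ).smulRight v)

/-- A closed Reeb orbit `γ : ℝ / Pℤ → M`, possibly multiply covered. -/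
structure IsReebOrbit (α : (x : M) → TangentSpace (𝓡 n) x →L[ℝ] ℝ) (γ : ℝ → M) (P : ℝ) :
    Prop where
  pos : 0 < P
  curve : IsReebCurve α γ
  periodic : Function.Periodic γ P

/-- A closed Reeb orbit whose period `P` is minimal.  Its `k`-fold iterate is `γ` with
period `k * P`. -/
structure IsSimpleReebOrbit (α : (x : M) → TangentSpace (𝓡 n) x →L[ℝ] ℝ) (γ : ℝ → M) (P : ℝ) :
    Prop extends IsReebOrbit α γ P where
  minimal : ∀ Q, 0 < Q → Q < P → ¬ Function.Periodic γ Q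

/-- The action `∫ γ^* α` of a closed orbit of period `P`. -/
def orbitAction (α : (x : M) → TangentSpace (𝓡 n) x →L[ℝ] ℝ) (γ : ℝ → M) (P : ℝ) : ℝ :=
  ∫ t in (0 : ℝ)..P, α (γ t) (mfderiv 𝓘(ℝ, ℝ) (𝓡 n) γ t (1 : ℝ))

/-- `φ` is the (smooth, complete) flow of the Reeb vector field. -/
structure IsReebFlow (α : (x : M) → TangentSpace (𝓡 n) x →L[ℝ] ℝ) (φ : ℝ → M → M) : Prop where
  smooth : ContMDiff (𝓘(ℝ, ℝ).prod (𝓡 n)) (𝓡 n) ∞ (fun q : ℝ × M => φ q.1 q.2)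
  zero : ∀ x, φ 0 x = x
  curve : ∀ x, IsReebCurve α (fun t => φ t x)

/-- The linearized return map of the flow on `ker α` does not have the eigenvalue `1`. -/
def IsNondegenerateOrbit (α : (x : M) → TangentSpace (𝓡 n) x →L[ℝ] ℝ) (φ : ℝ → M → M)
    (γ : ℝ → M) (P : ℝ) : Prop :=
  ∀ v : TangentSpace (𝓡 n) (γ 0), α (γ 0) v = 0 →
    (mfderiv (𝓡 n) (𝓡 n) (φ P) (γ 0) v : EuclideanSpace ℝ (Fin n)) = v → v = 0

end Forms

/-! ## The Robbin–Salamon and Conley–Zehnder indices of paths in `Sp(2)`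

`ℝ²` carries the form `ω₀ = dx ∧ dy`; a real `2 × 2` matrix is symplectic iff its determinant
is `1`. Paths are functions on `ℝ` of which only the values on `[0, T]` matter. -/

/-- A continuous path in `Sp(2)` on `[0, T]` starting at the identity. -/
structure IsSpPath (T : ℝ) (Ψ : ℝ → Matrix (Fin 2) (Fin 2) ℝ) : Prop where
  pos : 0 < T
  continuousOn : ContinuousOn Ψ (Icc 0 T)
  det : ∀ t ∈ Icc 0 T, (Ψ t).det = 1
  zero : Ψ 0 = 1

/-- The space `ker (Ψ(t) - 1)`. -/
def crossingSpace (Ψ : ℝ → Matrix (Fin 2) (Fin 2) ℝ) (t : ℝ) : Submodule ℝ (Fin 2 → ℝ) :=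
  LinearMap.ker (Matrix.toLin' (Ψ t - 1))

/-- The times `t ∈ [0, T]` with `det (Ψ(t) - 1) = 0`. -/
def crossings (T : ℝ) (Ψ : ℝ → Matrix (Fin 2) (Fin 2) ℝ) : Set ℝ :=
  {t | t ∈ Icc 0 T ∧ (Ψ t - 1).det = 0}

/-- The derivative of the path, one-sided at the end points of `[0, T]`. -/
def pathDeriv (T : ℝ) (Ψ : ℝ → Matrix (Fin 2) (Fin 2) ℝ) (t : ℝ) : Matrix (Fin 2) (Fin 2) ℝ :=
  Matrix.of fun i j => derivWithin (fun s => Ψ s i j) (Icc 0 T) t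

/-- The crossing form `v ↦ ω₀(v, Ψ'(t) v)` on `ker (Ψ(t) - 1)`. -/
def crossingForm (T : ℝ) (Ψ : ℝ → Matrix (Fin 2) (Fin 2) ℝ) (t : ℝ) :
    QuadraticForm ℝ (crossingSpace Ψ t) :=
  (Matrix.toQuadraticForm' (!![0, 1; -1, 0] * pathDeriv T Ψ t)).restrict (crossingSpace Ψ t)

/-- The signature of the crossing form. -/
def crossingSign (T : ℝ) (Ψ : ℝ → Matrix (Fin 2) (Fin 2) ℝ) (t : ℝ) : ℤ :=
  (sigPos (crossingForm T Ψ t) : ℤ) - (sigNeg (crossingForm T Ψ t) : ℤ)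

/-- A `C¹` path in `Sp(2)` starting at `1` with only regular crossings.  Finiteness of the
set of crossings is a consequence of regularity. -/
structure IsRegularPath (T : ℝ) (Ψ : ℝ → Matrix (Fin 2) (Fin 2) ℝ) : Prop
    extends IsSpPath T Ψ where
  contDiffOn : ∀ i j, ContDiffOn ℝ 1 (fun t => Ψ t i j) (Icc 0 T)
  regular : ∀ t ∈ crossings T Ψ, ∀ v : crossingSpace Ψ t,
    (∀ w, QuadraticMap.polar (crossingForm T Ψ t) v w = 0) → v = 0
  finite : (crossings T Ψ).Finite

/-- The signature count of a path with regular crossings; the end points have weight `1/2`. -/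
def crossingSum (T : ℝ) (Ψ : ℝ → Matrix (Fin 2) (Fin 2) ℝ) : ℚ :=
  (1 / 2 : ℚ) * (crossingSign T Ψ 0 : ℚ)
    + ∑ᶠ t ∈ crossings T Ψ ∩ Ioo 0 T, (crossingSign T Ψ t : ℚ)
    + (1 / 2 : ℚ) * (crossingSign T Ψ T : ℚ)

/-- Homotopy in `Sp(2)` with fixed end points of paths on `[0, T]` starting at `1`. -/
def SpHomotopic (T : ℝ) (Ψ Ψ' : ℝ → Matrix (Fin 2) (Fin 2) ℝ) : Prop :=
  ∃ h : ℝ × ℝ → Matrix (Fin 2) (Fin 2) ℝ,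
    ContinuousOn h (Icc 0 1 ×ˢ Icc 0 T) ∧
    (∀ q ∈ Icc (0 : ℝ) 1 ×ˢ Icc 0 T, (h q).det = 1) ∧
    (∀ t ∈ Icc 0 T, h (0, t) = Ψ t ∧ h (1, t) = Ψ' t) ∧
    ∀ s ∈ Icc (0 : ℝ) 1, h (s, 0) = 1 ∧ h (s, T) = Ψ T

/-- `m` is the Robbin–Salamon index of the continuous path `Ψ` on `[0, T]`: the common value of
the signature count on all paths with regular crossings that are homotopic to `Ψ` with fixed end
points, of which there is at least one. -/
structure IsRSIndex (T : ℝ) (Ψ : ℝ → Matrix (Fin 2) (Fin 2) ℝ) (m : ℚ) : Prop where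
  path : IsSpPath T Ψ
  exists_regular : ∃ Ψ', IsRegularPath T Ψ' ∧ SpHomotopic T Ψ Ψ'
  eq_crossingSum : ∀ Ψ', IsRegularPath T Ψ' → SpHomotopic T Ψ Ψ' → crossingSum T Ψ' = m

/-- The Conley–Zehnder index: the Robbin–Salamon index of a path whose end point does not have
the eigenvalue `1`; it is an integer. -/
def IsCZIndex (T : ℝ) (Ψ : ℝ → Matrix (Fin 2) (Fin 2) ℝ) (m : ℤ) : Prop :=
  (1 - Ψ T).det ≠ 0 ∧ IsRSIndex T Ψ m

/-! ## Indices of Reeb orbits in contact 3-manifolds -/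

section Orbits

variable {V : Type*} [TopologicalSpace V] [ChartedSpace (EuclideanSpace ℝ (Fin 3)) V]

/-- A continuous frame over `S` of the plane field `ker α`, symplectic for `dα`;
equivalently a symplectic trivialization of `(ker α, dα)` over `S`. -/
structure IsSymplecticFrame [IsManifold (𝓡 3) ∞ V]
    (α : (x : V) → TangentSpace (𝓡 3) x →L[ℝ] ℝ) (S : Set V)
    (e : Fin 2 → (x : V) → TangentSpace (𝓡 3) x) : Prop where
  continuousOn : ∀ i, ContinuousOn (fun x => (⟨x, e i x⟩ : TangentBundle (𝓡 3) V)) S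
  mem_ker : ∀ i, ∀ x ∈ S, α x (e i x) = 0
  area : ∀ x ∈ S, dOneForm α x (e 0 x) (e 1 x) = 1

/-- `Ψ` is the linearized Reeb flow along `γ` on `[0, P]`, as a path of matrices in the
frame `e`. -/
def IsLinearizedFlow (φ : ℝ → V → V) (γ : ℝ → V) (P : ℝ)
    (e : Fin 2 → (x : V) → TangentSpace (𝓡 3) x) (Ψ : ℝ → Matrix (Fin 2) (Fin 2) ℝ) : Prop :=
  ∀ t ∈ Icc 0 P, ∀ j,
    (mfderiv (𝓡 3) (𝓡 3) (φ t) (γ 0) (e j (γ 0)) : EuclideanSpace ℝ (Fin 3))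
      = ∑ i, Ψ t i j • (e i (γ t) : EuclideanSpace ℝ (Fin 3))

/-- `m` is the Robbin–Salamon index of the orbit `(γ, P)` of the Reeb flow `φ` of `α`, in the
trivialization given by the frame `e`. -/
def IsOrbitRSIndex [IsManifold (𝓡 3) ∞ V]
    (α : (x : V) → TangentSpace (𝓡 3) x →L[ℝ] ℝ) (φ : ℝ → V → V)
    (γ : ℝ → V) (P : ℝ) (e : Fin 2 → (x : V) → TangentSpace (𝓡 3) x) (m : ℚ) : Prop :=
  IsSymplecticFrame α (range γ) e ∧ ∃ Ψ, IsLinearizedFlow φ γ P e Ψ ∧ IsRSIndex P Ψ m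

/-- `m` is the Conley–Zehnder index of the orbit `(γ, P)` of the Reeb flow `φ` of `α`, in the
trivialization given by the frame `e`. -/
def IsOrbitCZIndex [IsManifold (𝓡 3) ∞ V]
    (α : (x : V) → TangentSpace (𝓡 3) x →L[ℝ] ℝ) (φ : ℝ → V → V)
    (γ : ℝ → V) (P : ℝ) (e : Fin 2 → (x : V) → TangentSpace (𝓡 3) x) (m : ℤ) : Prop :=
  IsSymplecticFrame α (range γ) e ∧ ∃ Ψ, IsLinearizedFlow φ γ P e Ψ ∧ IsCZIndex P Ψ m

end Orbits

/-! ## Prequantization bundles over surfaces -/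

/-- A symplectic form on a surface: a smooth nondegenerate alternating 2-form.  It is closed
for dimension reasons. -/
structure IsAreaForm {B : Type*} [TopologicalSpace B] [ChartedSpace (EuclideanSpace ℝ (Fin 2)) B]
    (σ : (b : B) → TangentSpace (𝓡 2) b →L[ℝ] TangentSpace (𝓡 2) b →L[ℝ] ℝ) : Prop where
  smooth : ∀ c v w, ContDiffOn ℝ ∞ (twoFormInChart σ c v w) (extChartAt (𝓡 2) c).target
  alternating : ∀ b v, σ b v v = 0
  nondegenerate : ∀ b v, (∀ w, σ b v w = 0) → v = 0

/-- `proj : V → B` is a principal circle bundle over the symplectic surface `(B, σ)` (the circle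
acts smoothly and freely, and `proj` is a surjective submersion whose fibres are the orbits),
and `lam` is a real-valued connection form on it with curvature `σ`: it is smooth and
invariant, equal to `1` on the generator of the action, which has period `2π`, and
`d lam = proj^* σ`. -/
structure IsPrequantizationBundle {B V : Type*}
    [TopologicalSpace B] [ChartedSpace (EuclideanSpace ℝ (Fin 2)) B]
    [TopologicalSpace V] [ChartedSpace (EuclideanSpace ℝ (Fin 3)) V]
    [MulAction Circle V]
    (σ : (b : B) → TangentSpace (𝓡 2) b →L[ℝ] TangentSpace (𝓡 2) b →L[ℝ] ℝ)
    (proj : V → B) (lam : (x : V) → TangentSpace (𝓡 3) x →L[ℝ] ℝ) : Prop where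
  areaForm : IsAreaForm σ
  smooth_action : ContMDiffSMul (𝓡 1) (𝓡 3) ∞ Circle V
  free : ∀ (z : Circle) (x : V), z • x = x → z = 1
  smooth_proj : ContMDiff (𝓡 3) (𝓡 2) ∞ proj
  surjective : Function.Surjective proj
  submersion : ∀ x, Function.Surjective (mfderiv (𝓡 3) (𝓡 2) proj x)
  fibres : ∀ x y, proj x = proj y ↔ ∃ z : Circle, z • x = y
  smooth_form : IsSmoothOneForm lam
  generator : ∀ x, lam ((Circle.exp 0) • x)
    (mfderiv 𝓘(ℝ, ℝ) (𝓡 3) (fun t : ℝ => Circle.exp t • x) 0 (1 : ℝ)) = 1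
  invariant : ∀ (z : Circle) (x : V) (v : TangentSpace (𝓡 3) x),
    lam (z • x) (mfderiv (𝓡 3) (𝓡 3) (fun y : V => z • y) x v) = lam x v
  curvature : ∀ (x : V) (v w : TangentSpace (𝓡 3) x), dOneForm lam x v w =
    σ (proj x) (mfderiv (𝓡 3) (𝓡 2) proj x v) (mfderiv (𝓡 3) (𝓡 2) proj x w)

/-- The perturbed form `(1 + ε π^*H) lam`. -/
def perturbedForm {B V : Type*} [TopologicalSpace V] [ChartedSpace (EuclideanSpace ℝ (Fin 3)) V]
    (proj : V → B) (H : B → ℝ) (lam : (x : V) → TangentSpace (𝓡 3) x →L[ℝ] ℝ) (ε : ℝ) (x : V) :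
    TangentSpace (𝓡 3) x →L[ℝ] ℝ :=
  (1 + ε * H (proj x)) • lam x

/-- The frame `e` rescaled by `(1 + ε π^*H)^{-1/2}`: a frame symplectic for `d lam` over a fibre
above a critical point of `H` becomes symplectic for the differential of the perturbed form. -/
def rescaledFrame {B V : Type*} [TopologicalSpace V] [ChartedSpace (EuclideanSpace ℝ (Fin 3)) V]
    (proj : V → B) (H : B → ℝ) (ε : ℝ) (e : Fin 2 → (x : V) → TangentSpace (𝓡 3) x)
    (i : Fin 2) (x : V) : TangentSpace (𝓡 3) x :=
  (Real.sqrt (1 + ε * H (proj x)))⁻¹ • e i x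

end

/-! ## Signatures -/

section Signature

variable {W : Type*} [AddCommGroup W] [Module ℝ W] [FiniteDimensional ℝ W]

/-! Write `f = 1 + ε π^*H` and let `X` be the Hamiltonian field, `σ(X, ·) = dH`. The Reeb vector of
`f λ` has `λ`-component `1/f` and projects to `(ε/f²) X` (`isReebVector_pertForm`). Since `H` is
conserved, a Reeb curve covers a trajectory of `X` run with the constant small factor `κ = ε/(1 +
εH)²`; over a critical point it is the fibre run at speed `1/f`.

Closed orbits. Embed the compact surface by `ψ` into a Euclidean space. Compactness gives one
constant `C` with `‖d(dψ X) v‖ ≤ C ‖dψ v‖` (`exists_vecD_le`), so `F = dψ(X)` satisfies `‖F'‖ ≤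
κC‖F‖` along a projected Reeb curve. For a closed orbit of period `P`, take `t₀` maximizing `‖F‖`.
Rolle's theorem for `⟨F(t₀), ψ⟩` gives `t₁` with `F(t₁) ⊥ F(t₀)`, whence `‖F(t₀)‖² ≤ κCP ‖F(t₀)‖²`.
If `κCP < 1` then `F = 0` and the orbit lies over a critical point (`crit_of_periodic`). The period
is the action, so small `ε` handles all actions below `T`.

Nondegeneracy. Over a critical point the linearized flow on the contact plane projects to `exp(tκ
dX)`. The generator has trace zero, nonzero determinant because `H` is Morse, and `√|det| ≤ κC` by
the same constant (`sqrt_det_hamMatrix_le`). Hence `1` is not an eigenvalue before time `2π/√|det|`.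

Index. In a frame over the fibre the linearized circle action is, over `k` turns, a loop of some
winding number `m` in `Sp(2)`, of index `2m`. The perturbed linearized flow is this loop,
reparametrized, times `exp(tκ dX)`. The loop contributes `2m` (`isCZIndex_mul`); the short
exponential has its only crossing at `0` and contributes half the signature of that crossing form,
which is `-κ Hess H`. This half signature is `index_p(H) - 1` (`morseIndex_eq`).

Well-definedness of the Robbin–Salamon count is proved by hand. Identify `Sp(2)` with the pairs `(a,
b)` in `z ↦ a z + b z̄`, `|a|² - |b|² = 1`; the argument `θ` of `a` and the number `b` are global
coordinates on the universal cover. An explicit function `coverIndex` of trace and `θ` jumps by half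
the crossing signature on each side of a regular crossing and is locally constant elsewhere, so the
signature count depends only on the lifted end point (`crossingSum_eq_coverIndex`). Explicit regular
representatives complete the argument (`exists_regular_loop`, `exists_complexStructure`). -/

theorem sigPos_eq_finrank_of_posDef {Q : QuadraticForm ℝ W} (h : ∀ v, v ≠ 0 → 0 < Q v) :
    sigPos Q = Module.finrank ℝ W := by
  refine le_antisymm (sigPos_le_finrank Q) ?_
  have := le_sigPos_of_posDef Q (V := ⊤) (fun v hv => h v (by simpa using hv))
  simpa using this

theorem sigNeg_eq_zero_of_nonneg {Q : QuadraticForm ℝ W} (h : ∀ v, 0 ≤ Q v) :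
    sigNeg Q = 0 := by
  have := QuadraticForm.sigPos_add_finrank_le_of_nonpos (Q := -Q) (V := ⊤)
    (fun v _ => by simpa using h v)
  rw [finrank_top, sigPos_neg] at this
  omega

theorem sigNeg_eq_finrank_of_negDef {Q : QuadraticForm ℝ W} (h : ∀ v, v ≠ 0 → Q v < 0) :
    sigNeg Q = Module.finrank ℝ W := by
  rw [← sigPos_neg]
  exact sigPos_eq_finrank_of_posDef fun v hv => by simpa using h v hv

theorem sigPos_eq_zero_of_nonpos {Q : QuadraticForm ℝ W} (h : ∀ v, Q v ≤ 0) :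
    sigPos Q = 0 := by
  rw [← sigNeg_neg]
  exact sigNeg_eq_zero_of_nonneg fun v => by simpa using h v

theorem one_le_sigPos {Q : QuadraticForm ℝ W} {v : W} (h : 0 < Q v) : 1 ≤ sigPos Q := by
  have hv : v ≠ 0 := by rintro rfl; simp at h
  rw [← finrank_span_singleton (K := ℝ) hv]
  refine le_sigPos_of_posDef Q ?_
  rintro ⟨x, hx⟩ hx0
  obtain ⟨c, rfl⟩ := Submodule.mem_span_singleton.1 hx
  have hc : c ≠ 0 := by rintro rfl; simp at hx0
  rw [QuadraticMap.restrict_apply]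
  change 0 < Q (c • v)
  rw [QuadraticMap.map_smul]
  exact mul_pos (mul_self_pos.2 hc) h

theorem one_le_sigNeg {Q : QuadraticForm ℝ W} {v : W} (h : Q v < 0) : 1 ≤ sigNeg Q := by
  rw [← sigPos_neg]
  exact one_le_sigPos (v := v) (by simpa using h)

theorem sigPos_add_sigNeg_le (Q : QuadraticForm ℝ W) :
    sigPos Q + sigNeg Q ≤ Module.finrank ℝ W := by
  obtain ⟨V, hV, hV'⟩ := exists_finrank_eq_sigNeg_and_negDef Q
  rw [← hV]
  refine QuadraticForm.sigPos_add_finrank_le_of_nonpos fun x hx => ?_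
  by_cases h : x = 0
  · simp [h]
  · have := hV' ⟨x, hx⟩ (by simpa using h)
    simp [QuadraticMap.restrict_apply] at this
    exact this.le

theorem sig_eq_one_of_indefinite {Q : QuadraticForm ℝ W} (hW : Module.finrank ℝ W = 2)
    {v w : W} (hv : 0 < Q v) (hw : Q w < 0) : sigPos Q = 1 ∧ sigNeg Q = 1 := by
  have h1 := one_le_sigPos hv
  have h2 := one_le_sigNeg hw
  have h3 := sigPos_add_sigNeg_le Q
  omega

end Signature

/-! ## Crossing forms -/

/-- The form `v ↦ ω₀(v, D v)`. -/
noncomputable def omegaForm (D : Matrix (Fin 2) (Fin 2) ℝ) : QuadraticForm ℝ (Fin 2 → ℝ) :=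
  Matrix.toQuadraticForm' (!![0, 1; -1, 0] * D)

theorem omegaForm_apply (D : Matrix (Fin 2) (Fin 2) ℝ) (v : Fin 2 → ℝ) :
    omegaForm D v = D 1 0 * v 0 ^ 2 + (D 1 1 - D 0 0) * (v 0 * v 1) - D 0 1 * v 1 ^ 2 := by
  have h0 : ∀ j, ((!![0, 1; -1, 0] : Matrix (Fin 2) (Fin 2) ℝ) * D) 0 j = D 1 j := fun j => by
    rw [Matrix.mul_apply]; simp [Fin.sum_univ_two]
  have h1 : ∀ j, ((!![0, 1; -1, 0] : Matrix (Fin 2) (Fin 2) ℝ) * D) 1 j = - D 0 j := fun j => by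
    rw [Matrix.mul_apply]; simp [Fin.sum_univ_two]
  simp only [omegaForm, Matrix.toQuadraticForm', LinearMap.BilinMap.toQuadraticMap_apply,
    Matrix.toLinearMap₂'_apply, Fin.sum_univ_two, smul_eq_mul, h0, h1]
  ring

/-- The rotational part of a matrix. -/
noncomputable def rotPart (M : Matrix (Fin 2) (Fin 2) ℝ) : ℝ := (M 1 0 - M 0 1) / 2

theorem mem_ker_sub_one {M : Matrix (Fin 2) (Fin 2) ℝ} {v : Fin 2 → ℝ} :
    v ∈ LinearMap.ker (Matrix.toLin' (M - 1)) ↔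
      (M 0 0 - 1) * v 0 + M 0 1 * v 1 = 0 ∧ M 1 0 * v 0 + (M 1 1 - 1) * v 1 = 0 := by
  rw [LinearMap.mem_ker, Matrix.toLin'_apply, funext_iff, Fin.forall_fin_two]
  simp only [Matrix.mulVec, dotProduct, Fin.sum_univ_two, Matrix.sub_apply, Pi.zero_apply]
  simp

theorem det_sub_one {M : Matrix (Fin 2) (Fin 2) ℝ} (h : M.det = 1) :
    (M - 1).det = 2 - M.trace := by
  simp [Matrix.det_fin_two, Matrix.trace_fin_two] at *
  linarith

/-- Under these conditions `det = 1` becomes `(M₀₀ - 1)² + M₀₁² = 0`. The surface `trace = 2` in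
`Sp(2)` is thus a double cone with vertex `1`, whose two open halves are told apart by the sign of
`rotPart`. -/
theorem eq_one_of_rotPart_eq_zero {M : Matrix (Fin 2) (Fin 2) ℝ} (h : M.det = 1)
    (ht : M.trace = 2) (hy : rotPart M = 0) : M = 1 := by
  simp only [Matrix.det_fin_two, Matrix.trace_fin_two, rotPart] at *
  have h1 : M 1 0 = M 0 1 := by linarith
  have h2 : M 1 1 = 2 - M 0 0 := by linarith
  rw [h1, h2] at h
  have h3 : (M 0 0 - 1) ^ 2 + M 0 1 ^ 2 = 0 := by linarith
  have h4 : M 0 0 - 1 = 0 := by nlinarith [sq_nonneg (M 0 0 - 1), sq_nonneg (M 0 1)]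
  have h5 : M 0 1 = 0 := by nlinarith [sq_nonneg (M 0 0 - 1), sq_nonneg (M 0 1)]
  ext i j
  fin_cases i <;> fin_cases j <;> simp <;> linarith

/-- The hypothesis `hD` is the derivative of `det = 1`. The identity lets the crossing form at a
shear be read off from the rate at which the trace passes through `2` and the half of the cone on
which this happens. -/
theorem omegaForm_mul_rotPart {M D : Matrix (Fin 2) (Fin 2) ℝ} (h : M.det = 1)
    (ht : M.trace = 2)
    (hD : D 0 0 * M 1 1 + M 0 0 * D 1 1 - D 0 1 * M 1 0 - M 0 1 * D 1 0 = 0)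
    {v : Fin 2 → ℝ} (hv : v ∈ LinearMap.ker (Matrix.toLin' (M - 1))) :
    omegaForm D v * (2 * rotPart M) = - D.trace * (v 0 ^ 2 + v 1 ^ 2) := by
  obtain ⟨h1, h2⟩ := mem_ker_sub_one.1 hv
  rw [omegaForm_apply]
  simp only [Matrix.det_fin_two, Matrix.trace_fin_two, rotPart] at *
  have hs : M 1 1 = 2 - M 0 0 := by linarith
  rw [hs] at h h2 hD
  grind

theorem finrank_ker_of_rotPart {M : Matrix (Fin 2) (Fin 2) ℝ} (h : M.det = 1)
    (ht : M.trace = 2) (hy : rotPart M ≠ 0) :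
    Module.finrank ℝ (LinearMap.ker (Matrix.toLin' (M - 1))) = 1 := by
  have hne : LinearMap.ker (Matrix.toLin' (M - 1)) ≠ ⊤ := by
    intro h'
    rw [LinearMap.ker_eq_top] at h'
    have : M - 1 = 0 := by
      rw [← Matrix.toLin'.map_eq_zero_iff]; exact h'
    apply hy
    rw [sub_eq_zero.1 this]
    simp [rotPart]
  have h0 : LinearMap.ker (Matrix.toLin' (M - 1)) ≠ ⊥ := by
    intro h'
    obtain ⟨v, hv, hv'⟩ := Matrix.exists_mulVec_eq_zero_iff.2
      (show (M - 1).det = 0 by rw [det_sub_one h, ht]; ring)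
    apply hv
    rw [← Submodule.mem_bot ℝ, ← h']
    exact LinearMap.mem_ker.2 (by rw [Matrix.toLin'_apply]; exact hv')
  have h1 := Submodule.finrank_lt hne
  have h2 := Submodule.one_le_finrank_iff.2 h0
  simp at h1
  omega

theorem sub_sigs_of_rotPart {M D : Matrix (Fin 2) (Fin 2) ℝ} (h : M.det = 1)
    (ht : M.trace = 2)
    (hD : D 0 0 * M 1 1 + M 0 0 * D 1 1 - D 0 1 * M 1 0 - M 0 1 * D 1 0 = 0)
    (hy : rotPart M ≠ 0)
    (hreg : ∀ v : LinearMap.ker (Matrix.toLin' (M - 1)),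
      (∀ w, QuadraticMap.polar ((omegaForm D).restrict
        (LinearMap.ker (Matrix.toLin' (M - 1)))) v w = 0) → v = 0) :
    D.trace ≠ 0 ∧
    (sigPos ((omegaForm D).restrict (LinearMap.ker (Matrix.toLin' (M - 1)))) : ℤ) -
      sigNeg ((omegaForm D).restrict (LinearMap.ker (Matrix.toLin' (M - 1))))
      = - (SignType.sign (rotPart M) * SignType.sign D.trace : ℤ) := by
  set K := LinearMap.ker (Matrix.toLin' (M - 1))
  set Q := (omegaForm D).restrict K
  have hrank : Module.finrank ℝ K = 1 := finrank_ker_of_rotPart h ht hy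
  have key : ∀ v : K, Q v * (2 * rotPart M) =
      - D.trace * ((v : Fin 2 → ℝ) 0 ^ 2 + (v : Fin 2 → ℝ) 1 ^ 2) := fun v =>
    omegaForm_mul_rotPart h ht hD v.2
  have hpos : ∀ v : K, v ≠ 0 → 0 < (v : Fin 2 → ℝ) 0 ^ 2 + (v : Fin 2 → ℝ) 1 ^ 2 := by
    intro v hv
    by_contra! hc
    apply hv
    ext i
    fin_cases i <;> simp <;>
      nlinarith [sq_nonneg ((v : Fin 2 → ℝ) 0), sq_nonneg ((v : Fin 2 → ℝ) 1)]
  have htr : D.trace ≠ 0 := by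
    intro h0
    have hQ : ∀ v, Q v = 0 := by
      intro v
      have := key v
      rw [h0] at this
      simpa [hy] using this
    have : ∀ v : K, v = 0 := fun v => hreg v fun w => by
      change Q (v + w) - Q v - Q w = 0
      simp [hQ]
    have hs : Subsingleton K := ⟨fun a b => by rw [this a, this b]⟩
    have := Module.finrank_zero_of_subsingleton (R := ℝ) (M := K)
    omega
  refine ⟨htr, ?_⟩
  have hval : ∀ v : K, Q v = (- D.trace / (2 * rotPart M)) *
      ((v : Fin 2 → ℝ) 0 ^ 2 + (v : Fin 2 → ℝ) 1 ^ 2) := by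
    intro v
    have := key v
    field_simp
    linarith
  have hP : 0 < - D.trace / (2 * rotPart M) → (sigPos Q : ℤ) - sigNeg Q = 1 := by
    intro hp
    have h1 : ∀ v, v ≠ 0 → 0 < Q v := fun v hv => by
      rw [hval]; exact mul_pos hp (hpos v hv)
    rw [sigPos_eq_finrank_of_posDef h1, sigNeg_eq_zero_of_nonneg, hrank]
    · simp
    · intro v
      by_cases hv : v = 0
      · simp [hv]
      · exact (h1 v hv).le
  have hN : - D.trace / (2 * rotPart M) < 0 → (sigPos Q : ℤ) - sigNeg Q = -1 := by
    intro hp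
    have h1 : ∀ v, v ≠ 0 → Q v < 0 := fun v hv => by
      rw [hval]; exact mul_neg_of_neg_of_pos hp (hpos v hv)
    rw [sigNeg_eq_finrank_of_negDef h1, sigPos_eq_zero_of_nonpos, hrank]
    · simp
    · intro v
      by_cases hv : v = 0
      · simp [hv]
      · exact (h1 v hv).le
  rcases lt_or_gt_of_ne hy with hy | hy <;> rcases lt_or_gt_of_ne htr with ht' | ht'
  · rw [hN (div_neg_of_pos_of_neg (by linarith) (by linarith)), sign_neg hy, sign_neg ht']; rfl
  · rw [hP (div_pos_of_neg_of_neg (by linarith) (by linarith)), sign_neg hy, sign_pos ht']; rfl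
  · rw [hP (div_pos (by linarith) (by linarith)), sign_pos hy, sign_neg ht']; rfl
  · rw [hN (div_neg_of_neg_of_pos (by linarith) (by linarith)), sign_pos hy, sign_pos ht']; rfl

/-- For trace zero the discriminant of the form is `-4 det D`, so its type is decided by the sign of
`det D`; a definite form has the sign of its leading coefficient `D 1 0`. -/
theorem omegaForm_pos_of_det_pos {D : Matrix (Fin 2) (Fin 2) ℝ} (htr : D.trace = 0)
    (hdet : 0 < D.det) (h : 0 < D 1 0) {v : Fin 2 → ℝ} (hv : v ≠ 0) : 0 < omegaForm D v := by
  rw [omegaForm_apply]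
  simp only [Matrix.det_fin_two, Matrix.trace_fin_two] at *
  have h1 : D 1 1 = - D 0 0 := by linarith
  rw [h1] at hdet ⊢
  have : D 1 0 * (D 1 0 * v 0 ^ 2 + (-D 0 0 - D 0 0) * (v 0 * v 1) - D 0 1 * v 1 ^ 2)
      = (D 1 0 * v 0 - D 0 0 * v 1) ^ 2 + (D 0 0 * -D 0 0 - D 0 1 * D 1 0) * v 1 ^ 2 := by ring
  refine pos_of_mul_pos_right (a := D 1 0) ?_ h.le
  rw [this]
  by_cases h0 : v 1 = 0
  · have : v 0 ≠ 0 := by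
      intro h2; apply hv; ext i; fin_cases i <;> simp [h0, h2]
    rw [h0]
    have : 0 < (D 1 0 * v 0) ^ 2 := by positivity
    nlinarith
  · have : 0 < v 1 ^ 2 := by positivity
    nlinarith [sq_nonneg (D 1 0 * v 0 - D 0 0 * v 1), mul_pos hdet this]

theorem omegaForm_neg (D : Matrix (Fin 2) (Fin 2) ℝ) (v : Fin 2 → ℝ) :
    omegaForm (-D) v = - omegaForm D v := by
  simp only [omegaForm_apply, Matrix.neg_apply]; ring

theorem omegaForm_definite {D : Matrix (Fin 2) (Fin 2) ℝ} (htr : D.trace = 0)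
    (hdet : 0 < D.det) {v : Fin 2 → ℝ} (hv : v ≠ 0) : 0 < D 1 0 * omegaForm D v := by
  have h10 : D 1 0 ≠ 0 := by
    intro h
    simp only [Matrix.det_fin_two, Matrix.trace_fin_two, h] at *
    have h1 : D 1 1 = - D 0 0 := by linarith
    rw [h1] at hdet
    nlinarith [sq_nonneg (D 0 0)]
  rcases lt_or_gt_of_ne h10 with h | h
  · have := omegaForm_pos_of_det_pos (D := -D) (by simp [htr])
      (by simpa [Matrix.det_fin_two] using hdet) (by simpa using h) hv
    rw [omegaForm_neg] at this
    nlinarith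
  · exact mul_pos h (omegaForm_pos_of_det_pos htr hdet h hv)

theorem omegaForm_indefinite {D : Matrix (Fin 2) (Fin 2) ℝ} (htr : D.trace = 0)
    (hdet : D.det < 0) : (∃ v, 0 < omegaForm D v) ∧ ∃ v, omegaForm D v < 0 := by
  suffices h : ∃ v w, omegaForm D v * omegaForm D w < 0 by
    obtain ⟨v, w, h⟩ := h
    rcases mul_neg_iff.1 h with h | h
    · exact ⟨⟨v, h.1⟩, ⟨w, h.2⟩⟩
    · exact ⟨⟨w, h.2⟩, ⟨v, h.1⟩⟩
  simp only [Matrix.det_fin_two, Matrix.trace_fin_two] at *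
  have h1 : D 1 1 = - D 0 0 := by linarith
  rw [h1] at hdet
  by_cases h10 : D 1 0 = 0
  · by_cases h01 : D 0 1 = 0
    · refine ⟨![1, 1], ![1, -1], ?_⟩
      simp only [omegaForm_apply, h10, h01, h1, Matrix.cons_val_zero, Matrix.cons_val_one] at *
      nlinarith
    · refine ⟨![0, 1], ![D 0 1, - D 0 0], ?_⟩
      simp only [omegaForm_apply, h10, h1, Matrix.cons_val_zero, Matrix.cons_val_one] at *
      have h2 : 0 < D 0 1 ^ 2 := by positivity
      nlinarith [mul_pos h2 (neg_pos.2 hdet)]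
  -- The second vector is orthogonal to the first for the polar form, so the values have product `(D
  -- 1 0)² det D`. The preceding case uses the same construction starting from `![0, 1]`.
  · refine ⟨![1, 0], ![D 0 0, D 1 0], ?_⟩
    simp only [omegaForm_apply, h1, Matrix.cons_val_zero, Matrix.cons_val_one] at *
    have h2 : 0 < D 1 0 ^ 2 := by positivity
    nlinarith [mul_pos h2 (neg_pos.2 hdet)]

/-- This is the vertex of the cone, where the crossing space is the whole plane: `det D > 0` gives a
definite form, `det D < 0` an indefinite one, and regularity excludes `det D = 0`, since a kernel
vector of `D` lies in the radical. -/
theorem sub_sigs_of_eq_one {D : Matrix (Fin 2) (Fin 2) ℝ} (htr : D.trace = 0)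
    {K : Submodule ℝ (Fin 2 → ℝ)} (hK : K = ⊤)
    (hreg : ∀ v : K, (∀ w, QuadraticMap.polar ((omegaForm D).restrict K) v w = 0) → v = 0) :
    (0 < D.det ∧ (sigPos ((omegaForm D).restrict K) : ℤ) - sigNeg ((omegaForm D).restrict K)
      = 2 * SignType.sign (D 1 0)) ∨
    (D.det < 0 ∧ (sigPos ((omegaForm D).restrict K) : ℤ) - sigNeg ((omegaForm D).restrict K)
      = 0) := by
  subst hK
  have hrank : Module.finrank ℝ (⊤ : Submodule ℝ (Fin 2 → ℝ)) = 2 := by simp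
  set Q := (omegaForm D).restrict ⊤ with hQ
  have hQv : ∀ v : (⊤ : Submodule ℝ (Fin 2 → ℝ)), Q v = omegaForm D v := fun v => rfl
  rcases lt_trichotomy D.det 0 with h | h | h
  · right
    refine ⟨h, ?_⟩
    obtain ⟨⟨v, hv⟩, ⟨w, hw⟩⟩ := omegaForm_indefinite htr h
    obtain ⟨h1, h2⟩ := sig_eq_one_of_indefinite (Q := Q) hrank (v := ⟨v, trivial⟩)
      (w := ⟨w, trivial⟩) hv hw
    rw [h1, h2]; simp
  · exfalso
    obtain ⟨v, hv, hv'⟩ := Matrix.exists_mulVec_eq_zero_iff.2 h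
    have := hreg ⟨v, trivial⟩ fun w => by
      change omegaForm D (v + w) - omegaForm D v - omegaForm D w = 0
      have h0 := congrFun hv' 0
      have h1 := congrFun hv' 1
      simp only [Matrix.mulVec, dotProduct, Fin.sum_univ_two, Pi.zero_apply] at h0 h1
      simp only [omegaForm_apply, Pi.add_apply]
      rw [Matrix.trace_fin_two] at htr
      have ht : D 1 1 = - D 0 0 := by linarith
      rw [ht] at h1 ⊢
      linear_combination (2 * (w : Fin 2 → ℝ) 0) * h1 - (2 * (w : Fin 2 → ℝ) 1) * h0
    exact hv (congrArg Subtype.val this)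
  · left
    refine ⟨h, ?_⟩
    have hd : ∀ v : (⊤ : Submodule ℝ (Fin 2 → ℝ)), v ≠ 0 → 0 < D 1 0 * Q v := fun v hv =>
      omegaForm_definite htr h (by simpa using hv)
    have h10 : D 1 0 ≠ 0 := by
      intro h0
      have := hd ⟨![1, 0], trivial⟩ (by
        intro hc
        have := congrFun (congrArg Subtype.val hc) 0
        simp at this)
      simp [h0] at this
    rcases lt_or_gt_of_ne h10 with hs | hs
    · have h1 : ∀ v, v ≠ 0 → Q v < 0 := fun v hv => by nlinarith [hd v hv]
      rw [sigNeg_eq_finrank_of_negDef h1, sigPos_eq_zero_of_nonpos, hrank, sign_neg hs]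
      · simp
      · intro v
        by_cases hv : v = 0
        · simp [hv]
        · exact (h1 v hv).le
    · have h1 : ∀ v, v ≠ 0 → 0 < Q v := fun v hv => by nlinarith [hd v hv]
      rw [sigPos_eq_finrank_of_posDef h1, sigNeg_eq_zero_of_nonneg, hrank, sign_pos hs]
      · simp
      · intro v
        by_cases hv : v = 0
        · simp [hv]
        · exact (h1 v hv).le

/-! ## Local behaviour of paths at crossings -/

theorem eventually_sign_sub_of_hasDerivWithinAt {f : ℝ → ℝ} {d x : ℝ} {s : Set ℝ}
    (h : HasDerivWithinAt f d s x) (hd : d ≠ 0) :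
    ∀ᶠ t in 𝓝[s \ {x}] x,
      SignType.sign (f t - f x) = SignType.sign d * SignType.sign (t - x) := by
  have h1 := hasDerivWithinAt_iff_tendsto_slope.1 h
  have h2 : ∀ᶠ t in 𝓝[s \ {x}] x, SignType.sign (slope f x t) = SignType.sign d := by
    rcases lt_or_gt_of_ne hd with hd | hd
    · filter_upwards [h1.eventually_lt_const hd] with t ht
      rw [sign_neg ht, sign_neg hd]
    · filter_upwards [h1.eventually_const_lt hd] with t ht
      rw [sign_pos ht, sign_pos hd]
  filter_upwards [h2, self_mem_nhdsWithin] with t ht hts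
  rw [← ht, ← sign_mul, slope_def_field, div_mul_cancel₀]
  exact sub_ne_zero.2 hts.2

theorem hasDerivWithinAt_pathDeriv {T : ℝ} {Ψ : ℝ → Matrix (Fin 2) (Fin 2) ℝ}
    (hC : ∀ i j, ContDiffOn ℝ 1 (fun t => Ψ t i j) (Icc 0 T)) {t : ℝ} (ht : t ∈ Icc 0 T)
    (i j : Fin 2) :
    HasDerivWithinAt (fun s => Ψ s i j) (pathDeriv T Ψ t i j) (Icc 0 T) t :=
  ((hC i j).differentiableOn one_ne_zero t ht).hasDerivWithinAt

/-- Differentiate `det Ψ = 1` within the interval. At `Ψ = 1` the relation says that the derivative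
has trace zero. -/
theorem IsSpPath.pathDeriv_relation {T : ℝ} {Ψ : ℝ → Matrix (Fin 2) (Fin 2) ℝ}
    (h : IsSpPath T Ψ) (hC : ∀ i j, ContDiffOn ℝ 1 (fun t => Ψ t i j) (Icc 0 T)) {t : ℝ}
    (ht : t ∈ Icc 0 T) :
    pathDeriv T Ψ t 0 0 * Ψ t 1 1 + Ψ t 0 0 * pathDeriv T Ψ t 1 1
      - pathDeriv T Ψ t 0 1 * Ψ t 1 0 - Ψ t 0 1 * pathDeriv T Ψ t 1 0 = 0 := by
  have hd := fun i j => hasDerivWithinAt_pathDeriv hC ht i j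
  have h1 := ((hd 0 0).mul (hd 1 1)).sub ((hd 0 1).mul (hd 1 0))
  have h2 : HasDerivWithinAt (fun _ : ℝ => (1 : ℝ)) 0 (Icc 0 T) t := hasDerivWithinAt_const _ _ _
  have h3 := h1.congr_of_mem (f₁ := fun _ => (1 : ℝ)) (fun s hs => by
    have := h.det s hs
    rw [Matrix.det_fin_two] at this
    exact this.symm) ht
  have := (uniqueDiffOn_Icc h.pos t ht).eq_deriv _ h3 h2
  linarith

/-- The contribution to the index of the part of `Sp(2)` near the positive shears, in terms of
the trace and of the rotational part. -/
def localIndex (a b : SignType) : ℚ :=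
  if a = -1 then (if b = -1 then -1 else 1) else if a = 1 then 0 else (b : ℚ) / 2

/-- At a shear the rotational sign persists and the trace crosses `2` transversally. At the identity
the trace has a critical point, and the sign of the determinant of the derivative decides whether
the path is elliptic on both sides, rotating in opposite senses, or hyperbolic on both sides. In
each case the local index moves by half the crossing signature on either side. Nearby times are not
crossings, which later yields finiteness. -/
theorem eventually_localIndex {T : ℝ} {Ψ : ℝ → Matrix (Fin 2) (Fin 2) ℝ}
    (h : IsSpPath T Ψ) (hC : ∀ i j, ContDiffOn ℝ 1 (fun t => Ψ t i j) (Icc 0 T))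
    {t₀ : ℝ} (ht₀ : t₀ ∈ Icc 0 T) (htr : (Ψ t₀).trace = 2)
    (hreg : ∀ v : crossingSpace Ψ t₀,
      (∀ w, QuadraticMap.polar (crossingForm T Ψ t₀) v w = 0) → v = 0) :
    ∀ᶠ t in 𝓝[Icc 0 T \ {t₀}] t₀, (Ψ t).trace ≠ 2 ∧
      localIndex (SignType.sign ((Ψ t).trace - 2)) (SignType.sign (rotPart (Ψ t)))
        = localIndex 0 (SignType.sign (rotPart (Ψ t₀)))
          + (SignType.sign (t - t₀) : ℚ) * (crossingSign T Ψ t₀ : ℚ) / 2 := by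
  set D := pathDeriv T Ψ t₀ with hDdef
  have hd := fun i j => hasDerivWithinAt_pathDeriv hC ht₀ i j
  have hrel := h.pathDeriv_relation hC ht₀
  have hdtr : HasDerivWithinAt (fun t => (Ψ t).trace) D.trace (Icc 0 T) t₀ := by
    simp only [Matrix.trace_fin_two]
    exact (hd 0 0).add (hd 1 1)
  have hdrot : HasDerivWithinAt (fun t => rotPart (Ψ t)) (rotPart D) (Icc 0 T) t₀ := by
    simp only [rotPart]
    exact ((hd 1 0).sub (hd 0 1)).div_const 2
  have hne : ∀ᶠ t in 𝓝[Icc 0 T \ {t₀}] t₀, SignType.sign (t - t₀) ≠ 0 := by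
    filter_upwards [self_mem_nhdsWithin] with t ht
    rw [ne_eq, sign_eq_zero_iff, sub_eq_zero]
    exact ht.2
  have htr' : ∀ t, SignType.sign ((Ψ t).trace - 2) ≠ 0 → (Ψ t).trace ≠ 2 := by
    intro t ht h'
    rw [h'] at ht
    simp at ht
  by_cases hy : rotPart (Ψ t₀) = 0
  · have hone := eq_one_of_rotPart_eq_zero (h.det t₀ ht₀) htr hy
    have hDtr : D.trace = 0 := by
      rw [hone] at hrel
      rw [Matrix.trace_fin_two]
      simpa using hrel
    have hK : crossingSpace Ψ t₀ = ⊤ := by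
      simp [crossingSpace, hone]
    -- Here `2 - trace = det (Ψ - 1)`, and every entry of `Ψ - 1` vanishes to first order at `t₀`,
    -- so the quotient is the determinant of the slopes.
    have hslope : Filter.Tendsto (fun t => (2 - (Ψ t).trace) / (t - t₀) ^ 2)
        (𝓝[Icc 0 T \ {t₀}] t₀) (𝓝 D.det) := by
      have hs := fun i j => hasDerivWithinAt_iff_tendsto_slope.1 (hd i j)
      have := ((hs 0 0).mul (hs 1 1)).sub ((hs 0 1).mul (hs 1 0))
      rw [Matrix.det_fin_two]
      refine this.congr' ?_
      filter_upwards [self_mem_nhdsWithin] with t ht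
      have h1 : t - t₀ ≠ 0 := sub_ne_zero.2 ht.2
      rw [← det_sub_one (h.det t ht.1), Matrix.det_fin_two]
      simp only [slope_def_field, hone]
      simp
      field_simp
    rw [hy, sign_zero]
    rcases sub_sigs_of_eq_one hDtr hK hreg with ⟨hdet, hsig⟩ | ⟨hdet, hsig⟩
    · have hsig' : crossingSign T Ψ t₀ = 2 * SignType.sign (D 1 0) := hsig
      -- Definiteness tested on the two basis vectors shows that `D 1 0` and `-D 0 1` have the same
      -- sign, which is then the sign of `rotPart D`.
      have h10 : 0 < D 1 0 * omegaForm D ![1, 0] := omegaForm_definite hDtr hdet (by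
        intro hc; simpa using congrFun hc 0)
      have h01 : 0 < D 1 0 * omegaForm D ![0, 1] := omegaForm_definite hDtr hdet (by
        intro hc; simpa using congrFun hc 1)
      simp only [omegaForm_apply] at h10 h01
      simp at h10 h01
      have hsr : SignType.sign (rotPart D) = SignType.sign (D 1 0) := by
        rcases lt_or_gt_of_ne h10 with h' | h'
        · rw [sign_neg h', sign_neg]
          rw [rotPart]; nlinarith
        · rw [sign_pos h', sign_pos]
          rw [rotPart]; nlinarith
      have hr0 : rotPart D ≠ 0 := by
        rw [← sign_ne_zero, hsr, sign_ne_zero]; exact h10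
      filter_upwards [eventually_sign_sub_of_hasDerivWithinAt hdrot hr0, hne,
        hslope.eventually_const_lt hdet] with t h1 h2 h3
      rw [hy, sub_zero, hsr] at h1
      have h4 : (Ψ t).trace - 2 < 0 := by
        by_contra! hc
        exact absurd h3 (not_lt.2 (div_nonpos_of_nonpos_of_nonneg (by linarith) (sq_nonneg _)))
      refine ⟨by linarith, ?_⟩
      rw [h1, hsig', sign_neg h4]
      have h5 : SignType.sign (D 1 0) ≠ 0 := sign_ne_zero.2 h10
      generalize SignType.sign (D 1 0) = a at *
      generalize SignType.sign (t - t₀) = c at *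
      revert h2 h5
      cases a <;> cases c <;> simp [localIndex]
    · have hsig' : crossingSign T Ψ t₀ = 0 := hsig
      filter_upwards [hslope.eventually_lt_const hdet] with t h3
      have h4 : 0 < (Ψ t).trace - 2 := by
        by_contra! hc
        exact absurd h3 (not_lt.2 (div_nonneg (by linarith) (sq_nonneg _)))
      refine ⟨by linarith, ?_⟩
      rw [hsig', sign_pos h4]
      simp [localIndex]
  · obtain ⟨hDtr, hsig⟩ := sub_sigs_of_rotPart (h.det t₀ ht₀) htr hrel hy hreg
    have hsig' : crossingSign T Ψ t₀ =
      - (SignType.sign (rotPart (Ψ t₀)) * SignType.sign D.trace : ℤ) := hsig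
    have hc : Filter.Tendsto (fun t => rotPart (Ψ t)) (𝓝[Icc 0 T \ {t₀}] t₀)
        (𝓝 (rotPart (Ψ t₀))) :=
      hdrot.continuousWithinAt.mono_left (nhdsWithin_mono _ sdiff_subset)
    have hs : ∀ᶠ t in 𝓝[Icc 0 T \ {t₀}] t₀,
        SignType.sign (rotPart (Ψ t)) = SignType.sign (rotPart (Ψ t₀)) := by
      rcases lt_or_gt_of_ne hy with h' | h'
      · filter_upwards [hc.eventually_lt_const h'] with t ht
        rw [sign_neg ht, sign_neg h']
      · filter_upwards [hc.eventually_const_lt h'] with t ht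
        rw [sign_pos ht, sign_pos h']
    filter_upwards [eventually_sign_sub_of_hasDerivWithinAt hdtr hDtr, hne, hs] with t h1 h2 h3
    rw [htr] at h1
    have h5 : SignType.sign D.trace ≠ 0 := sign_ne_zero.2 hDtr
    have h6 : SignType.sign (rotPart (Ψ t₀)) ≠ 0 := sign_ne_zero.2 hy
    refine ⟨htr' t (by rw [h1]; exact mul_ne_zero h5 h2), ?_⟩
    rw [h1, hsig', h3]
    generalize SignType.sign D.trace = a at *
    generalize SignType.sign (t - t₀) = c at *
    generalize SignType.sign (rotPart (Ψ t₀)) = b at *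
    revert h2 h5 h6
    cases a <;> cases b <;> cases c <;> simp [localIndex] <;> norm_num

theorem crossings_eq {T : ℝ} {Ψ : ℝ → Matrix (Fin 2) (Fin 2) ℝ} (h : IsSpPath T Ψ) :
    crossings T Ψ = {t | t ∈ Icc 0 T ∧ (Ψ t).trace = 2} := by
  ext t
  refine and_congr_right fun ht => ?_
  rw [det_sub_one (h.det t ht), sub_eq_zero, eq_comm]

theorem IsSpPath.continuousOn_trace {T : ℝ} {Ψ : ℝ → Matrix (Fin 2) (Fin 2) ℝ}
    (h : IsSpPath T Ψ) : ContinuousOn (fun t => (Ψ t).trace) (Icc 0 T) :=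
  continuous_id.matrix_trace.comp_continuousOn h.continuousOn

/-- The set of crossings is compact, and an accumulation point would be a crossing that
`eventually_localIndex` isolates. -/
theorem finite_crossings {T : ℝ} {Ψ : ℝ → Matrix (Fin 2) (Fin 2) ℝ}
    (h : IsSpPath T Ψ) (hC : ∀ i j, ContDiffOn ℝ 1 (fun t => Ψ t i j) (Icc 0 T))
    (hreg : ∀ t ∈ crossings T Ψ, ∀ v : crossingSpace Ψ t,
      (∀ w, QuadraticMap.polar (crossingForm T Ψ t) v w = 0) → v = 0) :
    (crossings T Ψ).Finite := by
  have hc : IsCompact (crossings T Ψ) := by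
    rw [crossings_eq h]
    exact isCompact_Icc.of_isClosed_subset
      (h.continuousOn_trace.preimage_isClosed_of_isClosed isClosed_Icc
        (isClosed_singleton (x := (2 : ℝ)))) (fun t ht => ht.1)
  by_contra hinf
  obtain ⟨t₀, ht₀, hacc⟩ := Set.Infinite.exists_accPt_of_subset_isCompact hinf hc subset_rfl
  have ht := ht₀
  rw [crossings_eq h] at ht
  have hev := eventually_localIndex h hC ht.1 ht.2 (hreg t₀ ht₀)
  rw [accPt_iff_frequently_nhdsNE] at hacc
  rw [eventually_nhdsWithin_iff] at hev
  rw [frequently_nhdsWithin_iff] at hacc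
  obtain ⟨t, ⟨h1, h2⟩, h3⟩ := (hacc.and_eventually hev).exists
  rw [crossings_eq h] at h1
  exact (h3 ⟨h1.1, h2⟩).1 h1.2

theorem IsRegularPath.of_regular {T : ℝ} {Ψ : ℝ → Matrix (Fin 2) (Fin 2) ℝ}
    (h : IsSpPath T Ψ) (hC : ∀ i j, ContDiffOn ℝ 1 (fun t => Ψ t i j) (Icc 0 T))
    (hreg : ∀ t ∈ crossings T Ψ, ∀ v : crossingSpace Ψ t,
      (∀ w, QuadraticMap.polar (crossingForm T Ψ t) v w = 0) → v = 0) :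
    IsRegularPath T Ψ :=
  ⟨h, hC, hreg, finite_crossings h hC hreg⟩

theorem crossingSign_eq_zero {T : ℝ} {Ψ : ℝ → Matrix (Fin 2) (Fin 2) ℝ} {t : ℝ}
    (h : (Ψ t - 1).det ≠ 0) : crossingSign T Ψ t = 0 := by
  have hK : crossingSpace Ψ t = ⊥ := by
    rw [crossingSpace, LinearMap.ker_eq_bot']
    intro v hv
    by_contra hv0
    exact h (Matrix.exists_mulVec_eq_zero_iff.1 ⟨v, hv0, by
      rw [← Matrix.toLin'_apply]; exact hv⟩)
  have hr : Module.finrank ℝ (crossingSpace Ψ t) = 0 := by rw [hK]; simp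
  have h1 := sigPos_add_sigNeg_le (crossingForm T Ψ t)
  rw [crossingSign]
  omega

/-! ## The index as a function on the universal cover of `Sp(2)` -/

/-- `θ` is an argument of the complex linear part of `M`. -/
def IsAngle (M : Matrix (Fin 2) (Fin 2) ℝ) (θ : ℝ) : Prop :=
  ∃ r : ℝ, 1 ≤ r ∧ M.trace = 2 * (r * Real.cos θ) ∧ rotPart M = r * Real.sin θ

/-- The index of the point of the universal cover of `Sp(2)` with trace `τ` and angle `θ`. -/
noncomputable def coverIndex (τ θ : ℝ) : ℚ :=
  if τ < 2 then 2 * ⌊θ / (2 * Real.pi)⌋ + 1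
  else 2 * round (θ / (2 * Real.pi)) + if 2 < τ then 0 else
    (SignType.sign (θ - 2 * Real.pi * round (θ / (2 * Real.pi))) : ℚ) / 2

/-- In the window around `2πn` the rounding gives `n`, the floor gives `n` or `n - 1` according to
the sign of `θ - 2πn`, and that sign is the sign of `sin θ`, hence of `rotPart M`. -/
theorem coverIndex_eq_localIndex {M : Matrix (Fin 2) (Fin 2) ℝ} {θ : ℝ} (h : IsAngle M θ)
    {n : ℤ} (hn : |θ - 2 * Real.pi * n| < Real.pi / 2) :
    coverIndex M.trace θ =
      2 * n + localIndex (SignType.sign (M.trace - 2)) (SignType.sign (rotPart M)) := by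
  obtain ⟨r, hr, -, hy⟩ := h
  have hpi := Real.pi_pos
  rw [abs_lt] at hn
  have hdiv : θ / (2 * Real.pi) = n + (θ - 2 * Real.pi * n) / (2 * Real.pi) := by
    field_simp; ring
  have hb1 : (θ - 2 * Real.pi * n) / (2 * Real.pi) < 1 / 2 := by
    rw [div_lt_iff₀ (by positivity)]; linarith
  have hb2 : -(1 / 2) < (θ - 2 * Real.pi * n) / (2 * Real.pi) := by
    rw [lt_div_iff₀ (by positivity)]; linarith
  have hround : round (θ / (2 * Real.pi)) = n := by
    rw [round_eq, Int.floor_eq_iff, hdiv]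
    constructor <;> linarith
  have hsin : Real.sin θ = Real.sin (θ - 2 * Real.pi * n) := by
    rw [mul_comm, Real.sin_sub_int_mul_two_pi]
  have hsign : SignType.sign (rotPart M) = SignType.sign (θ - 2 * Real.pi * n) := by
    rw [hy, sign_mul, sign_pos (by linarith : 0 < r), one_mul, hsin]
    rcases lt_trichotomy (θ - 2 * Real.pi * n) 0 with h | h | h
    · rw [sign_neg h, sign_neg (Real.sin_neg_of_neg_of_neg_pi_lt h (by linarith))]
    · rw [h, Real.sin_zero]
    · rw [sign_pos h, sign_pos (Real.sin_pos_of_pos_of_lt_pi h (by linarith))]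
  rw [coverIndex, hround, hsign]
  rcases lt_trichotomy M.trace 2 with h | h | h
  · rw [if_pos h, sign_neg (sub_neg.2 h)]
    by_cases h0 : θ - 2 * Real.pi * n < 0
    · have : ⌊θ / (2 * Real.pi)⌋ = n - 1 := by
        rw [Int.floor_eq_iff, hdiv]
        have : (θ - 2 * Real.pi * n) / (2 * Real.pi) < 0 := div_neg_of_neg_of_pos h0 (by positivity)
        push_cast
        constructor <;> linarith
      rw [this, sign_neg h0]
      simp [localIndex]; ring
    · have : ⌊θ / (2 * Real.pi)⌋ = n := by
        rw [Int.floor_eq_iff, hdiv]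
        have : 0 ≤ (θ - 2 * Real.pi * n) / (2 * Real.pi) := div_nonneg (by linarith) (by positivity)
        constructor <;> linarith
      have h1 : SignType.sign (θ - 2 * Real.pi * n) ≠ -1 := by
        rw [ne_eq, sign_eq_neg_one_iff]; exact h0
      rw [this]
      simp [localIndex, h1]
  · rw [h]
    simp [localIndex]
  · rw [if_neg (by linarith), if_pos h, sign_pos (sub_pos.2 h)]
    simp [localIndex]

/-- A positive trace means `cos θ > 0`, so `θ` is within `π/2` of the nearest multiple of `2π`. This
covers a neighbourhood of all crossings and the hyperbolic matrices of positive trace. -/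
theorem exists_window {M : Matrix (Fin 2) (Fin 2) ℝ} {θ : ℝ} (h : IsAngle M θ)
    (htr : 0 < M.trace) : ∃ n : ℤ, |θ - 2 * Real.pi * n| < Real.pi / 2 := by
  obtain ⟨r, hr, hx, -⟩ := h
  have hpi := Real.pi_pos
  have hcos : 0 < Real.cos θ := by
    by_contra! hc
    nlinarith
  refine ⟨round (θ / (2 * Real.pi)), ?_⟩
  have h1 := abs_sub_round (θ / (2 * Real.pi))
  set n := round (θ / (2 * Real.pi))
  have h2 : θ - 2 * Real.pi * n = 2 * Real.pi * (θ / (2 * Real.pi) - n) := by field_simp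
  have h3 : |θ - 2 * Real.pi * n| ≤ Real.pi := by
    rw [h2, abs_mul, abs_of_pos (by positivity)]
    nlinarith
  by_contra! hc
  have h4 : Real.cos θ = Real.cos |θ - 2 * Real.pi * n| := by
    rw [Real.cos_abs, mul_comm, Real.cos_sub_int_mul_two_pi]
  rw [h4] at hcos
  exact absurd hcos (not_lt.2 (Real.cos_nonpos_of_pi_div_two_le_of_le hc (by linarith)))

theorem eventually_coverIndex {T : ℝ} {Ψ : ℝ → Matrix (Fin 2) (Fin 2) ℝ}
    (h : IsRegularPath T Ψ) {θ : ℝ → ℝ} (hθ : ContinuousOn θ (Icc 0 T))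
    (ha : ∀ t ∈ Icc 0 T, IsAngle (Ψ t) (θ t)) {t₀ : ℝ} (ht₀ : t₀ ∈ Icc 0 T) :
    ∀ᶠ t in 𝓝[Icc 0 T] t₀, coverIndex (Ψ t).trace (θ t) = coverIndex (Ψ t₀).trace (θ t₀)
      + (SignType.sign (t - t₀) : ℚ) * (crossingSign T Ψ t₀ : ℚ) / 2 := by
  have hcθ : Filter.Tendsto θ (𝓝[Icc 0 T] t₀) (𝓝 (θ t₀)) := hθ t₀ ht₀
  have hcτ : Filter.Tendsto (fun t => (Ψ t).trace) (𝓝[Icc 0 T] t₀) (𝓝 (Ψ t₀).trace) :=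
    h.toIsSpPath.continuousOn_trace t₀ ht₀
  have hpi := Real.pi_pos
  have hwin : ∀ n : ℤ, |θ t₀ - 2 * Real.pi * n| < Real.pi / 2 →
      ∀ᶠ t in 𝓝[Icc 0 T] t₀, |θ t - 2 * Real.pi * n| < Real.pi / 2 := fun n hn =>
    ((hcθ.sub_const _).abs).eventually_lt_const hn
  rcases lt_trichotomy (Ψ t₀).trace 2 with htr | htr | htr
  · rw [crossingSign_eq_zero (by rw [det_sub_one (h.det t₀ ht₀)]; linarith)]
    obtain ⟨r, hr, hx, -⟩ := ha t₀ ht₀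
    -- If `θ` were a multiple of `2π`, the radius bound `r ≥ 1` would force the trace to be at least
    -- `2`. Hence the floor is locally constant where the trace is below `2`.
    have hlt : (⌊θ t₀ / (2 * Real.pi)⌋ : ℝ) < θ t₀ / (2 * Real.pi) := by
      refine lt_of_le_of_ne (Int.floor_le _) fun hc => ?_
      have h1 : θ t₀ = (⌊θ t₀ / (2 * Real.pi)⌋ : ℝ) * (2 * Real.pi) := by
        rw [hc]; field_simp
      have h2 : Real.cos (θ t₀) = 1 := by rw [h1]; exact Real.cos_int_mul_two_pi _
      rw [h2] at hx
      linarith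
    have hdiv := hcθ.div_const (2 * Real.pi)
    filter_upwards [hcτ.eventually_lt_const htr, hdiv.eventually_const_lt hlt,
      hdiv.eventually_lt_const (Int.lt_floor_add_one _)] with t h1 h2 h3
    have : ⌊θ t / (2 * Real.pi)⌋ = ⌊θ t₀ / (2 * Real.pi)⌋ := by
      rw [Int.floor_eq_iff]; exact ⟨h2.le, h3⟩
    rw [coverIndex, coverIndex, if_pos h1, if_pos htr, this]
    simp
  · obtain ⟨n, hn⟩ := exists_window (ha t₀ ht₀) (by rw [htr]; norm_num)
    have hcr : t₀ ∈ crossings T Ψ := by rw [crossings_eq h.toIsSpPath]; exact ⟨ht₀, htr⟩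
    have hev := eventually_localIndex h.toIsSpPath h.contDiffOn ht₀ htr (h.regular t₀ hcr)
    rw [eventually_nhdsWithin_iff] at hev
    filter_upwards [hwin n hn, mem_nhdsWithin_of_mem_nhds hev, self_mem_nhdsWithin]
      with t h1 h2 h3
    by_cases hne : t = t₀
    · rw [hne]; simp
    · rw [coverIndex_eq_localIndex (ha t h3) h1, coverIndex_eq_localIndex (ha t₀ ht₀) hn,
        (h2 ⟨h3, hne⟩).2, htr, sub_self, sign_zero]
      ring
  · rw [crossingSign_eq_zero (by rw [det_sub_one (h.det t₀ ht₀)]; linarith)]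
    obtain ⟨n, hn⟩ := exists_window (ha t₀ ht₀) (by linarith)
    filter_upwards [hwin n hn, hcτ.eventually_const_lt htr, self_mem_nhdsWithin]
      with t h1 h2 h3
    rw [coverIndex_eq_localIndex (ha t h3) h1, coverIndex_eq_localIndex (ha t₀ ht₀) hn,
      sign_pos (sub_pos.2 h2), sign_pos (sub_pos.2 htr)]
    simp [localIndex]

theorem eq_of_eventually_eq_Icc {α : Type*} {T : ℝ} (hT : 0 ≤ T) {f : ℝ → α}
    (h : ∀ t₀ ∈ Icc 0 T, ∀ᶠ t in 𝓝[Icc 0 T] t₀, f t = f t₀) : f T = f 0 := by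
  have hl : IsLocallyConstant (fun t : Icc 0 T => f t) := by
    rw [IsLocallyConstant.iff_eventually_eq]
    intro t
    rw [nhds_subtype_eq_comap_nhdsWithin]
    exact (h t t.2).comap _
  have : PreconnectedSpace (Icc 0 T) := Subtype.preconnectedSpace isPreconnected_Icc
  exact hl.apply_eq_of_isPreconnected isPreconnected_univ
    (x := ⟨T, right_mem_Icc.2 hT⟩) (y := ⟨0, left_mem_Icc.2 hT⟩) trivial trivial

/-- Subtracting half of each signed jump from `coverIndex` leaves a locally constant function.
Comparing its values at `0` and `T`, an interior crossing is counted with weight one half from each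
end, while an end point is counted from one side only because `sign 0 = 0`; these are the
Robbin–Salamon weights. -/
theorem crossingSum_eq_coverIndex {T : ℝ} {Ψ : ℝ → Matrix (Fin 2) (Fin 2) ℝ}
    (h : IsRegularPath T Ψ) {θ : ℝ → ℝ} (hθ : ContinuousOn θ (Icc 0 T))
    (ha : ∀ t ∈ Icc 0 T, IsAngle (Ψ t) (θ t)) (h0 : θ 0 = 0) :
    crossingSum T Ψ = coverIndex (Ψ T).trace (θ T) := by
  classical
  have hT := h.pos
  set S := h.finite.toFinset
  have hS : ∀ c, c ∈ S ↔ c ∈ crossings T Ψ := fun c => h.finite.mem_toFinset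
  set s : ℝ → ℚ := fun c => crossingSign T Ψ c with hs
  have hs0 : ∀ c ∈ Icc 0 T, c ∉ S → s c = 0 := by
    intro c hc hcS
    simp only [hs]
    rw [crossingSign_eq_zero (fun h' => hcS ((hS c).2 ⟨hc, h'⟩))]
    simp
  have key := eq_of_eventually_eq_Icc hT.le (f := fun t => coverIndex (Ψ t).trace (θ t)
      - ∑ c ∈ S, (SignType.sign (t - c) : ℚ) * s c / 2) (by
    intro t₀ ht₀
    have hsum : ∀ᶠ t in 𝓝[Icc 0 T] t₀, ∀ c ∈ S, c ≠ t₀ →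
        SignType.sign (t - c) = SignType.sign (t₀ - c) := by
      rw [Filter.eventually_all_finset]
      intro c _
      by_cases hc : c = t₀
      · exact Filter.Eventually.of_forall fun t h' => absurd hc h'
      · have ht : Filter.Tendsto (fun t => t - c) (𝓝[Icc 0 T] t₀) (𝓝 (t₀ - c)) :=
          ((continuous_id.sub continuous_const).tendsto t₀).mono_left nhdsWithin_le_nhds
        rcases lt_or_gt_of_ne hc with hc | hc
        · filter_upwards [ht.eventually_const_lt (sub_pos.2 hc)] with t h1 _
          rw [sign_pos h1, sign_pos (sub_pos.2 hc)]
        · filter_upwards [ht.eventually_lt_const (sub_neg.2 hc)] with t h1 _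
          rw [sign_neg h1, sign_neg (sub_neg.2 hc)]
    filter_upwards [eventually_coverIndex h hθ ha ht₀, hsum] with t h1 h2
    rw [h1]
    by_cases htS : t₀ ∈ S
    · rw [← Finset.add_sum_erase S _ htS, ← Finset.add_sum_erase S
        (fun c => (SignType.sign (t₀ - c) : ℚ) * s c / 2) htS, Finset.sum_congr rfl
        (g := fun c => (SignType.sign (t₀ - c) : ℚ) * s c / 2)]
      · simp only [hs, sub_self, sign_zero, SignType.coe_zero]
        ring
      · intro c hc
        rw [h2 c (Finset.mem_of_mem_erase hc) (Finset.ne_of_mem_erase hc)]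
    · have : (crossingSign T Ψ t₀ : ℚ) = 0 := hs0 t₀ ht₀ htS
      rw [this, Finset.sum_congr rfl (g := fun c => (SignType.sign (t₀ - c) : ℚ) * s c / 2)]
      · simp
      · intro c hc
        rw [h2 c hc (by rintro rfl; exact htS hc)])
  have hzero : coverIndex (Ψ 0).trace (θ 0) = 0 := by
    rw [h.zero, h0]
    simp [coverIndex]
  rw [hzero] at key
  have hfin : ∑ᶠ t ∈ crossings T Ψ ∩ Ioo 0 T, (crossingSign T Ψ t : ℚ)
      = ∑ c ∈ S, if c ∈ Ioo 0 T then s c else 0 := by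
    have : crossings T Ψ ∩ Ioo 0 T = ↑(S.filter (· ∈ Ioo 0 T)) := by
      ext c
      rw [Finset.coe_filter, mem_ofPred_eq, hS, mem_inter_iff]
    rw [← Finset.sum_filter, this, finsum_mem_coe_finset]
  have h1 : ∑ c ∈ S, (if c = 0 then s 0 else 0) = s 0 := by
    rw [Finset.sum_ite_eq']
    split_ifs with hc
    · rfl
    · exact (hs0 0 (left_mem_Icc.2 hT.le) hc).symm
  have h2 : ∑ c ∈ S, (if c = T then s T else 0) = s T := by
    rw [Finset.sum_ite_eq']
    split_ifs with hc
    · rfl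
    · exact (hs0 T (right_mem_Icc.2 hT.le) hc).symm
  rw [crossingSum, hfin]
  change 1 / 2 * s 0 + _ + 1 / 2 * s T = _
  rw [← h1, ← h2]
  rw [sub_eq_iff_eq_add] at key
  rw [key, Finset.mul_sum, Finset.mul_sum, ← Finset.sum_add_distrib, ← Finset.sum_add_distrib,
    zero_sub, neg_add_eq_sub, ← Finset.sum_sub_distrib]
  refine Finset.sum_congr rfl fun c hc => ?_
  have hcI : c ∈ Icc 0 T := ((hS c).1 hc).1
  by_cases hc0 : c = 0
  · rw [hc0]
    simp [hT.ne, hT]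
    ring
  · by_cases hcT : c = T
    · rw [hcT]
      simp [hT.ne', hT]
      ring
    · have ha : 0 < c := lt_of_le_of_ne hcI.1 (Ne.symm hc0)
      have hb : c < T := lt_of_le_of_ne hcI.2 hcT
      simp [hc0, hcT, ha, hb]
      ring

/-! ## Angles along paths and homotopies -/

/-- In the form `z ↦ a z + b z̄` one has `a = trace/2 + i rotPart`, and the determinant is `|a|² -
|b|²`. In particular `|a| ≥ 1`, so `a` has an argument, and its modulus is determined by `b`. -/
theorem sq_add_sq_of_det {M : Matrix (Fin 2) (Fin 2) ℝ} (h : M.det = 1) :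
    (M.trace / 2) ^ 2 + rotPart M ^ 2 =
      1 + ((M 0 0 - M 1 1) / 2) ^ 2 + ((M 0 1 + M 1 0) / 2) ^ 2 := by
  rw [Matrix.det_fin_two] at h
  rw [Matrix.trace_fin_two, rotPart]
  linear_combination h

theorem IsAngle.radius {M : Matrix (Fin 2) (Fin 2) ℝ} {θ : ℝ} (h : M.det = 1)
    (ha : IsAngle M θ) :
    M.trace / 2 = √(1 + ((M 0 0 - M 1 1) / 2) ^ 2 + ((M 0 1 + M 1 0) / 2) ^ 2) * Real.cos θ ∧
    rotPart M = √(1 + ((M 0 0 - M 1 1) / 2) ^ 2 + ((M 0 1 + M 1 0) / 2) ^ 2) * Real.sin θ := by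
  obtain ⟨r, hr, hx, hy⟩ := ha
  have hr' : √(1 + ((M 0 0 - M 1 1) / 2) ^ 2 + ((M 0 1 + M 1 0) / 2) ^ 2) = r := by
    rw [← sq_add_sq_of_det h, hx, hy, ← Real.sqrt_sq (show 0 ≤ r by linarith)]
    congr 1
    rw [Real.sqrt_sq (show 0 ≤ r by linarith)]
    linear_combination r ^ 2 * Real.sin_sq_add_cos_sq θ
  rw [hr']
  exact ⟨by linarith, hy⟩

theorem isAngle_of_exp {M : Matrix (Fin 2) (Fin 2) ℝ} (h : M.det = 1) {θ r : ℝ} (hr : 0 < r)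
    (hx : M.trace = 2 * (r * Real.cos θ)) (hy : rotPart M = r * Real.sin θ) : IsAngle M θ := by
  refine ⟨r, ?_, hx, hy⟩
  have h1 := sq_add_sq_of_det h
  rw [hx, hy] at h1
  have h2 : r ^ 2 = 1 + ((M 0 0 - M 1 1) / 2) ^ 2 + ((M 0 1 + M 1 0) / 2) ^ 2 := by
    rw [← h1]
    linear_combination (- r ^ 2) * Real.sin_sq_add_cos_sq θ
  nlinarith [sq_nonneg ((M 0 0 - M 1 1) / 2), sq_nonneg ((M 0 1 + M 1 0) / 2)]

theorem isAngle_one : IsAngle 1 0 := ⟨1, le_rfl, by simp, by simp [rotPart]⟩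

theorem IsAngle.eq_add {M : Matrix (Fin 2) (Fin 2) ℝ} {a b : ℝ}
    (ha : IsAngle M a) (hb : IsAngle M b) : ∃ n : ℤ, a = b + n * (2 * Real.pi) := by
  obtain ⟨r, hr, hx, hy⟩ := ha
  obtain ⟨r', hr', hx', hy'⟩ := hb
  have h1 : r * Real.cos a = r' * Real.cos b := by linarith
  have h2 : r * Real.sin a = r' * Real.sin b := by rw [← hy, hy']
  have h3 : r ^ 2 = r' ^ 2 := by
    have e1 := Real.sin_sq_add_cos_sq a
    have e2 := Real.sin_sq_add_cos_sq b
    linear_combination (r * Real.cos a + r' * Real.cos b) * h1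
      + (r * Real.sin a + r' * Real.sin b) * h2 - r ^ 2 * e1 + r' ^ 2 * e2
  have h4 : r = r' := by nlinarith
  subst h4
  have hr0 : r ≠ 0 := by linarith
  have hcos : Real.cos (a - b) = 1 := by
    rw [Real.cos_sub, mul_left_cancel₀ hr0 h1, mul_left_cancel₀ hr0 h2]
    linear_combination Real.sin_sq_add_cos_sq b
  obtain ⟨n, hn⟩ := (Real.cos_eq_one_iff _).1 hcos
  exact ⟨n, by linarith⟩

theorem eq_of_continuousOn_of_int_mul {T : ℝ} (hT : 0 ≤ T) {f : ℝ → ℝ}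
    (hf : ContinuousOn f (Icc 0 T))
    (h : ∀ t ∈ Icc 0 T, ∃ n : ℤ, f t = f 0 + n * (2 * Real.pi)) : f T = f 0 := by
  refine eq_of_eventually_eq_Icc hT fun t₀ ht₀ => ?_
  have hpi := Real.pi_pos
  have hc : Filter.Tendsto (fun t => |f t - f t₀|) (𝓝[Icc 0 T] t₀) (𝓝 |f t₀ - f t₀|) :=
    ((hf t₀ ht₀).sub_const _).abs
  rw [sub_self, abs_zero] at hc
  filter_upwards [hc.eventually_lt_const (show (0 : ℝ) < 2 * Real.pi by positivity),
    self_mem_nhdsWithin] with t h1 h2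
  obtain ⟨n, hn⟩ := h t h2
  obtain ⟨m, hm⟩ := h t₀ ht₀
  have h3 : f t - f t₀ = ((n - m : ℤ) : ℝ) * (2 * Real.pi) := by rw [hn, hm]; push_cast; ring
  rw [h3, abs_mul, abs_of_pos (by positivity : (0 : ℝ) < 2 * Real.pi)] at h1
  have h4 : |((n - m : ℤ) : ℝ)| < 1 := by
    by_contra! hc'
    nlinarith
  have h5 : n - m = 0 := by
    rw [← Int.cast_abs] at h4
    exact Int.abs_lt_one_iff.1 (by exact_mod_cast h4)
  rw [h5] at h3
  simp at h3
  linarith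

/-- The complex linear part never vanishes, so its direction is a map from the plane to the circle,
and it lifts through the covering `Circle.exp` because the plane is simply connected. -/
theorem exists_angle {h : ℝ × ℝ → Matrix (Fin 2) (Fin 2) ℝ} (hc : Continuous h)
    (hdet : ∀ q, (h q).det = 1) (h0 : h (0, 0) = 1) :
    ∃ θ : ℝ × ℝ → ℝ, Continuous θ ∧ θ (0, 0) = 0 ∧ ∀ q, IsAngle (h q) (θ q) := by
  set z : ℝ × ℝ → ℂ := fun q => ⟨(h q).trace / 2, rotPart (h q)⟩
  have hzc : Continuous z := by
    have h1 : Continuous fun q => (h q).trace / 2 := hc.matrix_trace.div_const 2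
    have h2 : Continuous fun q => rotPart (h q) := by
      have := fun i j => hc.matrix_elem i j
      unfold rotPart
      fun_prop
    exact Complex.equivRealProdCLM.symm.continuous.comp (h1.prodMk h2)
  have hz : ∀ q, z q ≠ 0 := by
    intro q hq
    have h1 := sq_add_sq_of_det (hdet q)
    have h2 : (h q).trace / 2 = 0 := congrArg Complex.re hq
    have h3 : rotPart (h q) = 0 := congrArg Complex.im hq
    rw [h2, h3] at h1
    nlinarith [sq_nonneg ((h q 0 0 - h q 1 1) / 2), sq_nonneg ((h q 0 1 + h q 1 0) / 2)]
  have hn : ∀ q, ‖z q‖ ≠ 0 := fun q => norm_ne_zero_iff.2 (hz q)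
  have hmem : ∀ q, z q / (‖z q‖ : ℂ) ∈ Submonoid.unitSphere ℂ := fun q => by
    rw [Submonoid.unitSphere]
    simp [hz q]
  obtain ⟨f, hf⟩ : ∃ f : C(ℝ × ℝ, Circle), ∀ q, (f q : ℂ) = z q / (‖z q‖ : ℂ) :=
    ⟨⟨fun q => ⟨_, hmem q⟩, Continuous.subtype_mk
      (hzc.div (Complex.continuous_ofReal.comp hzc.norm)
        fun q => Complex.ofReal_ne_zero.2 (hn q)) _⟩, fun q => rfl⟩
  have hf0 : Circle.exp 0 = f (0, 0) := by
    apply Circle.ext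
    have hz1 : z (0, 0) = 1 := by
      apply Complex.ext <;> simp [z, h0, rotPart]
    rw [hf, hz1]
    simp
  obtain ⟨θ, ⟨hθ0, hθ⟩, -⟩ :=
    Circle.isCoveringMap_exp.existsUnique_continuousMap_lifts f (0, 0) 0 hf0
  refine ⟨θ, θ.continuous, hθ0, fun q => ?_⟩
  have h1 : Circle.exp (θ q) = f q := congrFun hθ q
  have h2 : Complex.exp (θ q * Complex.I) = z q / (‖z q‖ : ℂ) := by
    have := congrArg (Subtype.val) h1
    rw [← hf, ← this]
    simp
  have h3 : z q = ‖z q‖ * Complex.exp (θ q * Complex.I) := by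
    rw [h2, mul_div_cancel₀]
    exact_mod_cast hn q
  refine isAngle_of_exp (hdet q) (norm_pos_iff.2 (hz q)) ?_ ?_
  · have := congrArg Complex.re h3
    rw [Complex.re_ofReal_mul, Complex.exp_ofReal_mul_I_re] at this
    have h4 : (z q).re = (h q).trace / 2 := rfl
    linarith
  · have := congrArg Complex.im h3
    rw [Complex.im_ofReal_mul, Complex.exp_ofReal_mul_I_im] at this
    exact this

theorem exists_angle_of_continuousOn {T : ℝ} (hT : 0 ≤ T)
    {h : ℝ × ℝ → Matrix (Fin 2) (Fin 2) ℝ} (hc : ContinuousOn h (Icc 0 1 ×ˢ Icc 0 T))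
    (hdet : ∀ q ∈ Icc (0 : ℝ) 1 ×ˢ Icc 0 T, (h q).det = 1) (h0 : h (0, 0) = 1) :
    ∃ θ : ℝ × ℝ → ℝ, Continuous θ ∧ θ (0, 0) = 0 ∧
      ∀ q ∈ Icc (0 : ℝ) 1 ×ˢ Icc 0 T, IsAngle (h q) (θ q) := by
  -- The retraction of the plane onto the rectangle extends `h` continuously without leaving its
  -- image on the rectangle.
  set c : ℝ × ℝ → ℝ × ℝ := fun q =>
    ((projIcc (0 : ℝ) 1 zero_le_one q.1 : ℝ), (projIcc 0 T hT q.2 : ℝ)) with hcdef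
  have hcc : Continuous c :=
    ((continuous_subtype_val.comp continuous_projIcc).comp continuous_fst).prodMk
      ((continuous_subtype_val.comp continuous_projIcc).comp continuous_snd)
  have hcm : ∀ q, c q ∈ Icc (0 : ℝ) 1 ×ˢ Icc 0 T := fun q =>
    ⟨(projIcc (0 : ℝ) 1 zero_le_one q.1).2, (projIcc 0 T hT q.2).2⟩
  have hcid : ∀ q ∈ Icc (0 : ℝ) 1 ×ˢ Icc 0 T, c q = q := by
    intro q hq
    simp only [hcdef, projIcc_of_mem _ hq.1, projIcc_of_mem _ hq.2]
  obtain ⟨θ, h1, h2, h3⟩ := exists_angle (h := h ∘ c) (hc.comp_continuous hcc hcm)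
    (fun q => hdet _ (hcm q)) (by
      rw [Function.comp, hcid _ ⟨left_mem_Icc.2 zero_le_one, left_mem_Icc.2 hT⟩, h0])
  refine ⟨θ, h1, h2, fun q hq => ?_⟩
  have := h3 q
  rwa [Function.comp, hcid q hq] at this

/-- `θ` is the continuous angle along `Ψ` starting at `0`. -/
structure IsAngleLift (T : ℝ) (Ψ : ℝ → Matrix (Fin 2) (Fin 2) ℝ) (θ : ℝ → ℝ) : Prop where
  continuousOn : ContinuousOn θ (Icc 0 T)
  zero : θ 0 = 0
  isAngle : ∀ t ∈ Icc 0 T, IsAngle (Ψ t) (θ t)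

theorem IsSpPath.exists_isAngleLift {T : ℝ} {Ψ : ℝ → Matrix (Fin 2) (Fin 2) ℝ}
    (h : IsSpPath T Ψ) : ∃ θ, IsAngleLift T Ψ θ := by
  obtain ⟨θ, h1, h2, h3⟩ := exists_angle_of_continuousOn h.pos.le (h := fun q => Ψ q.2)
    (h.continuousOn.comp continuousOn_snd fun q hq => hq.2) (fun q hq => h.det _ hq.2) h.zero
  exact ⟨fun t => θ (0, t), (by fun_prop : Continuous fun t => θ (0, t)).continuousOn, h2,
    fun t ht => h3 (0, t) ⟨left_mem_Icc.2 zero_le_one, ht⟩⟩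

theorem IsAngleLift.unique {T : ℝ} (hT : 0 ≤ T) {Ψ : ℝ → Matrix (Fin 2) (Fin 2) ℝ}
    {θ θ' : ℝ → ℝ} (h : IsAngleLift T Ψ θ) (h' : IsAngleLift T Ψ θ') : θ T = θ' T := by
  have := eq_of_continuousOn_of_int_mul hT (h.continuousOn.sub h'.continuousOn) (by
    intro t ht
    obtain ⟨n, hn⟩ := (h.isAngle t ht).eq_add (h'.isAngle t ht)
    exact ⟨n, by simp [h.zero, h'.zero]; linarith⟩)
  simp [h.zero, h'.zero] at this
  linarith

/-- Lift the angle over the whole homotopy. Along the two sides where the matrix is fixed it can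
only move by multiples of `2π`, so by continuity it is constant there. -/
theorem SpHomotopic.exists_isAngleLift {T : ℝ} (hT : 0 ≤ T)
    {Ψ Ψ' : ℝ → Matrix (Fin 2) (Fin 2) ℝ} {θ : ℝ → ℝ} (hθ : IsAngleLift T Ψ θ)
    (h0 : Ψ 0 = 1) (h : SpHomotopic T Ψ Ψ') :
    ∃ θ', IsAngleLift T Ψ' θ' ∧ θ' T = θ T := by
  obtain ⟨h, hc, hdet, h01, hends⟩ := h
  have hl : (0 : ℝ) ∈ Icc (0 : ℝ) 1 := left_mem_Icc.2 zero_le_one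
  have hr : (1 : ℝ) ∈ Icc (0 : ℝ) 1 := right_mem_Icc.2 zero_le_one
  have hl' : (0 : ℝ) ∈ Icc 0 T := left_mem_Icc.2 hT
  have hr' : T ∈ Icc 0 T := right_mem_Icc.2 hT
  obtain ⟨Θ, h1, h2, h3⟩ := exists_angle_of_continuousOn hT hc hdet (by rw [(h01 0 hl').1, h0])
  have hstart : ∀ t : ℝ, (∀ s ∈ Icc (0 : ℝ) 1, IsAngle (h (0, t)) (Θ (s, t))) →
      Θ (1, t) = Θ (0, t) := fun t ht =>
    eq_of_continuousOn_of_int_mul (f := fun s => Θ (s, t)) zero_le_one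
      (by fun_prop : Continuous fun s => Θ (s, t)).continuousOn
      fun s hs => (ht s hs).eq_add (ht 0 hl)
  have e0 := hstart 0 fun s hs => by
    rw [(hends 0 hl).1, ← (hends s hs).1]
    exact h3 (s, 0) ⟨hs, hl'⟩
  have eT := hstart T fun s hs => by
    rw [(hends 0 hl).2, ← (hends s hs).2]
    exact h3 (s, T) ⟨hs, hr'⟩
  refine ⟨fun t => Θ (1, t), ⟨(by fun_prop : Continuous fun t => Θ (1, t)).continuousOn,
    by rw [e0, h2], fun t ht => ?_⟩, ?_⟩
  · rw [← (h01 t ht).2]; exact h3 (1, t) ⟨hr, ht⟩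
  · change Θ (1, T) = θ T
    rw [eT]
    refine IsAngleLift.unique hT (θ := fun t => Θ (0, t)) (Ψ := Ψ)
      ⟨(by fun_prop : Continuous fun t => Θ (0, t)).continuousOn, h2, fun t ht => ?_⟩ hθ
    rw [← (h01 t ht).1]; exact h3 (0, t) ⟨hl, ht⟩

/-- The element of `Sp(2)` with angle `θ` and complex antilinear part `u + i v`. -/
noncomputable def spOfCover (θ u v : ℝ) : Matrix (Fin 2) (Fin 2) ℝ :=
  !![√(1 + u ^ 2 + v ^ 2) * Real.cos θ + u, v - √(1 + u ^ 2 + v ^ 2) * Real.sin θ;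
    v + √(1 + u ^ 2 + v ^ 2) * Real.sin θ, √(1 + u ^ 2 + v ^ 2) * Real.cos θ - u]

theorem det_spOfCover (θ u v : ℝ) : (spOfCover θ u v).det = 1 := by
  have h := Real.sq_sqrt (show 0 ≤ 1 + u ^ 2 + v ^ 2 by positivity)
  rw [spOfCover, Matrix.det_fin_two_of]
  linear_combination √(1 + u ^ 2 + v ^ 2) ^ 2 * Real.sin_sq_add_cos_sq θ + h

theorem spOfCover_eq {M : Matrix (Fin 2) (Fin 2) ℝ} (h : M.det = 1) {θ : ℝ} (ha : IsAngle M θ) :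
    spOfCover θ ((M 0 0 - M 1 1) / 2) ((M 0 1 + M 1 0) / 2) = M := by
  obtain ⟨h1, h2⟩ := ha.radius h
  rw [spOfCover, ← h1, ← h2, Matrix.trace_fin_two, rotPart]
  ext i j
  fin_cases i <;> fin_cases j <;> simp <;> ring

theorem continuous_spOfCover : Continuous fun p : ℝ × ℝ × ℝ => spOfCover p.1 p.2.1 p.2.2 := by
  refine continuous_matrix fun i j => ?_
  fin_cases i <;> fin_cases j <;> simp only [spOfCover] <;> simp <;> fun_prop

theorem continuousOn_spOfCover {s : Set (ℝ × ℝ)} {a b c : ℝ × ℝ → ℝ} (ha : ContinuousOn a s)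
    (hb : ContinuousOn b s) (hc : ContinuousOn c s) :
    ContinuousOn (fun q => spOfCover (a q) (b q) (c q)) s :=
  continuous_spOfCover.comp_continuousOn (f := fun q => (a q, b q, c q))
    (ha.prodMk (hb.prodMk hc))

/-- The coordinates `(θ, u, v)` identify the universal cover with `ℝ³`; there the two lifted paths
have the same ends and are joined by straight-line interpolation. -/
theorem spHomotopic_of_angle_eq {T : ℝ} {Ψ Ψ' : ℝ → Matrix (Fin 2) (Fin 2) ℝ}
    (h : IsSpPath T Ψ) (h' : IsSpPath T Ψ') {θ θ' : ℝ → ℝ} (hθ : IsAngleLift T Ψ θ)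
    (hθ' : IsAngleLift T Ψ' θ') (hT : θ T = θ' T) (hΨ : Ψ T = Ψ' T) : SpHomotopic T Ψ Ψ' := by
  have hTm : T ∈ Icc 0 T := right_mem_Icc.2 h.pos.le
  set u : (ℝ → Matrix (Fin 2) (Fin 2) ℝ) → ℝ → ℝ := fun Φ t => (Φ t 0 0 - Φ t 1 1) / 2 with hu
  set v : (ℝ → Matrix (Fin 2) (Fin 2) ℝ) → ℝ → ℝ := fun Φ t => (Φ t 0 1 + Φ t 1 0) / 2 with hv
  have huc : ∀ Φ, ContinuousOn Φ (Icc 0 T) → ContinuousOn (u Φ) (Icc 0 T) := by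
    intro Φ hΦ
    have := fun i j => (continuous_id.matrix_elem i j).comp_continuousOn hΦ
    exact ((this 0 0).sub (this 1 1)).div_const 2
  have hvc : ∀ Φ, ContinuousOn Φ (Icc 0 T) → ContinuousOn (v Φ) (Icc 0 T) := by
    intro Φ hΦ
    have := fun i j => (continuous_id.matrix_elem i j).comp_continuousOn hΦ
    exact ((this 0 1).add (this 1 0)).div_const 2
  have hmix : ∀ f g : ℝ → ℝ, ContinuousOn f (Icc 0 T) → ContinuousOn g (Icc 0 T) →
      ContinuousOn (fun q : ℝ × ℝ => (1 - q.1) * f q.2 + q.1 * g q.2)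
        (Icc (0 : ℝ) 1 ×ˢ Icc 0 T) := by
    intro f g hf hg
    have hf' := hf.comp (continuousOn_snd (s := Icc (0 : ℝ) 1 ×ˢ Icc 0 T)) fun q hq => hq.2
    have hg' := hg.comp (continuousOn_snd (s := Icc (0 : ℝ) 1 ×ˢ Icc 0 T)) fun q hq => hq.2
    exact ((continuousOn_const.sub continuousOn_fst).mul hf').add (continuousOn_fst.mul hg')
  refine ⟨fun q => spOfCover ((1 - q.1) * θ q.2 + q.1 * θ' q.2)
    ((1 - q.1) * u Ψ q.2 + q.1 * u Ψ' q.2) ((1 - q.1) * v Ψ q.2 + q.1 * v Ψ' q.2), ?_, ?_, ?_, ?_⟩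
  · have e1 := hmix _ _ hθ.continuousOn hθ'.continuousOn
    have e2 := hmix _ _ (huc _ h.continuousOn) (huc _ h'.continuousOn)
    have e3 := hmix _ _ (hvc _ h.continuousOn) (hvc _ h'.continuousOn)
    exact continuousOn_spOfCover e1 e2 e3
  · exact fun q _ => det_spOfCover _ _ _
  · intro t ht
    refine ⟨?_, ?_⟩
    · simpa using spOfCover_eq (h.det t ht) (hθ.isAngle t ht)
    · simpa using spOfCover_eq (h'.det t ht) (hθ'.isAngle t ht)
  · intro s hs
    refine ⟨?_, ?_⟩
    · simp only [hθ.zero, hθ'.zero, hu, hv, h.zero, h'.zero]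
      simpa using spOfCover_eq (M := 1) (by simp) isAngle_one
    · have h1 : ∀ a : ℝ, (1 - s) * a + s * a = a := fun a => by ring
      simp only [← hT, hu, hv, ← hΨ, h1]
      exact spOfCover_eq (h.det T hTm) (hθ.isAngle T hTm)

/-- Uniqueness is automatic, since every homotopic regular path has the same lifted end point and
hence the same count. Only existence needs input: a regular `Ψ'` with that lifted end point. -/
theorem isRSIndex_coverIndex {T : ℝ} {Ψ Ψ' : ℝ → Matrix (Fin 2) (Fin 2) ℝ}
    (h : IsSpPath T Ψ) (h' : IsRegularPath T Ψ') {θ θ' : ℝ → ℝ} (hθ : IsAngleLift T Ψ θ)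
    (hθ' : IsAngleLift T Ψ' θ') (hT : θ T = θ' T) (hΨ : Ψ T = Ψ' T) :
    IsRSIndex T Ψ (coverIndex (Ψ T).trace (θ T)) := by
  refine ⟨h, ⟨Ψ', h', spHomotopic_of_angle_eq h h'.toIsSpPath hθ hθ' hT hΨ⟩, ?_⟩
  intro Φ hΦ hhom
  obtain ⟨φ, hφ, hφT⟩ := hhom.exists_isAngleLift h.pos.le hθ h.zero
  have hΦT : Φ T = Ψ T := by
    obtain ⟨k, -, -, h01, hends⟩ := hhom
    rw [← (h01 T (right_mem_Icc.2 h.pos.le)).2, (hends 1 (right_mem_Icc.2 zero_le_one)).2]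
  rw [crossingSum_eq_coverIndex hΦ hφ.continuousOn hφ.isAngle hφ.zero, hφT, hΦT]

/-! ## Products with loops -/

theorem IsAngle.add_int_mul {M : Matrix (Fin 2) (Fin 2) ℝ} {θ : ℝ} (h : IsAngle M θ) (n : ℤ) :
    IsAngle M (θ + n * (2 * Real.pi)) := by
  obtain ⟨r, hr, hx, hy⟩ := h
  exact ⟨r, hr, by rw [hx, Real.cos_add_int_mul_two_pi], by rw [hy, Real.sin_add_int_mul_two_pi]⟩

theorem isAngle_one_iff {θ : ℝ} : IsAngle 1 θ ↔ ∃ n : ℤ, θ = n * (2 * Real.pi) := by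
  constructor
  · intro h
    obtain ⟨n, hn⟩ := h.eq_add isAngle_one
    exact ⟨n, by rw [hn, zero_add]⟩
  · rintro ⟨n, rfl⟩
    simpa using isAngle_one.add_int_mul n

theorem IsSpPath.mul {T : ℝ} {L E : ℝ → Matrix (Fin 2) (Fin 2) ℝ} (hL : IsSpPath T L)
    (hE : IsSpPath T E) : IsSpPath T fun t => L t * E t where
  pos := hL.pos
  continuousOn := hL.continuousOn.mul hE.continuousOn
  det t ht := by rw [Matrix.det_mul, hL.det t ht, hE.det t ht, one_mul]
  zero := by rw [hL.zero, hE.zero, one_mul]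

/-- Angles are not additive under products in general, but the family `L(t) E(st)` deforms `L` into
`L E`. Its edge at `t = T` runs through `E(sT)` because `L(T) = 1`, so following the angle along `s
= 0` and then along this edge adds the two final angles. -/
theorem exists_isAngleLift_mul {T : ℝ} {L E : ℝ → Matrix (Fin 2) (Fin 2) ℝ} (hL : IsSpPath T L)
    (hLT : L T = 1) (hE : IsSpPath T E) {θL θE : ℝ → ℝ} (hθL : IsAngleLift T L θL)
    (hθE : IsAngleLift T E θE) :
    ∃ θ, IsAngleLift T (fun t => L t * E t) θ ∧ θ T = θL T + θE T := by
  have hT := hL.pos.le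
  have hl : (0 : ℝ) ∈ Icc (0 : ℝ) 1 := left_mem_Icc.2 zero_le_one
  have hr : (1 : ℝ) ∈ Icc (0 : ℝ) 1 := right_mem_Icc.2 zero_le_one
  have hl' : (0 : ℝ) ∈ Icc 0 T := left_mem_Icc.2 hT
  have hr' : T ∈ Icc 0 T := right_mem_Icc.2 hT
  have hst : ∀ q ∈ Icc (0 : ℝ) 1 ×ˢ Icc 0 T, q.1 * q.2 ∈ Icc 0 T := fun q hq =>
    ⟨mul_nonneg hq.1.1 hq.2.1, (mul_le_of_le_one_left hq.2.1 hq.1.2).trans hq.2.2⟩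
  obtain ⟨Θ, h1, h2, h3⟩ := exists_angle_of_continuousOn hT
    (h := fun q => L q.2 * E (q.1 * q.2))
    ((hL.continuousOn.comp continuousOn_snd fun q hq => hq.2).mul
      (hE.continuousOn.comp (by fun_prop) hst))
    (fun q hq => by rw [Matrix.det_mul, hL.det _ hq.2, hE.det _ (hst q hq), one_mul])
    (by simp [hL.zero, hE.zero])
  have hΘ0 : Θ (0, T) = θL T := by
    refine IsAngleLift.unique hT (θ := fun t => Θ (0, t))
      ⟨(by fun_prop : Continuous fun t => Θ (0, t)).continuousOn, h2, fun t ht => ?_⟩ hθL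
    simpa [hE.zero] using h3 (0, t) ⟨hl, ht⟩
  have hs0 : Θ (1, 0) = Θ (0, 0) := by
    refine eq_of_continuousOn_of_int_mul (f := fun s => Θ (s, 0)) zero_le_one
      (by fun_prop : Continuous fun s => Θ (s, 0)).continuousOn fun s hs => ?_
    have h4 := h3 (s, 0) ⟨hs, hl'⟩
    simp only [hL.zero, mul_zero, hE.zero, mul_one, isAngle_one_iff] at h4
    simpa [h2] using h4
  obtain ⟨n, hn⟩ := isAngle_one_iff.1 (show IsAngle 1 (Θ (0, T)) by
    simpa [hLT, hE.zero] using h3 (0, T) ⟨hl, hr'⟩)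
  have hsT : Θ (1, T) - Θ (0, T) = θE (1 * T) := by
    refine IsAngleLift.unique (Ψ := fun s => E (s * T)) zero_le_one
      (θ := fun s => Θ (s, T) - Θ (0, T)) (θ' := fun s => θE (s * T))
      ⟨(by fun_prop : Continuous fun s => Θ (s, T) - Θ (0, T)).continuousOn, sub_self _,
        fun s hs => ?_⟩
      ⟨hθE.continuousOn.comp (by fun_prop) fun s hs => hst (s, T) ⟨hs, hr'⟩, by
        simp [hθE.zero], fun s hs => hθE.isAngle _ (hst (s, T) ⟨hs, hr'⟩)⟩
    have h4 := (show IsAngle (E (s * T)) (Θ (s, T)) by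
      simpa [hLT] using h3 (s, T) ⟨hs, hr'⟩).add_int_mul (-n)
    rw [hn]
    convert h4 using 1
    push_cast; ring
  refine ⟨fun t => Θ (1, t), ⟨(by fun_prop : Continuous fun t => Θ (1, t)).continuousOn,
    by rw [hs0, h2], fun t ht => by simpa using h3 (1, t) ⟨hr, ht⟩⟩, ?_⟩
  rw [one_mul] at hsT
  linarith

theorem coverIndex_add_int_mul (τ θ : ℝ) (n : ℤ) :
    coverIndex τ (n * (2 * Real.pi) + θ) = 2 * n + coverIndex τ θ := by
  have hpi := Real.pi_pos
  have h : (n * (2 * Real.pi) + θ) / (2 * Real.pi) = θ / (2 * Real.pi) + n := by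
    field_simp; ring
  have h2 : n * (2 * Real.pi) + θ - 2 * Real.pi * ((round (θ / (2 * Real.pi)) + n : ℤ) : ℝ)
      = θ - 2 * Real.pi * round (θ / (2 * Real.pi)) := by push_cast; ring
  rw [coverIndex, coverIndex, h, Int.floor_add_intCast, round_add_intCast, h2]
  split_ifs <;> push_cast <;> ring

/-! ## One-parameter subgroups and regular representatives -/

/-- `E` is the one-parameter subgroup of `Sp(2)` generated by `A`. -/
structure IsOneParam (A : Matrix (Fin 2) (Fin 2) ℝ) (E : ℝ → Matrix (Fin 2) (Fin 2) ℝ) :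
    Prop where
  zero : E 0 = 1
  det : ∀ t, (E t).det = 1
  hasDerivAt : ∀ t i j, HasDerivAt (fun s => E s i j) ((E t * A) i j) t

namespace IsOneParam

variable {A : Matrix (Fin 2) (Fin 2) ℝ} {E : ℝ → Matrix (Fin 2) (Fin 2) ℝ}

theorem contDiff (h : IsOneParam A E) (i j : Fin 2) : ContDiff ℝ 1 fun t => E t i j := by
  have hc : ∀ i j, Continuous fun t => E t i j := fun i j =>
    continuous_iff_continuousAt.2 fun t => (h.hasDerivAt t i j).continuousAt
  refine contDiff_one_iff_deriv.2 ⟨fun t => (h.hasDerivAt t i j).differentiableAt, ?_⟩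
  have : deriv (fun t => E t i j) = fun t => (E t * A) i j := funext fun t =>
    (h.hasDerivAt t i j).deriv
  rw [this]
  simp only [Matrix.mul_apply]
  fun_prop

theorem isSpPath (h : IsOneParam A E) {T : ℝ} (hT : 0 < T) : IsSpPath T E where
  pos := hT
  continuousOn := (continuous_matrix fun i j => (h.contDiff i j).continuous).continuousOn
  det t _ := h.det t
  zero := h.zero

end IsOneParam

theorem isOneParam_const : IsOneParam 0 fun _ => 1 where
  zero := rfl
  det t := by simp
  hasDerivAt t i j := by simpa using hasDerivAt_const t ((1 : Matrix (Fin 2) (Fin 2) ℝ) i j)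

theorem sq_of_trace_eq_zero {A : Matrix (Fin 2) (Fin 2) ℝ} (h : A.trace = 0) :
    A * A = -A.det • (1 : Matrix (Fin 2) (Fin 2) ℝ) := by
  rw [Matrix.trace_fin_two] at h
  have h1 : A 1 1 = - A 0 0 := by linarith
  ext i j
  rw [Matrix.mul_apply, Fin.sum_univ_two, Matrix.det_fin_two, h1]
  fin_cases i <;> fin_cases j <;> simp [h1] <;> ring

theorem det_smul_one_add {A : Matrix (Fin 2) (Fin 2) ℝ} (h : A.trace = 0) (a b : ℝ) :
    (a • (1 : Matrix (Fin 2) (Fin 2) ℝ) + b • A).det = a ^ 2 + b ^ 2 * A.det := by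
  rw [Matrix.trace_fin_two] at h
  have h1 : A 1 1 = - A 0 0 := by linarith
  simp [Matrix.det_fin_two, h1]
  ring

theorem trace_smul_one_add {A : Matrix (Fin 2) (Fin 2) ℝ} (h : A.trace = 0) (a b : ℝ) :
    (a • (1 : Matrix (Fin 2) (Fin 2) ℝ) + b • A).trace = 2 * a := by
  simp [Matrix.trace_add, Matrix.trace_smul, h]; ring

/-- By Cayley–Hamilton `A² = -det A`, so the exponential of `tA` stays in the span of `1` and `A`,
and its equation reduces to a scalar system for `c` and `s`. -/
theorem isOneParam_of_coeff {A : Matrix (Fin 2) (Fin 2) ℝ} (h : A.trace = 0) {c s : ℝ → ℝ}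
    (hc : ∀ t, HasDerivAt c (- A.det * s t) t) (hs : ∀ t, HasDerivAt s (c t) t)
    (hc0 : c 0 = 1) (hs0 : s 0 = 0) (hcs : ∀ t, c t ^ 2 + s t ^ 2 * A.det = 1) :
    IsOneParam A fun t => c t • (1 : Matrix (Fin 2) (Fin 2) ℝ) + s t • A where
  zero := by simp [hc0, hs0]
  det t := by rw [det_smul_one_add h, hcs]
  hasDerivAt t i j := by
    have h1 : ((c t • (1 : Matrix (Fin 2) (Fin 2) ℝ) + s t • A) * A) i j
        = - A.det * s t * (1 : Matrix (Fin 2) (Fin 2) ℝ) i j + c t * A i j := by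
      rw [add_mul, smul_mul_assoc, smul_mul_assoc, one_mul, sq_of_trace_eq_zero h]
      simp
      ring
    rw [h1]
    exact ((hc t).mul_const _).add ((hs t).mul_const _)

/-- The coefficients of a one-parameter subgroup `c(t) + s(t) A` of `Sp(2)`, with trace different
from `2` on `(0, 2π / √|det A|)`. -/
theorem exists_isOneParam {A : Matrix (Fin 2) (Fin 2) ℝ} (h : A.trace = 0) (hdet : A.det ≠ 0) :
    ∃ E, IsOneParam A E ∧ (∀ t, E t * A = A * E t) ∧
      ∀ t, 0 < t → √|A.det| * t < 2 * Real.pi → (E t).trace ≠ 2 := by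
  have hcomm : ∀ (a b : ℝ), (a • (1 : Matrix (Fin 2) (Fin 2) ℝ) + b • A) * A
      = A * (a • (1 : Matrix (Fin 2) (Fin 2) ℝ) + b • A) := fun a b => by
    rw [add_mul, mul_add]; simp
  set a := √|A.det| with ha
  have ha0 : 0 < a := Real.sqrt_pos.2 (abs_pos.2 hdet)
  have ha2 : a ^ 2 = |A.det| := Real.sq_sqrt (abs_nonneg _)
  rcases lt_or_gt_of_ne hdet with hd | hd
  · rw [abs_of_neg hd] at ha2
    refine ⟨fun t => Real.cosh (a * t) • 1 + (Real.sinh (a * t) / a) • A,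
      isOneParam_of_coeff h (fun t => ?_) (fun t => ?_) (by simp) (by simp) (fun t => ?_),
      fun t => hcomm _ _, fun t ht _ => ?_⟩
    · have := ((hasDerivAt_id t).const_mul a).cosh
      refine this.congr_deriv ?_
      rw [← ha2]; field_simp; simp
    · have := (((hasDerivAt_id t).const_mul a).sinh).div_const a
      refine this.congr_deriv ?_
      field_simp; simp
    · have : A.det = - a ^ 2 := by linarith
      rw [this, div_pow]
      field_simp
      linarith [Real.cosh_sq (a * t)]
    · rw [trace_smul_one_add h]
      have : 1 < Real.cosh (a * t) := Real.one_lt_cosh.2 (by positivity)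
      linarith
  · rw [abs_of_pos hd] at ha2
    refine ⟨fun t => Real.cos (a * t) • 1 + (Real.sin (a * t) / a) • A,
      isOneParam_of_coeff h (fun t => ?_) (fun t => ?_) (by simp) (by simp) (fun t => ?_),
      fun t => hcomm _ _, fun t ht ht' => ?_⟩
    · have := ((hasDerivAt_id t).const_mul a).cos
      refine this.congr_deriv ?_
      rw [← ha2]; field_simp; simp
    · have := (((hasDerivAt_id t).const_mul a).sin).div_const a
      refine this.congr_deriv ?_
      field_simp; simp
    · rw [← ha2, div_pow]
      field_simp
      linarith [Real.sin_sq_add_cos_sq (a * t)]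
    · rw [trace_smul_one_add h]
      intro hc
      have h1 : Real.cos (a * t) = 1 := by linarith
      have h2 := (Real.cos_eq_one_iff_of_lt_of_lt (by nlinarith [Real.pi_pos, mul_pos ha0 ht])
        ht').1 h1
      nlinarith [mul_pos ha0 ht]

/-- The rotation loop `cos(wt) + sin(wt) K`. -/
noncomputable def rotLoop (K : Matrix (Fin 2) (Fin 2) ℝ) (w t : ℝ) : Matrix (Fin 2) (Fin 2) ℝ :=
  Real.cos (w * t) • (1 : Matrix (Fin 2) (Fin 2) ℝ) + Real.sin (w * t) • K

theorem isOneParam_rotLoop {K : Matrix (Fin 2) (Fin 2) ℝ} (htr : K.trace = 0) (hdet : K.det = 1)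
    (w : ℝ) : IsOneParam (w • K) (rotLoop K w) where
  zero := by simp [rotLoop]
  det t := by
    rw [rotLoop, det_smul_one_add htr, hdet, mul_one]
    exact Real.cos_sq_add_sin_sq _
  hasDerivAt t i j := by
    have h1 : (rotLoop K w t * (w • K)) i j =
        (- Real.sin (w * t) * w) * (1 : Matrix (Fin 2) (Fin 2) ℝ) i j
          + Real.cos (w * t) * w * K i j := by
      rw [rotLoop, add_mul, mul_smul_comm, mul_smul_comm, smul_mul_assoc, smul_mul_assoc, one_mul,
        sq_of_trace_eq_zero htr, hdet]
      simp
      ring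
    rw [h1]
    have hm := (hasDerivAt_id t).const_mul w
    have hc := (hm.cos).mul_const ((1 : Matrix (Fin 2) (Fin 2) ℝ) i j)
    have hs := (hm.sin).mul_const (K i j)
    exact (hc.add hs).congr_deriv (by simp)

/-- With `φ = wt` the complex linear part is `cos φ + i κ sin φ`, `κ = rotPart K ≥ 1`. It traverses
an ellipse positively, so its argument stays close to `φ` and agrees with it whenever `sin φ = 0`.
-/
theorem exists_isAngleLift_rotLoop {K : Matrix (Fin 2) (Fin 2) ℝ} (htr : K.trace = 0)
    (hdet : K.det = 1) (w : ℝ) (hrot : 0 < rotPart K) {T : ℝ} {m : ℤ}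
    (hm : w * T = m * (2 * Real.pi)) :
    ∃ θ, IsAngleLift T (rotLoop K w) θ ∧ θ T = m * (2 * Real.pi) := by
  have hκ : 1 ≤ rotPart K := by
    have := sq_add_sq_of_det hdet
    rw [htr] at this
    nlinarith [sq_nonneg ((K 0 0 - K 1 1) / 2), sq_nonneg ((K 0 1 + K 1 0) / 2)]
  set κ := rotPart K
  have hD : ∀ φ : ℝ, 0 < Real.cos φ ^ 2 + κ * Real.sin φ ^ 2 := fun φ => by
    nlinarith [Real.sin_sq_add_cos_sq φ, sq_nonneg (Real.sin φ)]
  -- This is the difference between the argument of `cos φ + i κ sin φ` and `φ`, by the subtraction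
  -- formula for the tangent. The denominator is positive, so no branch has to be chosen.
  set α : ℝ → ℝ := fun φ => Real.arctan ((κ - 1) * Real.sin φ * Real.cos φ /
    (Real.cos φ ^ 2 + κ * Real.sin φ ^ 2)) with hα
  have hαc : Continuous α := by
    refine Real.continuous_arctan.comp (Continuous.div (by fun_prop) (by fun_prop) fun φ =>
      (hD φ).ne')
  refine ⟨fun t => w * t + α (w * t), ⟨(by fun_prop : Continuous fun t =>
    w * t + α (w * t)).continuousOn, by simp [hα], fun t _ => ?_⟩, ?_⟩
  · set φ := w * t with hφ
    have hcos := Real.cos_arctan_pos ((κ - 1) * Real.sin φ * Real.cos φ /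
      (Real.cos φ ^ 2 + κ * Real.sin φ ^ 2))
    have hsin : Real.sin (α φ) = (κ - 1) * Real.sin φ * Real.cos φ /
        (Real.cos φ ^ 2 + κ * Real.sin φ ^ 2) * Real.cos (α φ) := by
      rw [← Real.tan_mul_cos hcos.ne', hα, Real.tan_arctan]
    have hcos' : 0 < Real.cos (α φ) := hcos
    have hs := Real.sin_sq_add_cos_sq φ
    have hDφ := hD φ
    refine isAngle_of_exp ((isOneParam_rotLoop htr hdet w).det t)
      (r := (Real.cos φ ^ 2 + κ * Real.sin φ ^ 2) / Real.cos (α φ)) (by positivity) ?_ ?_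
    · rw [rotLoop, trace_smul_one_add htr, Real.cos_add, hsin]
      field_simp
      linear_combination (- Real.cos φ) * hs
    · rw [Real.sin_add, hsin]
      have : rotPart (rotLoop K w t) = κ * Real.sin φ := by
        simp only [κ, rotPart, rotLoop]
        simp
        ring
      rw [this]
      field_simp
      linear_combination (- κ * Real.sin φ) * hs
  · simp only [hm]
    have : Real.sin (m * (2 * Real.pi)) = 0 := by
      have := Real.sin_int_mul_pi (m * 2)
      push_cast at this
      rw [← this]; ring_nf
    simp [hα, this]

theorem omegaForm_eq (D : Matrix (Fin 2) (Fin 2) ℝ) (v : Fin 2 → ℝ) :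
    omegaForm D v = v 0 * (D.mulVec v) 1 - v 1 * (D.mulVec v) 0 := by
  simp only [omegaForm_apply, Matrix.mulVec, dotProduct, Fin.sum_univ_two]
  ring

theorem omegaForm_regular {D : Matrix (Fin 2) (Fin 2) ℝ} (htr : D.trace = 0) (hdet : D.det ≠ 0)
    {v : Fin 2 → ℝ} (h : ∀ w, QuadraticMap.polar (omegaForm D) v w = 0) : v = 0 := by
  have h0 := h ![1, 0]
  have h1 := h ![0, 1]
  simp only [QuadraticMap.polar, omegaForm_apply, Pi.add_apply, Matrix.cons_val_zero,
    Matrix.cons_val_one] at h0 h1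
  rw [Matrix.trace_fin_two] at htr
  have ht : D 1 1 = - D 0 0 := by linarith
  rw [Matrix.det_fin_two] at hdet
  rw [ht] at h0 h1 hdet
  have e0 : (D 0 0 * -D 0 0 - D 0 1 * D 1 0) * v 0 = 0 := by
    linear_combination (D 0 0 / 2) * h1 - (D 0 1 / 2) * h0
  have e1 : (D 0 0 * -D 0 0 - D 0 1 * D 1 0) * v 1 = 0 := by
    linear_combination (D 0 0 / 2) * h0 + (D 1 0 / 2) * h1
  ext i
  fin_cases i
  · exact (mul_eq_zero.1 e0).resolve_left hdet
  · exact (mul_eq_zero.1 e1).resolve_left hdet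

theorem crossingForm_apply {T : ℝ} {Ψ : ℝ → Matrix (Fin 2) (Fin 2) ℝ} {t : ℝ}
    (v : crossingSpace Ψ t) : crossingForm T Ψ t v = omegaForm (pathDeriv T Ψ t) v := rfl

theorem regular_of_eq_one {T : ℝ} {Ψ : ℝ → Matrix (Fin 2) (Fin 2) ℝ} {t : ℝ} (h : Ψ t = 1)
    (htr : (pathDeriv T Ψ t).trace = 0) (hdet : (pathDeriv T Ψ t).det ≠ 0)
    (v : crossingSpace Ψ t) (hv : ∀ w, QuadraticMap.polar (crossingForm T Ψ t) v w = 0) :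
    v = 0 := by
  have hK : ∀ w, w ∈ crossingSpace Ψ t := fun w => by simp [crossingSpace, h]
  exact Subtype.ext (omegaForm_regular htr hdet fun w => hv ⟨w, hK w⟩)

theorem pathDeriv_eq {T : ℝ} (hT : 0 < T) {Ψ : ℝ → Matrix (Fin 2) (Fin 2) ℝ}
    {D : Matrix (Fin 2) (Fin 2) ℝ} {t : ℝ} (ht : t ∈ Icc 0 T)
    (h : ∀ i j, HasDerivAt (fun s => Ψ s i j) (D i j) t) : pathDeriv T Ψ t = D := by
  ext i j
  exact (h i j).hasDerivWithinAt.derivWithin (uniqueDiffOn_Icc hT t ht)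

theorem IsOneParam.isRegularPath {A : Matrix (Fin 2) (Fin 2) ℝ}
    {E : ℝ → Matrix (Fin 2) (Fin 2) ℝ} (h : IsOneParam A E) (htr : A.trace = 0)
    (hdet : A.det ≠ 0) {T : ℝ} (hT : 0 < T)
    (hcross : ∀ t, 0 < t → t ≤ T → (E t).trace ≠ 2) : IsRegularPath T E := by
  refine IsRegularPath.of_regular (h.isSpPath hT) (fun i j => (h.contDiff i j).contDiffOn) ?_
  rintro t ⟨ht, hd⟩ v hv
  have ht0 : t = 0 := by
    by_contra h0
    refine hcross t (lt_of_le_of_ne ht.1 (Ne.symm h0)) ht.2 ?_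
    rw [det_sub_one (h.det t)] at hd
    linarith
  subst ht0
  have hD : pathDeriv T E 0 = A := pathDeriv_eq hT ht fun i j => by
    simpa [h.zero] using h.hasDerivAt 0 i j
  exact regular_of_eq_one h.zero (by rw [hD, htr]) (by rwa [hD]) v hv

/-- The only crossing is `t = 0`, where the crossing form is `ω₀(v, A v)` on the whole plane, so the
index is half of its signature. -/
theorem IsOneParam.coverIndex_eq {A : Matrix (Fin 2) (Fin 2) ℝ}
    {E : ℝ → Matrix (Fin 2) (Fin 2) ℝ} (h : IsOneParam A E) (htr : A.trace = 0)
    (hdet : A.det ≠ 0) {T : ℝ} (hT : 0 < T)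
    (hcross : ∀ t, 0 < t → t ≤ T → (E t).trace ≠ 2) {θ : ℝ → ℝ} (hθ : IsAngleLift T E θ) :
    coverIndex (E T).trace (θ T) = if 0 < A.det then (SignType.sign (A 1 0) : ℚ) else 0 := by
  have hreg := h.isRegularPath htr hdet hT hcross
  rw [← crossingSum_eq_coverIndex hreg hθ.continuousOn hθ.isAngle hθ.zero, crossingSum]
  have hnot : ∀ t, 0 < t → t ≤ T → (E t - 1).det ≠ 0 := fun t h1 h2 hc => by
    rw [det_sub_one (h.det t)] at hc
    exact hcross t h1 h2 (by linarith)
  have hemp : crossings T E ∩ Ioo 0 T = ∅ := by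
    rw [eq_empty_iff_forall_notMem]
    rintro t ⟨h1, h2⟩
    exact hnot t h2.1 h2.2.le h1.2
  rw [hemp, finsum_mem_empty, crossingSign_eq_zero (hnot T hT le_rfl)]
  have hD : pathDeriv T E 0 = A := pathDeriv_eq hT (left_mem_Icc.2 hT.le) fun i j => by
    simpa [h.zero] using h.hasDerivAt 0 i j
  have hK : crossingSpace E 0 = ⊤ := by simp [crossingSpace, h.zero]
  have hr := hreg.regular 0 ⟨left_mem_Icc.2 hT.le, by simp [h.zero]⟩
  have hcf : crossingForm T E 0 = (omegaForm A).restrict (crossingSpace E 0) := by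
    rw [← hD]; rfl
  rw [hcf] at hr
  have hcs : crossingSign T E 0 = (sigPos ((omegaForm A).restrict (crossingSpace E 0)) : ℤ)
      - sigNeg ((omegaForm A).restrict (crossingSpace E 0)) := by
    rw [crossingSign, hcf]
  rcases sub_sigs_of_eq_one htr hK hr with ⟨h1, h2⟩ | ⟨h1, h2⟩
  · rw [hcs, h2, if_pos h1]
    push_cast
    ring
  · rw [hcs, h2, if_neg (by linarith)]
    simp

/-- Since `Φ` preserves `ω₀` and fixes `x`, `ω₀(x, ΦAx) = ω₀(Φx, ΦAx) = ω₀(x, Ax)`. -/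
theorem omegaForm_of_fixed {X A Φ : Matrix (Fin 2) (Fin 2) ℝ} (hΦ : Φ.det = 1) {x : Fin 2 → ℝ}
    (hx : Φ.mulVec x = x) : omegaForm (X * Φ + Φ * A) x = omegaForm (X + A) x := by
  have h1 : (X * Φ + Φ * A).mulVec x = X.mulVec x + Φ.mulVec (A.mulVec x) := by
    rw [Matrix.add_mulVec, ← Matrix.mulVec_mulVec, ← Matrix.mulVec_mulVec, hx]
  rw [omegaForm_eq, omegaForm_eq, h1, Matrix.add_mulVec]
  generalize A.mulVec x = y
  have e0 := congrFun hx 0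
  have e1 := congrFun hx 1
  simp only [Matrix.mulVec, dotProduct, Fin.sum_univ_two, Pi.add_apply] at e0 e1 ⊢
  rw [Matrix.det_fin_two] at hΦ
  linear_combination (-(Φ 1 0 * y 0 + Φ 1 1 * y 1)) * e0 + (Φ 0 0 * y 0 + Φ 0 1 * y 1) * e1
    + (x 0 * y 1 - x 1 * y 0) * hΦ

/-- At every crossing, wherever it occurs, the crossing form is the restriction of the single form
`ω₀(v, (X + A) v)`. Positive determinant makes it definite, hence nondegenerate on every subspace,
so crossings need not be located. -/
theorem isRegularPath_mul {X A : Matrix (Fin 2) (Fin 2) ℝ}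
    {L E : ℝ → Matrix (Fin 2) (Fin 2) ℝ} (hL : IsOneParam X L) (hX : ∀ t, L t * X = X * L t)
    (hE : IsOneParam A E) (htr : (X + A).trace = 0) (hdet : 0 < (X + A).det) {T : ℝ}
    (hT : 0 < T) : IsRegularPath T fun t => L t * E t := by
  have hsp := (hL.isSpPath hT).mul (hE.isSpPath hT)
  refine IsRegularPath.of_regular hsp (fun i j => ?_) ?_
  · have h1 := hL.contDiff
    have h2 := hE.contDiff
    simp only [Matrix.mul_apply]
    fun_prop
  rintro t ⟨ht, hd⟩ v hv
  have hD : pathDeriv T (fun t => L t * E t) t = X * (L t * E t) + L t * E t * A := by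
    refine pathDeriv_eq hT ht fun i j => ?_
    have h1 := fun k => (hL.hasDerivAt t i k).mul (hE.hasDerivAt t k j)
    have h2 := HasDerivAt.fun_sum (u := Finset.univ) fun k _ => h1 k
    have h3 : (fun s => (L s * E s) i j) = fun s => ∑ k, ((fun s => L s i k) * fun s => E s k j) s :=
      rfl
    rw [h3]
    refine h2.congr_deriv ?_
    rw [Finset.sum_add_distrib, ← Matrix.mul_apply, ← Matrix.mul_apply, hX, Matrix.add_apply,
      mul_assoc, mul_assoc]
  by_contra hv0
  have hv' : (L t * E t).mulVec v = v := by
    have := LinearMap.mem_ker.1 v.2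
    rw [Matrix.toLin'_apply, Matrix.sub_mulVec, Matrix.one_mulVec, sub_eq_zero] at this
    exact this
  have hval : crossingForm T (fun t => L t * E t) t v = omegaForm (X + A) v := by
    rw [crossingForm_apply, hD]
    exact omegaForm_of_fixed (hsp.det t ht) hv'
  have hpol := hv v
  rw [QuadraticMap.polar_self, hval] at hpol
  have := omegaForm_definite htr hdet (v := v) (fun h0 => hv0 (Subtype.ext h0))
  rw [nsmul_eq_mul, mul_eq_zero] at hpol
  rcases hpol with hpol | hpol
  · norm_num at hpol
  · rw [hpol, mul_zero] at this
    exact lt_irrefl _ this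

/-- The standard complex structure. -/
def stdJ : Matrix (Fin 2) (Fin 2) ℝ := !![0, -1; 1, 0]

theorem rotLoop_comm (K : Matrix (Fin 2) (Fin 2) ℝ) (w t : ℝ) :
    rotLoop K w t * (w • K) = (w • K) * rotLoop K w t := by
  rw [rotLoop, add_mul, mul_add]; simp [smul_smul, mul_comm]

theorem rotLoop_eq_one (K : Matrix (Fin 2) (Fin 2) ℝ) {w T : ℝ} {m : ℤ}
    (hm : w * T = m * (2 * Real.pi)) : rotLoop K w T = 1 := by
  have h1 : Real.sin (m * (2 * Real.pi)) = 0 := by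
    have := Real.sin_int_mul_pi (m * 2)
    push_cast at this
    rw [← this]; ring_nf
  rw [rotLoop, hm, Real.cos_int_mul_two_pi, h1]
  simp

/-- A complex structure compatible with the decomposition of `ℝ²` under `A`. -/
theorem exists_complexStructure {A : Matrix (Fin 2) (Fin 2) ℝ} (htr : A.trace = 0)
    (hdet : A.det ≠ 0) : ∃ K : Matrix (Fin 2) (Fin 2) ℝ, K.trace = 0 ∧ K.det = 1 ∧
      0 < rotPart K ∧ ∀ w : ℝ, √|A.det| < |w| → 0 < (w • K + A).det := by
  rw [Matrix.trace_fin_two] at htr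
  have ht : A 1 1 = - A 0 0 := by linarith
  set a := √|A.det| with ha
  have ha0 : 0 < a := Real.sqrt_pos.2 (abs_pos.2 hdet)
  have ha2 : a ^ 2 = |A.det| := Real.sq_sqrt (abs_nonneg _)
  have hAd : A.det = A 0 0 * - A 0 0 - A 0 1 * A 1 0 := by rw [Matrix.det_fin_two, ht]
  rcases lt_or_gt_of_ne hdet with hd | hd
  · rw [abs_of_neg hd] at ha2
    set y := rotPart A with hy
    set d := 1 + y ^ 2 / a ^ 2 with hdd
    have hd0 : 0 < d := by positivity
    have hsd : 0 < √d := Real.sqrt_pos.2 hd0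
    have hsd2 : √d ^ 2 = d := Real.sq_sqrt hd0.le
    -- The coefficient of `A` makes the trace of `K A` vanish, so there is no cross term and `det
    -- (wK + A) = w² + det A = w² - a²`. The factor in front normalizes `det K` to `1`.
    refine ⟨(√d)⁻¹ • (stdJ + (y / a ^ 2) • A), ?_, ?_, ?_, ?_⟩
    · simp [stdJ, Matrix.trace_fin_two, ht]
    · have : (stdJ + (y / a ^ 2) • A).det = d := by
        simp only [stdJ, Matrix.det_fin_two, hdd]
        simp [ht]
        have h1 : A 1 0 - A 0 1 = 2 * y := by rw [hy, rotPart]; ring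
        have h2 : A 0 0 * A 0 0 + A 0 1 * A 1 0 = a ^ 2 := by rw [ha2, hAd]; ring
        field_simp
        linear_combination a ^ 2 * y * h1 - y ^ 2 * h2
      rw [Matrix.det_smul, this, Fintype.card_fin, inv_pow, hsd2, inv_mul_cancel₀ hd0.ne']
    · have : rotPart ((√d)⁻¹ • (stdJ + (y / a ^ 2) • A)) = (√d)⁻¹ * d := by
        simp only [stdJ, rotPart, hdd]
        simp
        have h1 : A 1 0 - A 0 1 = 2 * y := by rw [hy, rotPart]; ring
        field_simp
        linear_combination y * h1
      rw [this]
      positivity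
    · intro w hw
      have hw2 : a ^ 2 < w ^ 2 := by rw [← sq_abs w]; exact pow_lt_pow_left₀ hw ha0.le two_ne_zero
      have : (w • (√d)⁻¹ • (stdJ + (y / a ^ 2) • A) + A).det = w ^ 2 - a ^ 2 := by
        have hh : w ^ 2 = (w * (√d)⁻¹) ^ 2 * d := by rw [mul_pow, inv_pow, hsd2]; field_simp
        rw [hh, smul_smul]
        generalize w * (√d)⁻¹ = z
        simp only [stdJ, Matrix.det_fin_two, hdd]
        simp [ht]
        have h1 : A 1 0 - A 0 1 = 2 * y := by rw [hy, rotPart]; ring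
        have h2 : A 0 0 * A 0 0 + A 0 1 * A 1 0 = a ^ 2 := by rw [ha2, hAd]; ring
        field_simp
        linear_combination (a ^ 2 * y * z ^ 2 + a ^ 4 * z) * h1
          + (- y ^ 2 * z ^ 2 - 2 * z * y * a ^ 2 - a ^ 4) * h2
      rw [this]
      linarith
  · rw [abs_of_pos hd] at ha2
    obtain ⟨s, hs, hs'⟩ : ∃ s : ℝ, s ^ 2 = 1 ∧ 0 < s * rotPart A := by
      have hy : rotPart A ≠ 0 := by
        intro h0
        rw [rotPart] at h0
        have : A 1 0 = A 0 1 := by linarith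
        rw [hAd, this] at hd
        nlinarith [sq_nonneg (A 0 0), sq_nonneg (A 0 1)]
      rcases lt_or_gt_of_ne hy with h | h
      · exact ⟨-1, by norm_num, by linarith⟩
      · exact ⟨1, by norm_num, by linarith⟩
    have hdd : ∀ z : ℝ, (z • A).det = z ^ 2 * a ^ 2 := fun z => by
      rw [Matrix.det_smul, ha2, Fintype.card_fin]
    -- In the elliptic case `A` is itself a multiple of a complex structure; `s = ±1` makes its
    -- rotation positive.
    refine ⟨(s / a) • A, ?_, ?_, ?_, ?_⟩
    · simp [Matrix.trace_fin_two, ht]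
    · rw [hdd, div_pow, hs]; field_simp
    · have : rotPart ((s / a) • A) = s * rotPart A / a := by simp [rotPart]; ring
      rw [this]; positivity
    · intro w hw
      have : w • (s / a) • A + A = (w * (s / a) + 1) • A := by rw [smul_smul, add_smul, one_smul]
      rw [this, hdd]
      have h1 : w * (s / a) + 1 ≠ 0 := by
        intro h0
        have h2 : w * s = - a := by field_simp at h0; linarith
        have h3 : w ^ 2 = a ^ 2 := by
          have : (w * s) ^ 2 = w ^ 2 * s ^ 2 := mul_pow _ _ _
          rw [h2, hs] at this
          linarith
        have hw2 : a ^ 2 < w ^ 2 := by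
          rw [← sq_abs w]; exact pow_lt_pow_left₀ hw ha0.le two_ne_zero
        linarith
      positivity

/-! ## Indices of loops and of their products with one-parameter subgroups -/

theorem exists_regular_loop {T : ℝ} (hT : 0 < T) (m : ℤ) :
    ∃ Φ θ, IsRegularPath T Φ ∧ IsAngleLift T Φ θ ∧ Φ T = 1 ∧ θ T = m * (2 * Real.pi) := by
  by_cases hm : m = 0
  · subst hm
    -- The constant loop is not regular. This contractible loop leaves `1` and returns to it through
    -- hyperbolic matrices, with crossings only at the two ends, where the derivative has
    -- determinant `-T²`.
    set f : ℝ → ℝ := fun t => t * (T - t) with hf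
    have hfd : ∀ t, HasDerivAt f (T - 2 * t) t := fun t => by
      have := (hasDerivAt_id t).mul ((hasDerivAt_id t).const_sub T)
      refine this.congr_deriv ?_
      simp; ring
    set Φ : ℝ → Matrix (Fin 2) (Fin 2) ℝ := fun t => !![Real.exp (f t), 0; 0, Real.exp (-f t)]
      with hΦ
    have hC : ∀ i j, ContDiff ℝ 1 fun t => Φ t i j := by
      intro i j
      fin_cases i <;> fin_cases j <;> simp [hΦ, hf] <;> fun_prop
    have hsp : IsSpPath T Φ :=
      ⟨hT, (continuous_matrix fun i j => (hC i j).continuous).continuousOn, fun t _ => by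
        simp [hΦ, Matrix.det_fin_two, ← Real.exp_add], by
        simp [hΦ, hf, Matrix.one_fin_two]⟩
    refine ⟨Φ, fun _ => 0, IsRegularPath.of_regular hsp (fun i j => (hC i j).contDiffOn) ?_,
      ⟨continuousOn_const, rfl, fun t ht => ?_⟩, by simp [hΦ, hf, Matrix.one_fin_two], by simp⟩
    · rintro t ⟨ht, hd⟩ v hv
      have htr : (Φ t).trace = 2 := by
        rw [det_sub_one (hsp.det t ht)] at hd; linarith
      have hft : f t = 0 := by
        by_contra h0
        have h1 := Real.one_lt_cosh.2 h0
        rw [Real.cosh_eq] at h1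
        simp [hΦ, Matrix.trace_fin_two] at htr
        linarith
      have hone : Φ t = 1 := by simp [hΦ, hft, Matrix.one_fin_two]
      have hD : pathDeriv T Φ t = !![T - 2 * t, 0; 0, -(T - 2 * t)] := by
        refine pathDeriv_eq hT ht fun i j => ?_
        fin_cases i <;> fin_cases j <;> simp [hΦ]
        · simpa [hft] using (hfd t).exp
        · exact hasDerivAt_const _ _
        · exact hasDerivAt_const _ _
        · simpa [hft] using (hfd t).neg.exp
      refine regular_of_eq_one hone (by rw [hD]; simp [Matrix.trace_fin_two]) ?_ v hv
      have hdd : (!![T - 2 * t, 0; 0, -(T - 2 * t)]).det = - T ^ 2 := by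
        have h2 : t * (T - t) = 0 := hft
        rw [Matrix.det_fin_two_of]
        linear_combination 4 * h2
      rw [hD, hdd]
      exact neg_ne_zero.2 (by positivity)
    · refine isAngle_of_exp (hsp.det t ht) (r := Real.cosh (f t)) (Real.cosh_pos _) ?_ ?_
      · simp [hΦ, Matrix.trace_fin_two, Real.cosh_eq]; ring
      · simp [hΦ, rotPart]
  · set w : ℝ := m * (2 * Real.pi) / T with hw
    have hwT : w * T = m * (2 * Real.pi) := by rw [hw]; field_simp
    have hw0 : w ≠ 0 := by
      have := Real.pi_pos
      have : (m : ℝ) ≠ 0 := Int.cast_ne_zero.2 hm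
      rw [hw]; positivity
    have htr : stdJ.trace = 0 := by simp [stdJ, Matrix.trace_fin_two]
    have hdet : stdJ.det = 1 := by simp [stdJ, Matrix.det_fin_two]
    obtain ⟨θ, hθ, hθT⟩ := exists_isAngleLift_rotLoop htr hdet w
      (by simp [stdJ, rotPart]) hwT
    have hreg := isRegularPath_mul (isOneParam_rotLoop htr hdet w) (rotLoop_comm _ _)
      isOneParam_const (by simp [htr]) (by
        rw [add_zero, Matrix.det_smul, hdet, Fintype.card_fin, mul_one]; positivity) hT
    simp only [mul_one] at hreg
    exact ⟨_, θ, hreg, hθ, rotLoop_eq_one _ hwT, hθT⟩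

theorem exists_isRSIndex_of_loop {T : ℝ} {Ψ : ℝ → Matrix (Fin 2) (Fin 2) ℝ} (h : IsSpPath T Ψ)
    (hT : Ψ T = 1) : ∃ (m : ℤ) (θ : ℝ → ℝ), IsAngleLift T Ψ θ ∧ θ T = m * (2 * Real.pi) ∧
      IsRSIndex T Ψ (2 * m) := by
  obtain ⟨θ, hθ⟩ := h.exists_isAngleLift
  obtain ⟨m, hm⟩ := isAngle_one_iff.1 (hT ▸ hθ.isAngle T (right_mem_Icc.2 h.pos.le))
  refine ⟨m, θ, hθ, hm, ?_⟩
  obtain ⟨Φ, φ, hΦ, hφ, hΦT, hφT⟩ := exists_regular_loop h.pos m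
  have := isRSIndex_coverIndex h hΦ hθ hφ (by rw [hm, hφT]) (by rw [hT, hΦT])
  rw [hm, hT] at this
  convert this using 1
  have h2 := coverIndex_add_int_mul (1 : Matrix (Fin 2) (Fin 2) ℝ).trace 0 m
  rw [add_zero] at h2
  rw [h2]
  simp [coverIndex]

/-- The loop shifts the final angle of `E` by `2πm`, which shifts `coverIndex` by `2m`. A regular
representative is `E` itself when `m = 0`, and otherwise a rotation loop of winding `m` times `E`,
for a complex structure adapted to `A`. -/
theorem isCZIndex_mul {T : ℝ} {Ψ E : ℝ → Matrix (Fin 2) (Fin 2) ℝ} (hΨ : IsSpPath T Ψ)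
    (hΨT : Ψ T = 1) {θ : ℝ → ℝ} (hθ : IsAngleLift T Ψ θ) {m : ℤ}
    (hm : θ T = m * (2 * Real.pi)) {A : Matrix (Fin 2) (Fin 2) ℝ} (hE : IsOneParam A E)
    (htr : A.trace = 0) (hdet : A.det ≠ 0) (hsmall : √|A.det| * T < 2 * Real.pi)
    (hcross : ∀ t, 0 < t → t ≤ T → (E t).trace ≠ 2) :
    IsCZIndex T (fun t => Ψ t * E t)
      (2 * m + if 0 < A.det then (SignType.sign (A 1 0) : ℤ) else 0) := by
  have hT := hΨ.pos
  have hEsp := hE.isSpPath hT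
  obtain ⟨θE, hθE⟩ := hEsp.exists_isAngleLift
  obtain ⟨Θ, hΘ, hΘT⟩ := exists_isAngleLift_mul hΨ hΨT hEsp hθ hθE
  have hend : Ψ T * E T = E T := by rw [hΨT, one_mul]
  have hval : coverIndex (E T).trace (Θ T)
      = ((2 * m + if 0 < A.det then (SignType.sign (A 1 0) : ℤ) else 0 : ℤ) : ℚ) := by
    rw [hΘT, hm, coverIndex_add_int_mul, hE.coverIndex_eq htr hdet hT hcross hθE]
    push_cast
    simp
  refine ⟨?_, ?_⟩
  · simp only [hend]
    have h1 : (1 - E T).det = (E T - 1).det := by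
      rw [← neg_sub, Matrix.det_neg]; simp
    rw [h1, det_sub_one (hE.det T), sub_ne_zero]
    exact (hcross T hT le_rfl).symm
  rw [← hval]
  obtain ⟨Φ, φ, hΦ, hφ, hφT, hΦT⟩ : ∃ Φ φ, IsRegularPath T Φ ∧ IsAngleLift T Φ φ ∧
      φ T = Θ T ∧ Φ T = E T := by
    by_cases hm0 : m = 0
    · refine ⟨E, θE, hE.isRegularPath htr hdet hT hcross, hθE, ?_, rfl⟩
      rw [hΘT, hm, hm0]; simp
    · obtain ⟨K, hKtr, hKdet, hKrot, hK⟩ := exists_complexStructure htr hdet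
      set w : ℝ := m * (2 * Real.pi) / T with hw
      have hwT : w * T = m * (2 * Real.pi) := by rw [hw]; field_simp
      -- Since `|w| T = 2π|m| ≥ 2π`, the loop rotates faster than `E` moves; this is what makes the
      -- generator `wK + A` have positive determinant.
      have hwa : √|A.det| < |w| := by
        have h1 : (1 : ℝ) ≤ |(m : ℝ)| := by
          rw [← Int.cast_abs]; exact_mod_cast Int.one_le_abs hm0
        have h2 : |w| * T = |(m : ℝ)| * (2 * Real.pi) := by
          calc |w| * T = |w * T| := by rw [abs_mul, abs_of_pos hT]
            _ = _ := by rw [hwT, abs_mul, abs_of_pos (by positivity : 0 < 2 * Real.pi)]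
        refine lt_of_mul_lt_mul_right (lt_of_lt_of_le hsmall ?_) hT.le
        rw [h2]
        nlinarith [Real.pi_pos]
      have hL := isOneParam_rotLoop hKtr hKdet w
      obtain ⟨θL, hθL, hθLT⟩ := exists_isAngleLift_rotLoop hKtr hKdet w hKrot hwT
      obtain ⟨φ, hφ, hφT⟩ := exists_isAngleLift_mul (hL.isSpPath hT) (rotLoop_eq_one K hwT) hEsp
        hθL hθE
      refine ⟨_, φ, isRegularPath_mul hL (rotLoop_comm K w) hE (by
        rw [Matrix.trace_add, Matrix.trace_smul, hKtr, htr]; simp) (hK w hwa) hT, hφ, ?_, ?_⟩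
      · rw [hφT, hΘT, hθLT, hm]
      · rw [rotLoop_eq_one K hwT, one_mul]
  have := isRSIndex_coverIndex (hΨ.mul hEsp) hΦ hΘ hφ hφT.symm (by rw [hΦT, hend])
  rwa [hend] at this

/-! ## Derivatives on manifolds modelled on Euclidean spaces

Tangent spaces are identified with the model space throughout. -/

section Charts

variable {n : ℕ} {M : Type*} [TopologicalSpace M] [ChartedSpace (EuclideanSpace ℝ (Fin n)) M]

/-- The derivative of a vector valued map. -/
noncomputable def vecD {F : Type*} [NormedAddCommGroup F] [NormedSpace ℝ F] (g : M → F) (x : M) :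
    EuclideanSpace ℝ (Fin n) →L[ℝ] F :=
  mfderiv (𝓡 n) 𝓘(ℝ, F) g x

/-- The derivative of a map of manifolds. -/
noncomputable def manD {m : ℕ} {N : Type*} [TopologicalSpace N]
    [ChartedSpace (EuclideanSpace ℝ (Fin m)) N] (g : M → N) (x : M) :
    EuclideanSpace ℝ (Fin n) →L[ℝ] EuclideanSpace ℝ (Fin m) :=
  mfderiv (𝓡 n) (𝓡 m) g x

/-- The derivative of the inverse of the chart centred at `c`. -/
noncomputable def chartSymmD (c : M) (y : EuclideanSpace ℝ (Fin n)) :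
    EuclideanSpace ℝ (Fin n) →L[ℝ] EuclideanSpace ℝ (Fin n) :=
  mfderiv 𝓘(ℝ, EuclideanSpace ℝ (Fin n)) (𝓡 n) (extChartAt (𝓡 n) c).symm y

/-- The derivative of the chart centred at `c`. -/
noncomputable def chartD (c x : M) :
    EuclideanSpace ℝ (Fin n) →L[ℝ] EuclideanSpace ℝ (Fin n) :=
  vecD (extChartAt (𝓡 n) c) x

/-- The curve `γ` has velocity `v` at time `t`. -/
def HasVelocityAt (γ : ℝ → M) (v : EuclideanSpace ℝ (Fin n)) (t : ℝ) : Prop :=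
  HasMFDerivAt 𝓘(ℝ, ℝ) (𝓡 n) γ t
    ((1 : ℝ →L[ℝ] ℝ).smulRight (v : TangentSpace (𝓡 n) (γ t)))

/-- The exterior derivative, on vectors of the model space. -/
noncomputable def extD (α : M → EuclideanSpace ℝ (Fin n) →L[ℝ] ℝ) (x : M)
    (v w : EuclideanSpace ℝ (Fin n)) : ℝ :=
  dOneForm (n := n) (M := M) α x v w

/-- The coefficients of a 1-form in a chart. -/
noncomputable def formInChart (α : M → EuclideanSpace ℝ (Fin n) →L[ℝ] ℝ) (c : M)
    (y : EuclideanSpace ℝ (Fin n)) : EuclideanSpace ℝ (Fin n) →L[ℝ] ℝ :=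
  oneFormInChart (n := n) (M := M) α c y

theorem formInChart_apply (α : M → EuclideanSpace ℝ (Fin n) →L[ℝ] ℝ) (c : M)
    (y v : EuclideanSpace ℝ (Fin n)) :
    formInChart α c y v = α ((extChartAt (𝓡 n) c).symm y) (chartSymmD c y v) := rfl

theorem extD_eq (α : M → EuclideanSpace ℝ (Fin n) →L[ℝ] ℝ) (x : M)
    (v w : EuclideanSpace ℝ (Fin n)) :
    extD α x v w = fderiv ℝ (formInChart α x) (extChartAt (𝓡 n) x x) v w
      - fderiv ℝ (formInChart α x) (extChartAt (𝓡 n) x x) w v := rfl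

theorem formInChart_smul (f : M → ℝ) (lam : M → EuclideanSpace ℝ (Fin n) →L[ℝ] ℝ) (c : M) :
    formInChart (fun x => f x • lam x) c
      = fun y => (f ∘ (extChartAt (𝓡 n) c).symm) y • formInChart lam c y := rfl

theorem extChartAt_target_mem_nhds_self (c : M) :
    (extChartAt (𝓡 n) c).target ∈ 𝓝 (extChartAt (𝓡 n) c c) :=
  (isOpen_extChartAt_target c).mem_nhds (mem_extChartAt_target c)

theorem HasVelocityAt.continuousAt {γ : ℝ → M} {t : ℝ} {v : EuclideanSpace ℝ (Fin n)}
    (h : HasVelocityAt γ v t) : ContinuousAt γ t :=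
  HasMFDerivAt.continuousAt h

/-- The velocity of the image of a curve under a vector valued map. -/
theorem HasVelocityAt.vecD_comp {F : Type*} [NormedAddCommGroup F] [NormedSpace ℝ F]
    {g : M → F} {γ : ℝ → M} {t : ℝ} {v : EuclideanSpace ℝ (Fin n)}
    (h : HasVelocityAt γ v t) (hg : MDifferentiableAt (𝓡 n) 𝓘(ℝ, F) g (γ t)) :
    HasDerivAt (fun s => g (γ s)) (vecD g (γ t) v) t := by
  have h1 : HasFDerivAt (fun s => g (γ s)) ((vecD g (γ t)).comp ((1 : ℝ →L[ℝ] ℝ).smulRight v)) t :=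
    (hg.hasMFDerivAt.comp t h).hasFDerivAt
  refine h1.hasDerivAt.congr_deriv ?_
  change vecD g (γ t) ((1 : ℝ) • v) = vecD g (γ t) v
  rw [one_smul]

/-- The velocity of the image of a curve under a map of manifolds. -/
theorem HasVelocityAt.manD_comp {m : ℕ} {N : Type*} [TopologicalSpace N]
    [ChartedSpace (EuclideanSpace ℝ (Fin m)) N]
    {g : M → N} {γ : ℝ → M} {t : ℝ} {v : EuclideanSpace ℝ (Fin n)}
    (h : HasVelocityAt γ v t) (hg : MDifferentiableAt (𝓡 n) (𝓡 m) g (γ t)) :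
    HasVelocityAt (n := m) (fun s => g (γ s)) (manD (n := n) (m := m) g (γ t) v) t := by
  have h1 := hg.hasMFDerivAt.comp t h
  have h2 : (mfderiv (𝓡 n) (𝓡 m) g (γ t)).comp
      ((1 : ℝ →L[ℝ] ℝ).smulRight (v : TangentSpace (𝓡 n) (γ t))) =
      (1 : ℝ →L[ℝ] ℝ).smulRight (manD (n := n) (m := m) g (γ t) v : TangentSpace (𝓡 m) (g (γ t))) := by
    apply ContinuousLinearMap.ext_ring
    change manD (n := n) (m := m) g (γ t) ((1 : ℝ) • v) = (1 : ℝ) • manD (n := n) (m := m) g (γ t) v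
    rw [one_smul, one_smul]
  exact h1.congr_mfderiv h2

theorem contMDiff_of_chart_symm [IsManifold (𝓡 n) ∞ M] {F : Type*} [NormedAddCommGroup F] [NormedSpace ℝ F]
    {g : M → F}
    (hg : ∀ c, ContDiffOn ℝ ∞ (g ∘ (extChartAt (𝓡 n) c).symm) (extChartAt (𝓡 n) c).target) :
    ContMDiff (𝓡 n) 𝓘(ℝ, F) ∞ g := by
  intro c
  have h1 : ContMDiffAt (𝓡 n) 𝓘(ℝ, F) ∞
      ((g ∘ (extChartAt (𝓡 n) c).symm) ∘ extChartAt (𝓡 n) c) c :=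
    ((hg c).contDiffAt (extChartAt_target_mem_nhds_self c)).contMDiffAt.comp c
      contMDiffAt_extChartAt
  refine h1.congr_of_eventuallyEq ?_
  filter_upwards [extChartAt_source_mem_nhds (I := 𝓡 n) c] with z hz
  rw [Function.comp_apply, Function.comp_apply, (extChartAt (𝓡 n) c).left_inv hz]

variable [IsManifold (𝓡 n) ∞ M]

variable (n M) in
theorem isManifold_one : IsManifold (𝓡 n) 1 M := IsManifold.of_le (n := ∞) (by norm_num)

theorem hasMFDerivAt_chart_symm {c : M} {y : EuclideanSpace ℝ (Fin n)}
    (hy : y ∈ (extChartAt (𝓡 n) c).target) :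
    HasMFDerivAt 𝓘(ℝ, EuclideanSpace ℝ (Fin n)) (𝓡 n) (extChartAt (𝓡 n) c).symm y
      (chartSymmD c y) :=
  (((contMDiffOn_extChartAt_symm (n := ∞) c).contMDiffAt
    ((isOpen_extChartAt_target c).mem_nhds hy)).mdifferentiableAt (by norm_num)).hasMFDerivAt

theorem mdifferentiableAt_chart {c x : M} (hx : x ∈ (extChartAt (𝓡 n) c).source) :
    MDifferentiableAt (𝓡 n) 𝓘(ℝ, EuclideanSpace ℝ (Fin n)) (extChartAt (𝓡 n) c) x :=
  (contMDiffAt_extChartAt' (n := ∞) (by rwa [extChartAt_source] at hx)).mdifferentiableAt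
    (by norm_num)

theorem chartD_self (c : M) (v : EuclideanSpace ℝ (Fin n)) : chartD c c v = v := by
  have := isManifold_one n M
  have h := mfderiv_extChartAt_self (I := 𝓡 n) (x := c)
  exact DFunLike.congr_fun h v

theorem chartD_chartSymmD {c : M} {y : EuclideanSpace ℝ (Fin n)}
    (hy : y ∈ (extChartAt (𝓡 n) c).target) (v : EuclideanSpace ℝ (Fin n)) :
    chartD c ((extChartAt (𝓡 n) c).symm y) (chartSymmD c y v) = v := by
  have := isManifold_one n M
  have h := mfderiv_extChartAt_comp_mfderivWithin_extChartAt_symm (I := 𝓡 n) hy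
  rw [(𝓡 n).range_eq_univ, mfderivWithin_univ] at h
  exact DFunLike.congr_fun h v

theorem chartSymmD_chartD {c x : M} (hx : x ∈ (extChartAt (𝓡 n) c).source)
    (v : EuclideanSpace ℝ (Fin n)) :
    chartSymmD c (extChartAt (𝓡 n) c x) (chartD c x v) = v := by
  have := isManifold_one n M
  have h := mfderivWithin_extChartAt_symm_comp_mfderiv_extChartAt' (I := 𝓡 n) hx
  rw [(𝓡 n).range_eq_univ, mfderivWithin_univ] at h
  exact DFunLike.congr_fun h v

theorem chartSymmD_self (c : M) (v : EuclideanSpace ℝ (Fin n)) :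
    chartSymmD c (extChartAt (𝓡 n) c c) v = v := by
  have h := chartSymmD_chartD (mem_extChartAt_source (I := 𝓡 n) c) v
  rwa [chartD_self] at h

theorem hasFDerivAt_comp_chart_symm {F : Type*} [NormedAddCommGroup F] [NormedSpace ℝ F]
    {g : M → F} {c : M} {y : EuclideanSpace ℝ (Fin n)} (hy : y ∈ (extChartAt (𝓡 n) c).target)
    (hg : MDifferentiableAt (𝓡 n) 𝓘(ℝ, F) g ((extChartAt (𝓡 n) c).symm y)) :
    HasFDerivAt (g ∘ (extChartAt (𝓡 n) c).symm)
      ((vecD g ((extChartAt (𝓡 n) c).symm y)).comp (chartSymmD c y)) y :=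
  (hg.hasMFDerivAt.comp y (hasMFDerivAt_chart_symm hy)).hasFDerivAt

theorem fderiv_comp_chart_symm {F : Type*} [NormedAddCommGroup F] [NormedSpace ℝ F]
    {g : M → F} {c : M} {y : EuclideanSpace ℝ (Fin n)} (hy : y ∈ (extChartAt (𝓡 n) c).target)
    (hg : MDifferentiableAt (𝓡 n) 𝓘(ℝ, F) g ((extChartAt (𝓡 n) c).symm y))
    (v : EuclideanSpace ℝ (Fin n)) :
    fderiv ℝ (g ∘ (extChartAt (𝓡 n) c).symm) y v =
      vecD g ((extChartAt (𝓡 n) c).symm y) (chartSymmD c y v) := by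
  rw [(hasFDerivAt_comp_chart_symm hy hg).fderiv]
  rfl

theorem vecD_eq_fderiv {F : Type*} [NormedAddCommGroup F] [NormedSpace ℝ F]
    {g : M → F} {c x : M} (hx : x ∈ (extChartAt (𝓡 n) c).source)
    (hg : MDifferentiableAt (𝓡 n) 𝓘(ℝ, F) g x) (v : EuclideanSpace ℝ (Fin n)) :
    vecD g x v =
      fderiv ℝ (g ∘ (extChartAt (𝓡 n) c).symm) (extChartAt (𝓡 n) c x) (chartD c x v) := by
  have hl := (extChartAt (𝓡 n) c).left_inv hx
  rw [fderiv_comp_chart_symm ((extChartAt (𝓡 n) c).map_source hx) (by rwa [hl]), hl,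
    chartSymmD_chartD hx]

theorem contDiffOn_comp_chart_symm {F : Type*} [NormedAddCommGroup F] [NormedSpace ℝ F]
    {g : M → F} (hg : ContMDiff (𝓡 n) 𝓘(ℝ, F) ∞ g) (c : M) :
    ContDiffOn ℝ ∞ (g ∘ (extChartAt (𝓡 n) c).symm) (extChartAt (𝓡 n) c).target := by
  rw [← contMDiffOn_iff_contDiffOn]
  exact hg.comp_contMDiffOn (contMDiffOn_extChartAt_symm c)

/-- The velocity of a curve in a chart. -/
theorem HasVelocityAt.chart {γ : ℝ → M} {t : ℝ} {v : EuclideanSpace ℝ (Fin n)} {c : M}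
    (h : HasVelocityAt γ v t) (hc : γ t ∈ (extChartAt (𝓡 n) c).source) :
    HasDerivAt (fun s => extChartAt (𝓡 n) c (γ s)) (chartD c (γ t) v) t :=
  h.vecD_comp (mdifferentiableAt_chart hc)

/-- A curve with zero velocity is constant. -/
theorem eq_of_hasVelocityAt_zero [T2Space M] {γ : ℝ → M}
    (h : ∀ t, HasVelocityAt (n := n) γ 0 t) (s t : ℝ) : γ s = γ t := by
  have hc : Continuous γ := continuous_iff_continuousAt.2 fun t => (h t).continuousAt
  have hl : IsLocallyConstant γ := by
    rw [IsLocallyConstant.iff_eventually_eq]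
    intro t
    have hsrc : ∀ᶠ s in 𝓝 t, γ s ∈ (extChartAt (𝓡 n) (γ t)).source :=
      hc.continuousAt (extChartAt_source_mem_nhds (I := 𝓡 n) (γ t))
    obtain ⟨r, hr, hball⟩ := Metric.eventually_nhds_iff_ball.1 hsrc
    filter_upwards [Metric.ball_mem_nhds t hr] with s hs
    have hd : ∀ u ∈ Metric.ball t r,
        HasFDerivWithinAt (fun s => extChartAt (𝓡 n) (γ t) (γ s)) (0 : ℝ →L[ℝ] _)
          (Metric.ball t r) u := by
      intro u hu
      have := (h u).chart (hball u hu)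
      rw [map_zero] at this
      refine this.hasFDerivAt.hasFDerivWithinAt.congr_fderiv ?_
      simp
    have heq := (convex_ball t r).is_const_of_fderivWithin_eq_zero (𝕜 := ℝ)
      (fun u hu => (hd u hu).differentiableWithinAt)
      (fun u hu => (hd u hu).fderivWithin (Metric.isOpen_ball.uniqueDiffWithinAt hu))
      hs (Metric.mem_ball_self hr)
    exact (extChartAt (𝓡 n) (γ t)).injOn (hball s hs) (mem_extChartAt_source _) heq
  exact hl.apply_eq_of_isPreconnected isPreconnected_univ trivial trivial

/-! ## Multiples of 1-forms -/

variable {lam : M → EuclideanSpace ℝ (Fin n) →L[ℝ] ℝ} {f : M → ℝ}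

theorem formInChart_self (α : M → EuclideanSpace ℝ (Fin n) →L[ℝ] ℝ) (c : M)
    (v : EuclideanSpace ℝ (Fin n)) : formInChart α c (extChartAt (𝓡 n) c c) v = α c v := by
  rw [formInChart_apply, chartSymmD_self, extChartAt_to_inv]

theorem IsSmoothOneForm.smul (h : IsSmoothOneForm (n := n) (M := M) lam)
    (hf : ContMDiff (𝓡 n) 𝓘(ℝ, ℝ) ∞ f) :
    IsSmoothOneForm (n := n) (M := M) fun x => f x • lam x := fun c =>
  (contDiffOn_comp_chart_symm hf c).smul (h c)

theorem extD_smul (h : IsSmoothOneForm (n := n) (M := M) lam)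
    (hf : ContMDiff (𝓡 n) 𝓘(ℝ, ℝ) ∞ f) (x : M) (v w : EuclideanSpace ℝ (Fin n)) :
    extD (fun x => f x • lam x) x v w =
      vecD f x v * lam x w - vecD f x w * lam x v + f x * extD lam x v w := by
  have hnhds := extChartAt_target_mem_nhds_self (n := n) x
  have d1 := ((contDiffOn_comp_chart_symm hf x).contDiffAt hnhds).differentiableAt (by norm_num)
  have d2 : DifferentiableAt ℝ (formInChart lam x) (extChartAt (𝓡 n) x x) :=
    ((h x).contDiffAt hnhds).differentiableAt (by norm_num)
  have hm := fun v => vecD_eq_fderiv (mem_extChartAt_source (I := 𝓡 n) x)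
    ((hf x).mdifferentiableAt (by norm_num)) v
  simp only [chartD_self] at hm
  rw [extD_eq, extD_eq, formInChart_smul, fderiv_fun_smul d1 d2, hm, hm]
  simp only [add_apply, smul_apply,
    ContinuousLinearMap.smulRight_apply, smul_eq_mul, formInChart_self]
  have e3 : (f ∘ (extChartAt (𝓡 n) x).symm) (extChartAt (𝓡 n) x x) = f x := by
    simp
  rw [e3]
  ring

end Charts

/-! ## A uniform comparison of derivatives on a compact manifold -/

/-- Lengths are measured through the immersion `ψ`, so no metric on `M` is needed. With `f = dψ(X)`
the resulting `C` bounds both the variation of `X` along trajectories and its linearization at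
zeros. The estimate is local near each chart centre, and compactness makes it uniform. -/
theorem exists_vecD_le {n : ℕ} {M : Type*} [TopologicalSpace M]
    [ChartedSpace (EuclideanSpace ℝ (Fin n)) M] [IsManifold (𝓡 n) ∞ M] [CompactSpace M]
    {F G : Type*} [NormedAddCommGroup F] [NormedSpace ℝ F] [NormedAddCommGroup G]
    [NormedSpace ℝ G] {ψ : M → F} {f : M → G} (hψ : ContMDiff (𝓡 n) 𝓘(ℝ, F) ∞ ψ)
    (hf : ContMDiff (𝓡 n) 𝓘(ℝ, G) ∞ f)
    (hinj : ∀ x, Function.Injective (vecD (n := n) ψ x)) :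
    ∃ C > 0, ∀ (x : M) (v : EuclideanSpace ℝ (Fin n)), ‖vecD f x v‖ ≤ C * ‖vecD ψ x v‖ := by
  suffices h : ∃ C > 0, ∀ x ∈ (univ : Set M), ∀ v : EuclideanSpace ℝ (Fin n),
      ‖vecD f x v‖ ≤ C * ‖vecD ψ x v‖ by
    obtain ⟨C, hC, h⟩ := h
    exact ⟨C, hC, fun x => h x trivial⟩
  refine isCompact_univ.induction_on (p := fun s => ∃ C > 0, ∀ x ∈ s,
    ∀ v : EuclideanSpace ℝ (Fin n), ‖vecD f x v‖ ≤ C * ‖vecD ψ x v‖) ⟨1, one_pos, by simp⟩ ?_ ?_ ?_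
  · rintro s t hst ⟨C, hC, h⟩
    exact ⟨C, hC, fun x hx => h x (hst hx)⟩
  · rintro s t ⟨C, hC, h⟩ ⟨C', hC', h'⟩
    refine ⟨C + C', by positivity, fun x hx v => ?_⟩
    rcases hx with hx | hx
    · exact (h x hx v).trans (mul_le_mul_of_nonneg_right (by linarith) (norm_nonneg _))
    · exact (h' x hx v).trans (mul_le_mul_of_nonneg_right (by linarith) (norm_nonneg _))
  · intro c _
    set g := fderiv ℝ (ψ ∘ (extChartAt (𝓡 n) c).symm)
    set k := fderiv ℝ (f ∘ (extChartAt (𝓡 n) c).symm)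
    set y₀ := extChartAt (𝓡 n) c c with hy₀
    have hopen := isOpen_extChartAt_target (I := 𝓡 n) c
    have hmem := mem_extChartAt_target (I := 𝓡 n) c
    have hg : ContinuousAt g y₀ := ((contDiffOn_comp_chart_symm hψ c).continuousOn_fderiv_of_isOpen
      hopen (by norm_num)).continuousAt (hopen.mem_nhds hmem)
    have hk : ContinuousAt k y₀ := ((contDiffOn_comp_chart_symm hf c).continuousOn_fderiv_of_isOpen
      hopen (by norm_num)).continuousAt (hopen.mem_nhds hmem)
    have hg0 : ∀ v, g y₀ v = vecD ψ c v := fun v => by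
      have := vecD_eq_fderiv (mem_extChartAt_source (I := 𝓡 n) c)
        ((hψ c).mdifferentiableAt (by norm_num)) v
      rw [this, chartD_self]
    have hginj : Function.Injective (g y₀).toLinearMap := fun v w hvw => by
      apply hinj c
      have h1 : g y₀ v = g y₀ w := hvw
      rwa [hg0, hg0] at h1
    obtain ⟨K, hK, hanti⟩ := (g y₀).toLinearMap.exists_antilipschitzWith
      (LinearMap.ker_eq_bot.2 hginj)
    have hK' : ∀ v, ‖v‖ ≤ K * ‖g y₀ v‖ := fun v => by
      have := hanti.le_mul_dist v 0
      simpa using this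
    have hK0 : (0 : ℝ) < K := hK
    -- With this radius the error in replacing `g y` by `g y₀` is at most half of `‖w‖`, which is
    -- absorbed at the price of doubling `K`.
    have hev1 : ∀ᶠ y in 𝓝 y₀, ‖g y - g y₀‖ < 1 / (2 * K) := by
      have := (hg.sub (continuousAt_const (y := g y₀))).norm
      refine this.eventually_lt_const ?_
      change ‖g y₀ - g y₀‖ < _
      rw [sub_self, norm_zero]
      positivity
    have hev2 : ∀ᶠ y in 𝓝 y₀, ‖k y‖ < ‖k y₀‖ + 1 :=
      hk.norm.eventually_lt_const (by linarith)
    have hcont : ContinuousAt (extChartAt (𝓡 n) c) c := continuousAt_extChartAt c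
    refine ⟨_, mem_nhdsWithin_of_mem_nhds (Filter.inter_mem (hcont (hev1.and hev2))
      (extChartAt_source_mem_nhds (I := 𝓡 n) c)), (‖k y₀‖ + 1) * (2 * K), by positivity, ?_⟩
    rintro x ⟨⟨h1, h2⟩, hx⟩ v
    rw [vecD_eq_fderiv hx ((hf x).mdifferentiableAt (by norm_num)),
      vecD_eq_fderiv hx ((hψ x).mdifferentiableAt (by norm_num))]
    change ‖k (extChartAt (𝓡 n) c x) _‖ ≤ _ * ‖g (extChartAt (𝓡 n) c x) _‖
    set y := extChartAt (𝓡 n) c x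
    set w := chartD c x v
    have h3 : ‖w‖ ≤ 2 * K * ‖g y w‖ := by
      have e1 : ‖g y₀ w‖ ≤ ‖g y w‖ + ‖(g y - g y₀) w‖ := by
        have : g y₀ w = g y w - (g y - g y₀) w := by simp
        rw [this]; exact norm_sub_le _ _
      have e2 : ‖(g y - g y₀) w‖ ≤ 1 / (2 * K) * ‖w‖ :=
        ((g y - g y₀).le_opNorm w).trans
          (mul_le_mul_of_nonneg_right (le_of_lt h1) (norm_nonneg _))
      have e3 := hK' w
      have e4 : (K : ℝ) * (1 / (2 * K) * ‖w‖) = ‖w‖ / 2 := by field_simp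
      nlinarith
    calc ‖k y w‖ ≤ ‖k y‖ * ‖w‖ := (k y).le_opNorm w
      _ ≤ (‖k y₀‖ + 1) * (2 * K * ‖g y w‖) :=
        mul_le_mul (le_of_lt h2) h3 (norm_nonneg _) (by positivity)
      _ = _ := by ring

/-! ## Hamiltonian vector fields on surfaces -/

/-- The first standard basis vector. -/
noncomputable abbrev stdE0 : EuclideanSpace ℝ (Fin 2) := EuclideanSpace.single 0 1

/-- The second standard basis vector. -/
noncomputable abbrev stdE1 : EuclideanSpace ℝ (Fin 2) := EuclideanSpace.single 1 1

theorem eq_stdE (v : EuclideanSpace ℝ (Fin 2)) : v = v 0 • stdE0 + v 1 • stdE1 := by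
  ext i
  fin_cases i <;> simp

theorem alternating_apply {τ : EuclideanSpace ℝ (Fin 2) →L[ℝ] EuclideanSpace ℝ (Fin 2) →L[ℝ] ℝ}
    (h : ∀ v, τ v v = 0) (v w : EuclideanSpace ℝ (Fin 2)) :
    τ v w = τ stdE0 stdE1 * (v 0 * w 1 - v 1 * w 0) := by
  have hs : τ stdE1 stdE0 = - τ stdE0 stdE1 := by
    have := h (stdE0 + stdE1)
    simp only [map_add, add_apply, h] at this
    linarith
  conv_lhs => rw [eq_stdE v, eq_stdE w]
  simp only [map_add, add_apply, map_smul, smul_apply, h, hs, smul_eq_mul]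
  ring

theorem alternating_ne_zero
    {τ : EuclideanSpace ℝ (Fin 2) →L[ℝ] EuclideanSpace ℝ (Fin 2) →L[ℝ] ℝ}
    (h : ∀ v, τ v v = 0) (hnd : ∀ v, (∀ w, τ v w = 0) → v = 0) : τ stdE0 stdE1 ≠ 0 := by
  intro h0
  have := hnd stdE0 fun w => by rw [alternating_apply h, h0, zero_mul]
  have := congrArg (fun v : EuclideanSpace ℝ (Fin 2) => v 0) this
  simp at this

/-- The vector `Z` with `s (dx ∧ dy)(Z, ·) = h`. -/
noncomputable def hamVec (s : ℝ) (h : EuclideanSpace ℝ (Fin 2) →L[ℝ] ℝ) :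
    EuclideanSpace ℝ (Fin 2) :=
  (h stdE1 / s) • stdE0 - (h stdE0 / s) • stdE1

theorem apply_hamVec {τ : EuclideanSpace ℝ (Fin 2) →L[ℝ] EuclideanSpace ℝ (Fin 2) →L[ℝ] ℝ}
    (h : ∀ v, τ v v = 0) (h0 : τ stdE0 stdE1 ≠ 0) (k : EuclideanSpace ℝ (Fin 2) →L[ℝ] ℝ)
    (w : EuclideanSpace ℝ (Fin 2)) : τ (hamVec (τ stdE0 stdE1) k) w = k w := by
  rw [alternating_apply h]
  conv_rhs => rw [eq_stdE w]
  simp [hamVec]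
  field_simp
  ring

theorem eq_hamVec {τ : EuclideanSpace ℝ (Fin 2) →L[ℝ] EuclideanSpace ℝ (Fin 2) →L[ℝ] ℝ}
    (h : ∀ v, τ v v = 0) (hnd : ∀ v, (∀ w, τ v w = 0) → v = 0)
    {k : EuclideanSpace ℝ (Fin 2) →L[ℝ] ℝ} {v : EuclideanSpace ℝ (Fin 2)}
    (hv : ∀ w, τ v w = k w) : v = hamVec (τ stdE0 stdE1) k := by
  rw [← sub_eq_zero]
  refine hnd _ fun w => ?_
  rw [map_sub, sub_apply, hv, apply_hamVec h (alternating_ne_zero h hnd), sub_self]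

section Surface

variable {B : Type*} [TopologicalSpace B] [ChartedSpace (EuclideanSpace ℝ (Fin 2)) B]

/-- The Hamiltonian vector field: `σ(Z, ·) = dH`. -/
noncomputable def hamField (σ : B → EuclideanSpace ℝ (Fin 2) →L[ℝ] EuclideanSpace ℝ (Fin 2) →L[ℝ] ℝ)
    (H : B → ℝ) (b : B) : EuclideanSpace ℝ (Fin 2) :=
  hamVec (σ b stdE0 stdE1) (vecD H b)

/-- The Hamiltonian vector field in a chart. -/
noncomputable def hamChart (σ : B → EuclideanSpace ℝ (Fin 2) →L[ℝ] EuclideanSpace ℝ (Fin 2) →L[ℝ] ℝ)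
    (H : B → ℝ) (c : B) (y : EuclideanSpace ℝ (Fin 2)) : EuclideanSpace ℝ (Fin 2) :=
  hamVec (twoFormInChart (n := 2) (M := B) σ c stdE0 stdE1 y)
    (fderiv ℝ (H ∘ (extChartAt (𝓡 2) c).symm) y)

variable {σ : B → EuclideanSpace ℝ (Fin 2) →L[ℝ] EuclideanSpace ℝ (Fin 2) →L[ℝ] ℝ} {H : B → ℝ}

theorem area_self (hσ : IsAreaForm (B := B) σ) (b : B) (v : EuclideanSpace ℝ (Fin 2)) :
    σ b v v = 0 := hσ.alternating b v

theorem area_nondegenerate (hσ : IsAreaForm (B := B) σ) (b : B) (v : EuclideanSpace ℝ (Fin 2))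
    (h : ∀ w, σ b v w = 0) : v = 0 := hσ.nondegenerate b v h

theorem area_hamField (hσ : IsAreaForm (B := B) σ) (b : B) (w : EuclideanSpace ℝ (Fin 2)) :
    σ b (hamField σ H b) w = vecD H b w :=
  apply_hamVec (area_self hσ b) (alternating_ne_zero (area_self hσ b) (area_nondegenerate hσ b)) _ w

theorem hamField_eq_zero_iff (hσ : IsAreaForm (B := B) σ) {b : B} :
    hamField σ H b = 0 ↔ IsCritPoint (n := 2) H b := by
  constructor
  · intro h
    have h1 : vecD (n := 2) H b = 0 := by
      ext w
      rw [← area_hamField hσ, h]; simp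
    exact h1
  · intro h
    have h1 : vecD (n := 2) H b = 0 := h
    rw [hamField, h1]
    simp [hamVec]

/-- The area form pulled back by the inverse of a chart. -/
noncomputable def areaPull (σ : B → EuclideanSpace ℝ (Fin 2) →L[ℝ] EuclideanSpace ℝ (Fin 2) →L[ℝ] ℝ)
    (c : B) (y : EuclideanSpace ℝ (Fin 2)) :
    EuclideanSpace ℝ (Fin 2) →L[ℝ] EuclideanSpace ℝ (Fin 2) →L[ℝ] ℝ :=
  (σ ((extChartAt (𝓡 2) c).symm y)).bilinearComp (chartSymmD c y) (chartSymmD c y)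

theorem areaPull_apply (c : B) (y v w : EuclideanSpace ℝ (Fin 2)) :
    areaPull σ c y v w
      = σ ((extChartAt (𝓡 2) c).symm y) (chartSymmD c y v) (chartSymmD c y w) := rfl

theorem areaPull_self (hσ : IsAreaForm (B := B) σ) (c : B) (y v : EuclideanSpace ℝ (Fin 2)) :
    areaPull σ c y v v = 0 := area_self hσ _ _

variable [IsManifold (𝓡 2) ∞ B]

theorem areaPull_nondegenerate (hσ : IsAreaForm (B := B) σ) {c : B}
    {y : EuclideanSpace ℝ (Fin 2)} (hy : y ∈ (extChartAt (𝓡 2) c).target)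
    (v : EuclideanSpace ℝ (Fin 2)) (h : ∀ w, areaPull σ c y v w = 0) : v = 0 := by
  have h1 : chartSymmD c y v = 0 := by
    refine area_nondegenerate hσ ((extChartAt (𝓡 2) c).symm y) _ fun w => ?_
    have h2 := chartSymmD_chartD ((extChartAt (𝓡 2) c).map_target hy) w
    rw [(extChartAt (𝓡 2) c).right_inv hy] at h2
    rw [← h2, ← areaPull_apply]
    exact h _
  rw [← chartD_chartSymmD hy v, h1, map_zero]

theorem areaPull_hamChart (hσ : IsAreaForm (B := B) σ) {c : B}
    {y : EuclideanSpace ℝ (Fin 2)} (hy : y ∈ (extChartAt (𝓡 2) c).target)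
    (w : EuclideanSpace ℝ (Fin 2)) :
    areaPull σ c y (hamChart σ H c y) w = fderiv ℝ (H ∘ (extChartAt (𝓡 2) c).symm) y w :=
  apply_hamVec (areaPull_self hσ c y) (alternating_ne_zero (areaPull_self hσ c y)
    (areaPull_nondegenerate hσ hy)) _ w

/-- Both vectors represent `dH` through `σ`, and nondegeneracy makes the representative unique. This
gives smoothness of the Hamiltonian field, as the chart expression is explicitly smooth. -/
theorem chartSymmD_hamChart (hσ : IsAreaForm (B := B) σ) (hH : ContMDiff (𝓡 2) 𝓘(ℝ, ℝ) ∞ H) {c : B}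
    {y : EuclideanSpace ℝ (Fin 2)} (hy : y ∈ (extChartAt (𝓡 2) c).target) :
    chartSymmD c y (hamChart σ H c y) = hamField σ H ((extChartAt (𝓡 2) c).symm y) := by
  refine eq_hamVec (area_self hσ _) (area_nondegenerate hσ _) fun w => ?_
  have h2 := chartSymmD_chartD ((extChartAt (𝓡 2) c).map_target hy) w
  rw [(extChartAt (𝓡 2) c).right_inv hy] at h2
  rw [← h2, ← areaPull_apply, areaPull_hamChart hσ hy,
    fderiv_comp_chart_symm hy ((hH _).mdifferentiableAt (by norm_num))]

theorem chartD_hamField (hσ : IsAreaForm (B := B) σ) (hH : ContMDiff (𝓡 2) 𝓘(ℝ, ℝ) ∞ H) {c b : B}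
    (hb : b ∈ (extChartAt (𝓡 2) c).source) :
    chartD c b (hamField σ H b) = hamChart σ H c (extChartAt (𝓡 2) c b) := by
  have hy := (extChartAt (𝓡 2) c).map_source hb
  have h := chartSymmD_hamChart hσ hH hy
  rw [(extChartAt (𝓡 2) c).left_inv hb] at h
  rw [← h]
  have h2 := chartD_chartSymmD hy (hamChart σ H c (extChartAt (𝓡 2) c b))
  rwa [(extChartAt (𝓡 2) c).left_inv hb] at h2

theorem contDiffOn_hamChart (hσ : IsAreaForm (B := B) σ) (hH : ContMDiff (𝓡 2) 𝓘(ℝ, ℝ) ∞ H)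
    (c : B) : ContDiffOn ℝ ∞ (hamChart σ H c) (extChartAt (𝓡 2) c).target := by
  have hopen := isOpen_extChartAt_target (I := 𝓡 2) c
  have h1 := hσ.smooth c stdE0 stdE1
  have h2 : ContDiffOn ℝ ∞ (fderiv ℝ (H ∘ (extChartAt (𝓡 2) c).symm)) _ :=
    (contDiffOn_comp_chart_symm hH c).fderiv_of_isOpen hopen (by norm_num)
  have h3 : ∀ y ∈ (extChartAt (𝓡 2) c).target,
      twoFormInChart (n := 2) (M := B) σ c stdE0 stdE1 y ≠ 0 := fun y hy =>
    alternating_ne_zero (areaPull_self hσ c y) (areaPull_nondegenerate hσ hy)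
  have h4 := fun v => h2.clm_apply (contDiffOn_const (c := v))
  exact (((h4 stdE1).div h1 h3).smul contDiffOn_const).sub
    (((h4 stdE0).div h1 h3).smul contDiffOn_const)

/-- The derivative of a vector valued map along the Hamiltonian vector field. -/
noncomputable def hamDeriv {F : Type*} [NormedAddCommGroup F] [NormedSpace ℝ F]
    (σ : B → EuclideanSpace ℝ (Fin 2) →L[ℝ] EuclideanSpace ℝ (Fin 2) →L[ℝ] ℝ)
    (H : B → ℝ) (ψ : B → F) (b : B) : F :=
  vecD ψ b (hamField σ H b)

variable {F : Type*} [NormedAddCommGroup F] [NormedSpace ℝ F] {ψ : B → F}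

theorem hamDeriv_comp_chart_symm (hσ : IsAreaForm (B := B) σ)
    (hH : ContMDiff (𝓡 2) 𝓘(ℝ, ℝ) ∞ H) (hψ : ContMDiff (𝓡 2) 𝓘(ℝ, F) ∞ ψ) {c : B}
    {y : EuclideanSpace ℝ (Fin 2)} (hy : y ∈ (extChartAt (𝓡 2) c).target) :
    (hamDeriv σ H ψ ∘ (extChartAt (𝓡 2) c).symm) y =
      fderiv ℝ (ψ ∘ (extChartAt (𝓡 2) c).symm) y (hamChart σ H c y) := by
  rw [fderiv_comp_chart_symm hy ((hψ _).mdifferentiableAt (by norm_num)),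
    chartSymmD_hamChart hσ hH hy]
  rfl

theorem contMDiff_hamDeriv (hσ : IsAreaForm (B := B) σ)
    (hH : ContMDiff (𝓡 2) 𝓘(ℝ, ℝ) ∞ H) (hψ : ContMDiff (𝓡 2) 𝓘(ℝ, F) ∞ ψ) :
    ContMDiff (𝓡 2) 𝓘(ℝ, F) ∞ (hamDeriv σ H ψ) := by
  refine contMDiff_of_chart_symm fun c => ?_
  have h2 : ContDiffOn ℝ ∞ (fderiv ℝ (ψ ∘ (extChartAt (𝓡 2) c).symm)) _ :=
    (contDiffOn_comp_chart_symm hψ c).fderiv_of_isOpen (isOpen_extChartAt_target (I := 𝓡 2) c)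
      (by norm_num)
  exact (h2.clm_apply (contDiffOn_hamChart hσ hH c)).congr fun y hy =>
    hamDeriv_comp_chart_symm hσ hH hψ hy

/-! ### Linearization at a critical point -/

/-- The linearization of the Hamiltonian vector field at `p`, in the chart centred at `p`. -/
noncomputable def hamLin (σ : B → EuclideanSpace ℝ (Fin 2) →L[ℝ] EuclideanSpace ℝ (Fin 2) →L[ℝ] ℝ)
    (H : B → ℝ) (p : B) : EuclideanSpace ℝ (Fin 2) →L[ℝ] EuclideanSpace ℝ (Fin 2) :=
  fderiv ℝ (hamChart σ H p) (extChartAt (𝓡 2) p p)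

theorem hasFDerivAt_hamChart (hσ : IsAreaForm (B := B) σ) (hH : ContMDiff (𝓡 2) 𝓘(ℝ, ℝ) ∞ H)
    (p : B) : HasFDerivAt (hamChart σ H p) (hamLin σ H p) (extChartAt (𝓡 2) p p) :=
  (((contDiffOn_hamChart hσ hH p).contDiffAt (extChartAt_target_mem_nhds_self p)).differentiableAt
    (by norm_num)).hasFDerivAt

theorem hamChart_self (hσ : IsAreaForm (B := B) σ) (hH : ContMDiff (𝓡 2) 𝓘(ℝ, ℝ) ∞ H) {p : B}
    (hp : IsCritPoint (n := 2) H p) : hamChart σ H p (extChartAt (𝓡 2) p p) = 0 := by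
  rw [← chartD_hamField hσ hH (mem_extChartAt_source p), (hamField_eq_zero_iff hσ).2 hp, map_zero]

/-- Differentiate `σ(X, w) = dH(w)` in the chart at `p` for constant `w`. The derivative of the
coefficient of `σ` drops out because `X` vanishes at `p`. -/
theorem area_hamLin (hσ : IsAreaForm (B := B) σ) (hH : ContMDiff (𝓡 2) 𝓘(ℝ, ℝ) ∞ H) {p : B}
    (hp : IsCritPoint (n := 2) H p) (v w : EuclideanSpace ℝ (Fin 2)) :
    σ p (hamLin σ H p v) w = hessianAt (n := 2) H p v w := by
  set y₀ := extChartAt (𝓡 2) p p with hy₀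
  have hnhds := extChartAt_target_mem_nhds_self (n := 2) p
  set s : EuclideanSpace ℝ (Fin 2) → ℝ := twoFormInChart (n := 2) (M := B) σ p stdE0 stdE1
    with hs
  have hsd : HasFDerivAt s (fderiv ℝ s y₀) y₀ :=
    (((hσ.smooth p stdE0 stdE1).contDiffAt hnhds).differentiableAt (by norm_num)).hasFDerivAt
  have hZ := hasFDerivAt_hamChart hσ hH p
  have hZ0 : hamChart σ H p y₀ = 0 := hamChart_self hσ hH hp
  have hcoord : ∀ i : Fin 2, HasFDerivAt (fun y => hamChart σ H p y i)
      ((EuclideanSpace.proj i : EuclideanSpace ℝ (Fin 2) →L[ℝ] ℝ).comp (hamLin σ H p)) y₀ := fun i =>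
    (EuclideanSpace.proj i : EuclideanSpace ℝ (Fin 2) →L[ℝ] ℝ).hasFDerivAt.comp y₀ hZ
  have h1 := hsd.mul (((hcoord 0).mul_const (w 1)).sub ((hcoord 1).mul_const (w 0)))
  have h2 : HasFDerivAt (fun y => fderiv ℝ (H ∘ (extChartAt (𝓡 2) p).symm) y w)
      ((hessianAt (n := 2) H p).flip w) y₀ := by
    have hf : ContDiffAt ℝ ∞ (fderiv ℝ (H ∘ (extChartAt (𝓡 2) p).symm)) y₀ :=
      ((contDiffOn_comp_chart_symm hH p).fderiv_of_isOpen (isOpen_extChartAt_target (I := 𝓡 2) p)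
        (by norm_num) (m := ∞)).contDiffAt hnhds
    have := (hf.differentiableAt (by norm_num)).hasFDerivAt.clm_apply (hasFDerivAt_const w y₀)
    refine this.congr_fderiv ?_
    ext u
    simp [hessianAt, hy₀]
  have h3 : (fun y => fderiv ℝ (H ∘ (extChartAt (𝓡 2) p).symm) y w) =ᶠ[𝓝 y₀]
      fun y => s y * (hamChart σ H p y 0 * w 1 - hamChart σ H p y 1 * w 0) := by
    filter_upwards [hnhds] with y hy
    rw [← areaPull_hamChart hσ hy, alternating_apply (areaPull_self hσ p y)]
    rfl
  have h4 := DFunLike.congr_fun (h2.unique (h1.congr_of_eventuallyEq h3)) v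
  have hs0 : s y₀ = σ p stdE0 stdE1 := by
    change areaPull σ p y₀ stdE0 stdE1 = _
    rw [areaPull_apply, chartSymmD_self, chartSymmD_self, extChartAt_to_inv]
  rw [alternating_apply (area_self hσ p)]
  simp [hZ0, hs0] at h4
  rw [h4]
  ring

/-- In the derivative of `dψ(X)` the second derivative of `ψ` is paired with `X(p) = 0`. -/
theorem vecD_hamLin (hσ : IsAreaForm (B := B) σ) (hH : ContMDiff (𝓡 2) 𝓘(ℝ, ℝ) ∞ H)
    (hψ : ContMDiff (𝓡 2) 𝓘(ℝ, F) ∞ ψ) {p : B} (hp : IsCritPoint (n := 2) H p)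
    (v : EuclideanSpace ℝ (Fin 2)) :
    vecD (hamDeriv σ H ψ) p v = vecD ψ p (hamLin σ H p v) := by
  have hsrc := mem_extChartAt_source (I := 𝓡 2) p
  have hnhds := extChartAt_target_mem_nhds_self (n := 2) p
  rw [vecD_eq_fderiv hsrc (((contMDiff_hamDeriv hσ hH hψ) p).mdifferentiableAt (by norm_num)),
    vecD_eq_fderiv hsrc ((hψ p).mdifferentiableAt (by norm_num)), chartD_self, chartD_self]
  have hf : ContDiffAt ℝ ∞ (fderiv ℝ (ψ ∘ (extChartAt (𝓡 2) p).symm)) (extChartAt (𝓡 2) p p) :=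
    ((contDiffOn_comp_chart_symm hψ p).fderiv_of_isOpen (isOpen_extChartAt_target (I := 𝓡 2) p)
      (by norm_num) (m := ∞)).contDiffAt hnhds
  have h1 := (hf.differentiableAt (by norm_num)).hasFDerivAt.clm_apply
    (hasFDerivAt_hamChart hσ hH p)
  have h2 : hamDeriv σ H ψ ∘ (extChartAt (𝓡 2) p).symm =ᶠ[𝓝 (extChartAt (𝓡 2) p p)]
      fun y => fderiv ℝ (ψ ∘ (extChartAt (𝓡 2) p).symm) y (hamChart σ H p y) := by
    filter_upwards [hnhds] with y hy
    exact hamDeriv_comp_chart_symm hσ hH hψ hy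
  rw [(h1.congr_of_eventuallyEq h2).fderiv]
  simp only [ContinuousLinearMap.comp_apply, hamChart_self hσ hH hp, map_zero, add_zero]

end Surface

/-! ## Curves and maps depending on a real parameter -/

section Curves

variable {n : ℕ} {M : Type*} [TopologicalSpace M] [ChartedSpace (EuclideanSpace ℝ (Fin n)) M]
  {m : ℕ} {N : Type*} [TopologicalSpace N] [ChartedSpace (EuclideanSpace ℝ (Fin m)) N]

theorem HasVelocityAt.unique {γ : ℝ → M} {v w : EuclideanSpace ℝ (Fin n)} {t : ℝ}
    (hv : HasVelocityAt γ v t) (hw : HasVelocityAt γ w t) : v = w := by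
  have h := hasMFDerivAt_unique hv hw
  have h1 : (1 : ℝ) • v = (1 : ℝ) • w := DFunLike.congr_fun h (1 : ℝ)
  rwa [one_smul, one_smul] at h1

theorem hasVelocityAt_const (x : M) (t : ℝ) : HasVelocityAt (n := n) (fun _ : ℝ => x) 0 t := by
  have h : HasMFDerivAt 𝓘(ℝ, ℝ) (𝓡 n) (fun _ : ℝ => x) t _ := hasMFDerivAt_const x t
  refine h.congr_mfderiv ?_
  apply ContinuousLinearMap.ext_ring
  change (0 : EuclideanSpace ℝ (Fin n)) = (1 : ℝ) • (0 : EuclideanSpace ℝ (Fin n))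
  rw [smul_zero]

theorem HasVelocityAt.of_mdifferentiableAt {γ : ℝ → M} {t : ℝ}
    (h : MDifferentiableAt 𝓘(ℝ, ℝ) (𝓡 n) γ t) :
    HasVelocityAt γ (mfderiv 𝓘(ℝ, ℝ) (𝓡 n) γ t (1 : ℝ)) t := by
  refine h.hasMFDerivAt.congr_mfderiv ?_
  apply ContinuousLinearMap.ext_ring
  change (mfderiv 𝓘(ℝ, ℝ) (𝓡 n) γ t (1 : ℝ) : EuclideanSpace ℝ (Fin n)) = (1 : ℝ) •
    (mfderiv 𝓘(ℝ, ℝ) (𝓡 n) γ t (1 : ℝ) : EuclideanSpace ℝ (Fin n))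
  rw [one_smul]

theorem HasVelocityAt.mfderiv_one {γ : ℝ → M} {v : EuclideanSpace ℝ (Fin n)} {t : ℝ}
    (h : HasVelocityAt γ v t) :
    (mfderiv 𝓘(ℝ, ℝ) (𝓡 n) γ t (1 : ℝ) : EuclideanSpace ℝ (Fin n)) = v :=
  (HasVelocityAt.of_mdifferentiableAt (HasMFDerivAt.mdifferentiableAt h)).unique h

/-- Reparametrization of a curve. -/
theorem HasVelocityAt.comp {γ : ℝ → M} {v : EuclideanSpace ℝ (Fin n)} {g : ℝ → ℝ} {g' t : ℝ}
    (h : HasVelocityAt γ v (g t)) (hg : HasDerivAt g g' t) :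
    HasVelocityAt (fun s => γ (g s)) (g' • v) t := by
  have h1 := HasMFDerivAt.comp t h hg.hasFDerivAt.hasMFDerivAt
  refine HasMFDerivAt.congr_mfderiv h1 ?_
  apply ContinuousLinearMap.ext_ring
  change ((1 : ℝ) • g') • v = (1 : ℝ) • (g' • v)
  rw [one_smul, one_smul]

/-- The derivative of a map depending on a real parameter. -/
noncomputable def prodD (a : ℝ × M → N) (q : ℝ × M) :
    ℝ × EuclideanSpace ℝ (Fin n) →L[ℝ] EuclideanSpace ℝ (Fin m) :=
  mfderiv (𝓘(ℝ, ℝ).prod (𝓡 n)) (𝓡 m) a q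

theorem HasVelocityAt.prod_comp {a : ℝ × M → N} {g : ℝ → ℝ} {γ : ℝ → M} {t g' : ℝ}
    {v : EuclideanSpace ℝ (Fin n)}
    (ha : MDifferentiableAt (𝓘(ℝ, ℝ).prod (𝓡 n)) (𝓡 m) a (g t, γ t))
    (hg : HasDerivAt g g' t) (hγ : HasVelocityAt γ v t) :
    HasVelocityAt (fun s => a (g s, γ s)) (prodD (n := n) (m := m) a (g t, γ t) (g', v)) t := by
  have h1 := hg.hasFDerivAt.hasMFDerivAt.prodMk hγ
  have h2 := HasMFDerivAt.comp t ha.hasMFDerivAt h1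
  refine h2.congr_mfderiv ?_
  apply ContinuousLinearMap.ext_ring
  change prodD (n := n) (m := m) a (g t, γ t) ((1 : ℝ) • g', (1 : ℝ) • v) =
    (1 : ℝ) • prodD (n := n) (m := m) a (g t, γ t) (g', v)
  rw [one_smul, one_smul, one_smul]

theorem manD_eq_prodD {a : ℝ × M → N} {r : ℝ} {x : M}
    (ha : MDifferentiableAt (𝓘(ℝ, ℝ).prod (𝓡 n)) (𝓡 m) a (r, x))
    (v : EuclideanSpace ℝ (Fin n)) :
    manD (n := n) (m := m) (fun y => a (r, y)) x v = prodD (n := n) (m := m) a (r, x) (0, v) := by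
  have h1 : HasMFDerivAt (𝓡 n) (𝓘(ℝ, ℝ).prod (𝓡 n)) (fun y : M => (r, y)) x _ :=
    (hasMFDerivAt_const r x).prodMk (hasMFDerivAt_id x)
  have h2 := (HasMFDerivAt.comp x ha.hasMFDerivAt h1).mfderiv
  exact DFunLike.congr_fun h2 v

/-- The product rule for `t ↦ a (g t, γ t)`. -/
theorem HasVelocityAt.prod_comp_add {a : ℝ × M → N} {g : ℝ → ℝ} {γ : ℝ → M} {t g' : ℝ}
    {v : EuclideanSpace ℝ (Fin n)} {w : EuclideanSpace ℝ (Fin m)}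
    (ha : MDifferentiableAt (𝓘(ℝ, ℝ).prod (𝓡 n)) (𝓡 m) a (g t, γ t))
    (hg : HasDerivAt g g' t) (hγ : HasVelocityAt γ v t)
    (hw : HasVelocityAt (fun s => a (s, γ t)) w (g t)) :
    HasVelocityAt (fun s => a (g s, γ s))
      (g' • w + manD (n := n) (m := m) (fun y => a (g t, y)) (γ t) v) t := by
  have h1 := HasVelocityAt.prod_comp ha hg hγ
  have h2 : w = prodD (n := n) (m := m) a (g t, γ t) (1, 0) :=
    hw.unique (HasVelocityAt.prod_comp (g := fun s => s) (γ := fun _ => γ t) ha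
      (hasDerivAt_id _) (hasVelocityAt_const _ _))
  have h3 : prodD (n := n) (m := m) a (g t, γ t) (g', v) =
      g' • w + manD (n := n) (m := m) (fun y => a (g t, y)) (γ t) v := by
    rw [h2, manD_eq_prodD ha, ← map_smul, ← map_add]
    simp
  rwa [h3] at h1

theorem manD_comp_apply {k : ℕ} {K : Type*} [TopologicalSpace K]
    [ChartedSpace (EuclideanSpace ℝ (Fin k)) K] {g : N → K} {f : M → N} {x : M}
    (hg : MDifferentiableAt (𝓡 m) (𝓡 k) g (f x)) (hf : MDifferentiableAt (𝓡 n) (𝓡 m) f x)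
    (v : EuclideanSpace ℝ (Fin n)) :
    manD (n := n) (m := k) (fun y => g (f y)) x v
      = manD (n := m) (m := k) g (f x) (manD (n := n) (m := m) f x v) :=
  DFunLike.congr_fun (mfderiv_comp x hg hf) v

end Curves

/-- Uniqueness for `‖F'‖ ≤ K ‖F‖`. -/
theorem eq_zero_of_norm_deriv_le {F : Type*} [NormedAddCommGroup F] [NormedSpace ℝ F]
    {f f' : ℝ → F} {K : ℝ} (hf : ∀ t, HasDerivAt f (f' t) t) (h0 : f 0 = 0)
    (hle : ∀ t, ‖f' t‖ ≤ K * ‖f t‖) (t : ℝ) : f t = 0 := by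
  have key : ∀ g g' : ℝ → F, (∀ t, HasDerivAt g (g' t) t) → g 0 = 0 →
      (∀ t, ‖g' t‖ ≤ K * ‖g t‖) → ∀ t, 0 ≤ t → g t = 0 := by
    intro g g' hg hg0 hgle t ht
    exact eq_zero_of_abs_deriv_le_mul_abs_self_of_eq_zero_right
      (fun s _ => (hg s).continuousAt.continuousWithinAt)
      (fun s _ => (hg s).hasDerivWithinAt) hg0 (fun s _ => hgle s) t ⟨ht, le_rfl⟩
  rcases le_total 0 t with ht | ht
  · exact key f f' hf h0 hle t ht
  · have h := key (fun s => f (-s)) (fun s => -f' (-s))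
      (fun s => by simpa [Function.comp_def] using (hf (-s)).scomp s (hasDerivAt_neg s)) (by simpa using h0)
      (fun s => by simpa using hle (-s)) (-t) (by linarith)
    simpa using h

/-! ## Prequantization bundles -/

section Prequantization

variable {B V : Type*} [TopologicalSpace B] [ChartedSpace (EuclideanSpace ℝ (Fin 2)) B]
  [TopologicalSpace V] [ChartedSpace (EuclideanSpace ℝ (Fin 3)) V] [MulAction Circle V]
  {σ : B → EuclideanSpace ℝ (Fin 2) →L[ℝ] EuclideanSpace ℝ (Fin 2) →L[ℝ] ℝ}
  {proj : V → B} {lam : V → EuclideanSpace ℝ (Fin 3) →L[ℝ] ℝ}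

/-- The derivative of the bundle projection. -/
noncomputable abbrev projD (proj : V → B) (x : V) :
    EuclideanSpace ℝ (Fin 3) →L[ℝ] EuclideanSpace ℝ (Fin 2) :=
  manD (n := 3) (m := 2) proj x

/-- The generator of the circle action. -/
noncomputable def genVec (x : V) : EuclideanSpace ℝ (Fin 3) :=
  mfderiv 𝓘(ℝ, ℝ) (𝓡 3) (fun t : ℝ => Circle.exp t • x) 0 (1 : ℝ)

namespace IsPrequantizationBundle

theorem contMDiff_action (hV : IsPrequantizationBundle σ proj lam) :
    ContMDiff (𝓘(ℝ, ℝ).prod (𝓡 3)) (𝓡 3) ∞ (fun q : ℝ × V => Circle.exp q.1 • q.2) := by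
  have := hV.smooth_action
  exact (ContMDiffSMul.contMDiff_smul (I := 𝓡 1) (I' := 𝓡 3) (n := ∞) (G := Circle) (M := V)).comp
    ((contMDiff_circleExp.comp contMDiff_fst).prodMk contMDiff_snd)

theorem mdifferentiableAt_action (hV : IsPrequantizationBundle σ proj lam) (q : ℝ × V) :
    MDifferentiableAt (𝓘(ℝ, ℝ).prod (𝓡 3)) (𝓡 3) (fun q : ℝ × V => Circle.exp q.1 • q.2) q :=
  (hV.contMDiff_action q).mdifferentiableAt (by norm_num)

theorem mdifferentiableAt_proj (hV : IsPrequantizationBundle σ proj lam) (x : V) :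
    MDifferentiableAt (𝓡 3) (𝓡 2) proj x :=
  (hV.smooth_proj x).mdifferentiableAt (by norm_num)

theorem mdifferentiableAt_smul (hV : IsPrequantizationBundle σ proj lam) (r : ℝ) (x : V) :
    MDifferentiableAt (𝓡 3) (𝓡 3) (fun y : V => Circle.exp r • y) x :=
  (hV.mdifferentiableAt_action (r, x)).comp x
    (mdifferentiableAt_const.prodMk mdifferentiableAt_id)

theorem proj_smul (hV : IsPrequantizationBundle σ proj lam) (z : Circle) (x : V) :
    proj (z • x) = proj x :=
  ((hV.fibres x (z • x)).2 ⟨z, rfl⟩).symm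

theorem hasVelocityAt_smul (hV : IsPrequantizationBundle σ proj lam) (x : V) (t : ℝ) :
    HasVelocityAt (fun s : ℝ => Circle.exp s • x) (genVec (Circle.exp t • x)) t := by
  have h0 : HasVelocityAt (fun s : ℝ => Circle.exp s • (Circle.exp t • x))
      (genVec (Circle.exp t • x)) 0 :=
    HasVelocityAt.of_mdifferentiableAt ((hV.mdifferentiableAt_action (0, Circle.exp t • x)).comp
      (0 : ℝ) (mdifferentiableAt_id.prodMk mdifferentiableAt_const))
  rw [← sub_self t] at h0
  have h1 := HasVelocityAt.comp (g := fun s => s - t) h0 ((hasDerivAt_id t).sub_const t)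
  rw [one_smul] at h1
  refine cast ?_ h1
  congr 1
  funext s
  rw [smul_smul, ← Circle.exp_add, sub_add_cancel]

theorem lam_genVec (hV : IsPrequantizationBundle σ proj lam) (x : V) : lam x (genVec x) = 1 := by
  have h : lam ((Circle.exp 0) • x) (genVec x) = 1 := hV.generator x
  rwa [Circle.exp_zero, one_smul] at h

theorem projD_genVec (hV : IsPrequantizationBundle σ proj lam) (x : V) :
    projD proj x (genVec x) = 0 := by
  have h := hV.hasVelocityAt_smul x 0
  have h1 := h.manD_comp (hV.mdifferentiableAt_proj _)
  simp only [hV.proj_smul] at h1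
  have h2 := h1.unique (hasVelocityAt_const (proj x) 0)
  rwa [Circle.exp_zero, one_smul] at h2

theorem extD_lam (hV : IsPrequantizationBundle σ proj lam) (x : V)
    (v w : EuclideanSpace ℝ (Fin 3)) :
    extD lam x v w = σ (proj x) (projD proj x v) (projD proj x w) :=
  hV.curvature x v w

theorem projD_surjective (hV : IsPrequantizationBundle σ proj lam) (x : V) :
    Function.Surjective (projD proj x) := hV.submersion x

/-- The kernel of a surjection from dimension three to dimension two is a line, and it contains the
generator, which is nonzero since `λ` is `1` on it. Tangent vectors are therefore determined by
their projection and their `λ`-value. -/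
theorem eq_smul_genVec (hV : IsPrequantizationBundle σ proj lam) {x : V}
    {v : EuclideanSpace ℝ (Fin 3)} (hv : projD proj x v = 0) : v = lam x v • genVec x := by
  have hker : Module.finrank ℝ (LinearMap.ker (projD proj x).toLinearMap) = 1 := by
    have h1 := LinearMap.finrank_range_add_finrank_ker (projD proj x).toLinearMap
    rw [LinearMap.range_eq_top.2 (hV.projD_surjective x), finrank_top,
      finrank_euclideanSpace_fin, finrank_euclideanSpace_fin] at h1
    omega
  have hg : (⟨genVec x, hV.projD_genVec x⟩ : LinearMap.ker (projD proj x).toLinearMap) ≠ 0 := by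
    intro h
    have h1 : genVec x = 0 := congrArg Subtype.val h
    have h2 := hV.lam_genVec x
    rw [h1, map_zero] at h2
    exact zero_ne_one h2
  obtain ⟨c, hc⟩ := (finrank_eq_one_iff_of_nonzero' _ hg).1 hker ⟨v, hv⟩
  have hc1 : c • genVec x = v := congrArg Subtype.val hc
  rw [← hc1, map_smul, hV.lam_genVec, smul_eq_mul, mul_one]

theorem eq_of_projD_eq (hV : IsPrequantizationBundle σ proj lam) {x : V}
    {v w : EuclideanSpace ℝ (Fin 3)} (h : projD proj x v = projD proj x w)
    (hl : lam x v = lam x w) : v = w := by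
  have h1 := hV.eq_smul_genVec (x := x) (v := v - w) (by rw [map_sub, h, sub_self])
  rw [map_sub, hl, sub_self, zero_smul] at h1
  exact sub_eq_zero.1 h1

theorem exists_horizontal (hV : IsPrequantizationBundle σ proj lam) (x : V)
    (u : EuclideanSpace ℝ (Fin 2)) : ∃ w, lam x w = 0 ∧ projD proj x w = u := by
  obtain ⟨w, hw⟩ := hV.projD_surjective x u
  refine ⟨w - lam x w • genVec x, ?_, ?_⟩
  · rw [map_sub, map_smul, hV.lam_genVec, smul_eq_mul, mul_one, sub_self]
  · rw [map_sub, map_smul, hV.projD_genVec, smul_zero, sub_zero, hw]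

theorem manD_smul_genVec (hV : IsPrequantizationBundle σ proj lam) (r : ℝ) (x : V) :
    manD (n := 3) (m := 3) (fun y : V => Circle.exp r • y) x (genVec x)
      = genVec (Circle.exp r • x) := by
  have h1 := hV.hasVelocityAt_smul x 0
  rw [Circle.exp_zero, one_smul] at h1
  have h2 := h1.manD_comp (hV.mdifferentiableAt_smul r _)
  have h3 := hV.hasVelocityAt_smul (Circle.exp r • x) 0
  simp only [Circle.exp_zero, one_smul] at h2 h3
  refine h2.unique ?_
  refine cast ?_ h3
  congr 1
  funext s
  rw [smul_smul, smul_smul, mul_comm]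

theorem projD_manD_smul (hV : IsPrequantizationBundle σ proj lam) (r : ℝ) (x : V)
    (v : EuclideanSpace ℝ (Fin 3)) :
    projD proj (Circle.exp r • x) (manD (n := 3) (m := 3) (fun y : V => Circle.exp r • y) x v)
      = projD proj x v := by
  have h := manD_comp_apply (hV.mdifferentiableAt_proj _) (hV.mdifferentiableAt_smul r x) v
  simp only [hV.proj_smul] at h
  exact h.symm

theorem lam_manD_smul (hV : IsPrequantizationBundle σ proj lam) (r : ℝ) (x : V)
    (v : EuclideanSpace ℝ (Fin 3)) :
    lam (Circle.exp r • x) (manD (n := 3) (m := 3) (fun y : V => Circle.exp r • y) x v)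
      = lam x v := hV.invariant _ x v

theorem isReebFlow (hV : IsPrequantizationBundle σ proj lam) :
    IsReebFlow (n := 3) lam (fun t x => Circle.exp t • x) where
  smooth := hV.contMDiff_action
  zero x := by rw [Circle.exp_zero, one_smul]
  curve x t := ⟨genVec (Circle.exp t • x), ⟨hV.lam_genVec _,
    fun (w : EuclideanSpace ℝ (Fin 3)) => by
      change extD lam (Circle.exp t • x) (genVec (Circle.exp t • x)) w = 0
      rw [hV.extD_lam, hV.projD_genVec, map_zero, zero_apply]⟩,
    hV.hasVelocityAt_smul x t⟩

theorem isSimple (hV : IsPrequantizationBundle σ proj lam) {α : V → EuclideanSpace ℝ (Fin 3) →L[ℝ] ℝ}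
    {x : V} {c : ℝ} (hc : 0 < c)
    (h : IsReebCurve (n := 3) α (fun t => Circle.exp (t / c) • x)) :
    IsSimpleReebOrbit (n := 3) α (fun t => Circle.exp (t / c) • x) (2 * Real.pi * c) where
  pos := by positivity
  curve := h
  periodic t := by
    have : (t + 2 * Real.pi * c) / c = t / c + 2 * Real.pi := by field_simp
    simp only [this, Circle.exp_add_two_pi]
  minimal Q hQ hQP hper := by
    have h0 := hper 0
    simp only [zero_add, zero_div, Circle.exp_zero, one_smul] at h0
    -- Freeness of the action turns a return to `x` into `Q / c ∈ 2πℤ`, so the first positive return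
    -- time is `2πc`.
    obtain ⟨m, hm⟩ := Circle.exp_eq_one.1 (hV.free _ _ h0)
    have h1 : Q = m * (2 * Real.pi) * c := by rw [← hm]; field_simp
    have hm0 : (0 : ℝ) < m := by
      by_contra hneg
      have : (m : ℝ) * (2 * Real.pi) * c ≤ 0 := by
        have : 0 ≤ 2 * Real.pi * c := by positivity
        nlinarith
      linarith
    have hm1 : (1 : ℝ) ≤ m := by exact_mod_cast (Int.cast_pos.1 hm0 : 0 < m)
    have : 0 < 2 * Real.pi * c := by positivity
    nlinarith

end IsPrequantizationBundle

end Prequantization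

/-! ## The perturbed contact form -/

theorem norm_smul_hamDeriv_le {B : Type*} [TopologicalSpace B]
    [ChartedSpace (EuclideanSpace ℝ (Fin 2)) B]
    {σ : B → EuclideanSpace ℝ (Fin 2) →L[ℝ] EuclideanSpace ℝ (Fin 2) →L[ℝ] ℝ} {H : B → ℝ}
    {F : Type*} [NormedAddCommGroup F] [NormedSpace ℝ F] {ψ : B → F}
    {C κ : ℝ} (hκ : 0 ≤ κ) (hC : ∀ (x : B) (v : EuclideanSpace ℝ (Fin 2)),
      ‖vecD (hamDeriv σ H ψ) x v‖ ≤ C * ‖vecD ψ x v‖) (b : B) :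
    ‖κ • hamDeriv σ H (hamDeriv σ H ψ) b‖ ≤ (κ * C) * ‖hamDeriv σ H ψ b‖ := by
  rw [norm_smul, Real.norm_eq_abs, abs_of_nonneg hκ, mul_assoc]
  exact mul_le_mul_of_nonneg_left (hC _ _) hκ

/-- The action of a closed Reeb orbit is its period. -/
theorem orbitAction_eq {n : ℕ} {M : Type*} [TopologicalSpace M]
    [ChartedSpace (EuclideanSpace ℝ (Fin n)) M] {α : M → EuclideanSpace ℝ (Fin n) →L[ℝ] ℝ}
    {γ : ℝ → M}
    (hγ : IsReebCurve (n := n) α γ) (P : ℝ) : orbitAction (n := n) α γ P = P := by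
  have h : ∀ t, α (γ t) (mfderiv 𝓘(ℝ, ℝ) (𝓡 n) γ t (1 : ℝ)) = 1 := fun t => by
    obtain ⟨v, hv, hvel⟩ := hγ t
    have h1 : (mfderiv 𝓘(ℝ, ℝ) (𝓡 n) γ t (1 : ℝ) : EuclideanSpace ℝ (Fin n)) = v :=
      HasVelocityAt.mfderiv_one hvel
    have h2 : α (γ t) v = 1 := hv.1
    exact (congrArg (α (γ t)) h1).trans h2
  change ∫ t in (0 : ℝ)..P, α (γ t) (mfderiv 𝓘(ℝ, ℝ) (𝓡 n) γ t (1 : ℝ)) = P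
  simp only [h]
  simp

/-- The perturbed form, on vectors of the model space. -/
noncomputable def pertForm {B V : Type*} (proj : V → B) (H : B → ℝ) (lam : V → EuclideanSpace ℝ (Fin 3) →L[ℝ] ℝ)
    (ε : ℝ) (x : V) : EuclideanSpace ℝ (Fin 3) →L[ℝ] ℝ :=
  (1 + ε * H (proj x)) • lam x

theorem pertForm_apply {B V : Type*} {proj : V → B} {lam : V → EuclideanSpace ℝ (Fin 3) →L[ℝ] ℝ}
    {H : B → ℝ} {ε : ℝ} (x : V) (v : EuclideanSpace ℝ (Fin 3)) :
    pertForm proj H lam ε x v = (1 + ε * H (proj x)) * lam x v := rfl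

section Perturbed

variable {B V : Type*} [TopologicalSpace B] [ChartedSpace (EuclideanSpace ℝ (Fin 2)) B]
  [TopologicalSpace V] [ChartedSpace (EuclideanSpace ℝ (Fin 3)) V] [MulAction Circle V]
  {σ : B → EuclideanSpace ℝ (Fin 2) →L[ℝ] EuclideanSpace ℝ (Fin 2) →L[ℝ] ℝ}
  {proj : V → B} {lam : V → EuclideanSpace ℝ (Fin 3) →L[ℝ] ℝ} {H : B → ℝ} {ε : ℝ}

namespace IsPrequantizationBundle

theorem contMDiff_factor (hV : IsPrequantizationBundle σ proj lam)
    (hH : ContMDiff (𝓡 2) 𝓘(ℝ, ℝ) ∞ H) (ε : ℝ) :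
    ContMDiff (𝓡 3) 𝓘(ℝ, ℝ) ∞ fun x => 1 + ε * H (proj x) := by
  have h : ContDiff ℝ ∞ fun u : ℝ => 1 + ε * u := by fun_prop
  exact h.contMDiff.comp (hH.comp hV.smooth_proj)

theorem vecD_factor (hV : IsPrequantizationBundle σ proj lam)
    (hH : ContMDiff (𝓡 2) 𝓘(ℝ, ℝ) ∞ H) (x : V) (v : EuclideanSpace ℝ (Fin 3)) :
    vecD (fun x => 1 + ε * H (proj x)) x v = ε * vecD H (proj x) (projD proj x v) := by
  have h1 : HasFDerivAt (fun u : ℝ => 1 + ε * u) (ε • (1 : ℝ →L[ℝ] ℝ)) (H (proj x)) := by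
    have := ((hasFDerivAt_id (𝕜 := ℝ) (H (proj x))).const_mul ε).const_add 1
    exact this
  have h2 := ((hH (proj x)).mdifferentiableAt (by norm_num)).hasMFDerivAt.comp x
    (hV.mdifferentiableAt_proj x).hasMFDerivAt
  have h3 := HasMFDerivAt.comp x h1.hasMFDerivAt h2
  exact DFunLike.congr_fun h3.mfderiv v

variable [IsManifold (𝓡 3) ∞ V]

theorem extD_pertForm (hV : IsPrequantizationBundle σ proj lam)
    (hH : ContMDiff (𝓡 2) 𝓘(ℝ, ℝ) ∞ H) (x : V) (v w : EuclideanSpace ℝ (Fin 3)) :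
    extD (pertForm proj H lam ε) x v w =
      ε * vecD H (proj x) (projD proj x v) * lam x w
        - ε * vecD H (proj x) (projD proj x w) * lam x v
        + (1 + ε * H (proj x)) * σ (proj x) (projD proj x v) (projD proj x w) := by
  rw [← hV.vecD_factor hH, ← hV.vecD_factor hH, ← hV.extD_lam]
  exact extD_smul hV.smooth_form (hV.contMDiff_factor hH ε) x v w

theorem isReebVector_pertForm (hV : IsPrequantizationBundle σ proj lam)
    (hH : ContMDiff (𝓡 2) 𝓘(ℝ, ℝ) ∞ H) {x : V} (hf : 0 < 1 + ε * H (proj x))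
    {v : EuclideanSpace ℝ (Fin 3)} :
    IsReebVector (n := 3) (pertForm proj H lam ε) x v ↔
      lam x v = (1 + ε * H (proj x))⁻¹ ∧
        projD proj x v = (ε / (1 + ε * H (proj x)) ^ 2) • hamField σ H (proj x) := by
  change (pertForm proj H lam ε x v = 1 ∧ ∀ w : EuclideanSpace ℝ (Fin 3),
    extD (pertForm proj H lam ε) x v w = 0) ↔ _
  have hff : (1 + ε * H (proj x)) ≠ 0 := hf.ne'
  set f := 1 + ε * H (proj x)
  constructor
  · rintro ⟨h1, h2⟩
    have hl : lam x v = f⁻¹ := by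
      rw [pertForm_apply] at h1
      exact eq_inv_of_mul_eq_one_right h1
    refine ⟨hl, ?_⟩
    rw [← sub_eq_zero]
    -- Testing `d(fλ)(v, ·) = 0` on horizontal lifts is enough to determine the projection of `v`,
    -- by nondegeneracy of `σ`.
    refine area_nondegenerate hV.areaForm (proj x) _ fun u => ?_
    obtain ⟨w, hw, rfl⟩ := hV.exists_horizontal x u
    have h3 := h2 w
    rw [hV.extD_pertForm hH, hw, hl] at h3
    rw [map_sub, sub_apply, map_smul, smul_apply, area_hamField hV.areaForm, smul_eq_mul]
    change _ + f * _ = 0 at h3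
    field_simp at h3 ⊢
    linarith
  · rintro ⟨h1, h2⟩
    refine ⟨by rw [pertForm_apply, h1]; exact mul_inv_cancel₀ hff, fun w => ?_⟩
    rw [hV.extD_pertForm hH, h1, h2, map_smul, map_smul, smul_apply, area_hamField hV.areaForm,
      ← area_hamField hV.areaForm (proj x) (hamField σ H (proj x)), area_self hV.areaForm]
    change _ + f * _ = 0
    simp only [smul_eq_mul]
    field_simp
    ring

theorem isContactForm_pertForm (hV : IsPrequantizationBundle σ proj lam)
    (hH : ContMDiff (𝓡 2) 𝓘(ℝ, ℝ) ∞ H) (hpos : ∀ b, 0 < 1 + ε * H b) :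
    IsContactForm (n := 3) (pertForm proj H lam ε) where
  smooth := IsSmoothOneForm.smul hV.smooth_form (hV.contMDiff_factor hH ε)
  ne_zero x h := by
    have h1 : pertForm proj H lam ε x (genVec x) = 0 := DFunLike.congr_fun h (genVec x)
    rw [pertForm_apply, hV.lam_genVec, mul_one] at h1
    exact (hpos _).ne' h1
  nondegenerate x (v : EuclideanSpace ℝ (Fin 3)) hv h := by
    have hz : ∀ {w}, pertForm proj H lam ε x w = 0 → lam x w = 0 := fun {w} hw => by
      rw [pertForm_apply] at hw
      exact (mul_eq_zero.1 hw).resolve_left (hpos _).ne'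
    refine hV.eq_of_projD_eq (x := x) (v := v) (w := 0) ?_ (by rw [hz hv, map_zero])
    rw [map_zero]
    refine area_nondegenerate hV.areaForm (proj x) _ fun u => ?_
    obtain ⟨w, hw, rfl⟩ := hV.exists_horizontal x u
    have h1 : extD (pertForm proj H lam ε) x v w = 0 :=
      h w (by change pertForm proj H lam ε x w = 0; rw [pertForm_apply, hw, mul_zero])
    rw [hV.extD_pertForm hH, hw, hz hv] at h1
    have := (hpos (proj x)).ne'
    simpa [this] using h1

end IsPrequantizationBundle

/-! ### Reeb curves of the perturbed form -/

variable [IsManifold (𝓡 3) ∞ V] {γ : ℝ → V}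

namespace IsPrequantizationBundle

theorem exists_velocity (hV : IsPrequantizationBundle σ proj lam)
    (hH : ContMDiff (𝓡 2) 𝓘(ℝ, ℝ) ∞ H) (hpos : ∀ b, 0 < 1 + ε * H b)
    (hγ : IsReebCurve (n := 3) (pertForm proj H lam ε) γ) (t : ℝ) :
    ∃ v : EuclideanSpace ℝ (Fin 3), HasVelocityAt γ v t ∧
      lam (γ t) v = (1 + ε * H (proj (γ t)))⁻¹ ∧
      projD proj (γ t) v = (ε / (1 + ε * H (proj (γ t))) ^ 2) • hamField σ H (proj (γ t)) := by
  obtain ⟨v, hv, hvel⟩ := hγ t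
  exact ⟨v, hvel, (hV.isReebVector_pertForm hH (hpos _)).1 hv⟩

theorem hasVelocityAt_proj (hV : IsPrequantizationBundle σ proj lam)
    (hH : ContMDiff (𝓡 2) 𝓘(ℝ, ℝ) ∞ H) (hpos : ∀ b, 0 < 1 + ε * H b)
    (hγ : IsReebCurve (n := 3) (pertForm proj H lam ε) γ) (t : ℝ) :
    HasVelocityAt (n := 2) (fun s => proj (γ s))
      ((ε / (1 + ε * H (proj (γ t))) ^ 2) • hamField σ H (proj (γ t))) t := by
  obtain ⟨v, hv, -, h⟩ := hV.exists_velocity hH hpos hγ t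
  rw [← h]
  exact hv.manD_comp (hV.mdifferentiableAt_proj _)

/-- The Hamiltonian is constant along Reeb curves. -/
theorem ham_proj_eq (hV : IsPrequantizationBundle σ proj lam)
    (hH : ContMDiff (𝓡 2) 𝓘(ℝ, ℝ) ∞ H) (hpos : ∀ b, 0 < 1 + ε * H b)
    (hγ : IsReebCurve (n := 3) (pertForm proj H lam ε) γ) (t : ℝ) :
    H (proj (γ t)) = H (proj (γ 0)) := by
  have h : ∀ s, HasDerivAt (fun s => H (proj (γ s))) 0 s := fun s => by
    have h1 := (hV.hasVelocityAt_proj hH hpos hγ s).vecD_comp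
      ((hH _).mdifferentiableAt (by norm_num))
    rwa [map_smul, ← area_hamField hV.areaForm, area_self hV.areaForm, smul_zero] at h1
  exact is_const_of_deriv_eq_zero (fun s => (h s).differentiableAt) (fun s => (h s).deriv) t 0

/-- The derivative of a vector valued map along the projection of a Reeb curve. -/
theorem hasDerivAt_comp_proj {F : Type*} [NormedAddCommGroup F] [NormedSpace ℝ F] {ψ : B → F}
    (hV : IsPrequantizationBundle σ proj lam)
    (hH : ContMDiff (𝓡 2) 𝓘(ℝ, ℝ) ∞ H) (hpos : ∀ b, 0 < 1 + ε * H b)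
    (hγ : IsReebCurve (n := 3) (pertForm proj H lam ε) γ)
    (hψ : ContMDiff (𝓡 2) 𝓘(ℝ, F) ∞ ψ) (t : ℝ) :
    HasDerivAt (fun s => ψ (proj (γ s)))
      ((ε / (1 + ε * H (proj (γ 0))) ^ 2) • hamDeriv σ H ψ (proj (γ t))) t := by
  have h := (hV.hasVelocityAt_proj hH hpos hγ t).vecD_comp
    ((hψ _).mdifferentiableAt (by norm_num))
  rw [map_smul, hV.ham_proj_eq hH hpos hγ t] at h
  exact h

/-- The fibres over critical points are Reeb curves. -/
theorem isReebCurve_smul (hV : IsPrequantizationBundle σ proj lam)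
    (hH : ContMDiff (𝓡 2) 𝓘(ℝ, ℝ) ∞ H) (hpos : ∀ b, 0 < 1 + ε * H b) {x : V}
    (hcrit : IsCritPoint (n := 2) H (proj x)) :
    IsReebCurve (n := 3) (pertForm proj H lam ε)
      (fun t => Circle.exp (t / (1 + ε * H (proj x))) • x) := fun t => by
  have h := HasVelocityAt.comp (g := fun s => s / (1 + ε * H (proj x)))
    (hV.hasVelocityAt_smul x (t / (1 + ε * H (proj x)))) ((hasDerivAt_id t).div_const _)
  refine ⟨_, (hV.isReebVector_pertForm hH (hpos _)).2 ⟨?_, ?_⟩, h⟩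
  · rw [map_smul, hV.lam_genVec, hV.proj_smul, smul_eq_mul, mul_one, one_div]
  · rw [map_smul, hV.projD_genVec, hV.proj_smul, (hamField_eq_zero_iff hV.areaForm).2 hcrit,
      smul_zero, smul_zero]

/-- The Reeb curves over a critical point are the fibres. -/
theorem eq_smul_of_proj_eq [T2Space V] (hV : IsPrequantizationBundle σ proj lam)
    (hH : ContMDiff (𝓡 2) 𝓘(ℝ, ℝ) ∞ H) (hpos : ∀ b, 0 < 1 + ε * H b)
    (hγ : IsReebCurve (n := 3) (pertForm proj H lam ε) γ)
    (hcrit : IsCritPoint (n := 2) H (proj (γ 0))) (hconst : ∀ t, proj (γ t) = proj (γ 0))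
    (t : ℝ) : γ t = Circle.exp (t / (1 + ε * H (proj (γ 0)))) • γ 0 := by
  set c := 1 + ε * H (proj (γ 0)) with hc
  have hvel : ∀ s, HasVelocityAt γ (c⁻¹ • genVec (γ s)) s := fun s => by
    obtain ⟨v, hv, h1, h2⟩ := hV.exists_velocity hH hpos hγ s
    rw [hconst s] at h1 h2
    rw [(hamField_eq_zero_iff hV.areaForm).2 hcrit, smul_zero] at h2
    rwa [hV.eq_smul_genVec h2, h1] at hv
  -- Rotating back along the fibre at the same speed stops the curve, so no uniqueness theorem for
  -- integral curves is needed.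
  have hz : ∀ s, HasVelocityAt (n := 3) (fun s => Circle.exp (-s / c) • γ s) 0 s := fun s => by
    have h := HasVelocityAt.prod_comp_add (a := fun q : ℝ × V => Circle.exp q.1 • q.2)
      (g := fun s => -s / c) (hV.mdifferentiableAt_action (-s / c, γ s))
      ((hasDerivAt_neg s).div_const c) (hvel s) (hV.hasVelocityAt_smul (γ s) (-s / c))
    simp only [map_smul] at h
    rw [hV.manD_smul_genVec, ← add_smul] at h
    have : -1 / c + c⁻¹ = 0 := by ring
    rwa [this, zero_smul] at h
  have h := eq_of_hasVelocityAt_zero hz t 0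
  simp only [neg_zero, zero_div, Circle.exp_zero, one_smul] at h
  rw [← h, smul_smul, ← Circle.exp_add, ← add_div, add_neg_cancel, zero_div, Circle.exp_zero,
    one_smul]

variable [T2Space B] [IsManifold (𝓡 2) ∞ B]

theorem proj_eq_of_forall_crit (hV : IsPrequantizationBundle σ proj lam)
    (hH : ContMDiff (𝓡 2) 𝓘(ℝ, ℝ) ∞ H) (hpos : ∀ b, 0 < 1 + ε * H b)
    (hγ : IsReebCurve (n := 3) (pertForm proj H lam ε) γ)
    (h : ∀ t, hamField σ H (proj (γ t)) = 0) (t : ℝ) : proj (γ t) = proj (γ 0) :=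
  eq_of_hasVelocityAt_zero (γ := fun s => proj (γ s)) (fun s => by
    have := hV.hasVelocityAt_proj hH hpos hγ s
    rwa [h, smul_zero] at this) t 0

section Embedded

variable {F : Type*} [NormedAddCommGroup F] [InnerProductSpace ℝ F] {ψ : B → F} {C : ℝ}

/-- A Reeb curve starting over a critical point stays over it. -/
theorem proj_eq_of_crit (hV : IsPrequantizationBundle σ proj lam)
    (hH : ContMDiff (𝓡 2) 𝓘(ℝ, ℝ) ∞ H) (hpos : ∀ b, 0 < 1 + ε * H b)
    (hγ : IsReebCurve (n := 3) (pertForm proj H lam ε) γ)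
    (hψ : ContMDiff (𝓡 2) 𝓘(ℝ, F) ∞ ψ) (hinj : ∀ x, Function.Injective (vecD (n := 2) ψ x))
    (hε : 0 ≤ ε) (hC : ∀ (x : B) (v : EuclideanSpace ℝ (Fin 2)),
      ‖vecD (hamDeriv σ H ψ) x v‖ ≤ C * ‖vecD ψ x v‖)
    (hcrit : IsCritPoint (n := 2) H (proj (γ 0))) (t : ℝ) : proj (γ t) = proj (γ 0) := by
  -- Along the curve `dψ(X)` obeys a linear differential inequality and vanishes at time `0`, hence
  -- always.
  have h0 := eq_zero_of_norm_deriv_le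
    (hV.hasDerivAt_comp_proj hH hpos hγ (contMDiff_hamDeriv hV.areaForm hH hψ))
    (by rw [hamDeriv, (hamField_eq_zero_iff hV.areaForm).2 hcrit, map_zero])
    (fun t => norm_smul_hamDeriv_le (by positivity) hC (proj (γ t)))
  refine hV.proj_eq_of_forall_crit hH hpos hγ (fun s => hinj (proj (γ s)) ?_) t
  rw [map_zero]
  exact h0 s

/-- A closed Reeb orbit of small period lies over a critical point. -/
theorem crit_of_periodic (hV : IsPrequantizationBundle σ proj lam)
    (hH : ContMDiff (𝓡 2) 𝓘(ℝ, ℝ) ∞ H) (hpos : ∀ b, 0 < 1 + ε * H b)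
    {P : ℝ} (hγ : IsReebOrbit (n := 3) (pertForm proj H lam ε) γ P)
    (hψ : ContMDiff (𝓡 2) 𝓘(ℝ, F) ∞ ψ) (hinj : ∀ x, Function.Injective (vecD (n := 2) ψ x))
    (hε : 0 < ε) (hC : ∀ (x : B) (v : EuclideanSpace ℝ (Fin 2)),
      ‖vecD (hamDeriv σ H ψ) x v‖ ≤ C * ‖vecD ψ x v‖)
    (hsmall : ε / (1 + ε * H (proj (γ 0))) ^ 2 * C * P < 1) :
    IsCritPoint (n := 2) H (proj (γ 0)) ∧ ∀ t, proj (γ t) = proj (γ 0) := by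
  have hP := hγ.pos
  set κ := ε / (1 + ε * H (proj (γ 0))) ^ 2 with hκ
  have hκ0 : 0 < κ := div_pos hε (pow_pos (hpos _) 2)
  set f : ℝ → F := fun t => hamDeriv σ H ψ (proj (γ t)) with hf
  have hy := hV.hasDerivAt_comp_proj hH hpos hγ.curve hψ
  have hfd := hV.hasDerivAt_comp_proj hH hpos hγ.curve (contMDiff_hamDeriv hV.areaForm hH hψ)
  have hfle := fun t => norm_smul_hamDeriv_le hκ0.le hC (proj (γ t))
  have hfper : Function.Periodic f P := fun t => by simp only [hf, hγ.periodic t]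
  have hfc : Continuous f := continuous_iff_continuousAt.2 fun t => (hfd t).continuousAt
  obtain ⟨t₀, ht₀, hmax⟩ := isCompact_Icc.exists_isMaxOn (nonempty_Icc.2 hP.le)
    hfc.norm.continuousOn
  have hmax' : ∀ t ∈ Icc 0 P, ‖f t‖ ≤ ‖f t₀‖ := fun t ht => hmax ht
  have hg : ∀ t, HasDerivAt (fun s => inner ℝ (f t₀) (ψ (proj (γ s))))
      (inner ℝ (f t₀) (κ • f t)) t := fun t =>
    (innerSL ℝ (f t₀)).hasFDerivAt.comp_hasDerivAt t (hy t)
  -- Periodicity gives the component of `ψ` in the direction `f t₀` equal values at `0` and `P`, so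
  -- by Rolle its velocity vanishes somewhere; there `f t₁` is orthogonal to `f t₀`.
  obtain ⟨t₁, ht₁, h1⟩ := exists_hasDerivAt_eq_zero hP
    (fun t _ => (hg t).continuousAt.continuousWithinAt)
    (by rw [← hγ.periodic 0, zero_add]) (fun t _ => hg t)
  rw [inner_smul_right] at h1
  have h2 : inner ℝ (f t₀) (f t₁) = 0 := (mul_eq_zero.1 h1).resolve_left hκ0.ne'
  have hC0 : 0 ≤ κ * C * ‖f t₀‖ := (norm_nonneg _).trans (hfle t₀)
  have h3 : ‖f t₁ - f t₀‖ ≤ κ * C * ‖f t₀‖ * ‖t₁ - t₀‖ := by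
    refine (convex_Icc 0 P).norm_image_sub_le_of_norm_hasDerivWithin_le
      (fun t _ => (hfd t).hasDerivWithinAt) (fun t ht => ?_) ht₀ (Ioo_subset_Icc_self ht₁)
    -- Replacing `‖f t‖` by the maximum requires `κC ≥ 0`. The differential inequality at `t₀`
    -- supplies it if the maximum is positive; otherwise `f` vanishes on the whole period.
    rcases (norm_nonneg (f t₀)).eq_or_lt with h0 | h0
    · have h4 : ‖f t‖ = 0 := le_antisymm (by simpa [← h0] using hmax' t ht) (norm_nonneg _)
      have h5 := hfle t
      change _ ≤ _ * ‖f t‖ at h5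
      rw [h4, mul_zero] at h5
      exact h5.trans hC0
    · have hC1 : 0 ≤ κ * C := nonneg_of_mul_nonneg_left hC0 h0
      exact (hfle t).trans (mul_le_mul_of_nonneg_left (hmax' t ht) hC1)
  have h4 : ‖t₁ - t₀‖ ≤ P := by
    rw [Real.norm_eq_abs, abs_le]
    constructor <;> linarith [ht₁.1, ht₁.2, ht₀.1, ht₀.2]
  have h5 : ‖f t₀‖ ^ 2 ≤ κ * C * P * ‖f t₀‖ ^ 2 := by
    have h6 : ‖f t₀‖ ^ 2 = - inner ℝ (f t₀) (f t₁ - f t₀) := by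
      rw [inner_sub_right, h2, real_inner_self_eq_norm_sq]; ring
    have h7 := (abs_le.1 (abs_real_inner_le_norm (f t₀) (f t₁ - f t₀))).1
    have h8 : ‖f t₁ - f t₀‖ ≤ κ * C * ‖f t₀‖ * P :=
      h3.trans (mul_le_mul_of_nonneg_left h4 hC0)
    nlinarith [norm_nonneg (f t₀)]
  have h6 : f t₀ = 0 := by
    by_contra hne
    have : 0 < ‖f t₀‖ ^ 2 := by positivity
    nlinarith
  have h7 : ∀ t, hamField σ H (proj (γ t)) = 0 := fun t => by
    refine hinj (proj (γ t)) ?_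
    rw [map_zero]
    change f t = 0
    obtain ⟨s, hs, hst⟩ := hfper.exists_mem_Ico₀ hP t
    rw [hst]
    have := hmax' s ⟨hs.1, hs.2.le⟩
    rw [h6, norm_zero] at this
    exact norm_le_zero_iff.1 this
  exact ⟨(hamField_eq_zero_iff hV.areaForm).1 (h7 0),
    hV.proj_eq_of_forall_crit hH hpos hγ.curve h7⟩

end Embedded

end IsPrequantizationBundle

end Perturbed

/-! ## The linearized Reeb flow -/

theorem two_le_infty : (2 : WithTop ℕ∞) ≤ ∞ :=
  WithTop.coe_le_coe.2 (le_top : (2 : ℕ∞) ≤ ⊤)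

/-- Equality of mixed partial derivatives. -/
theorem exists_hasDerivAt_mixed {F : Type*} [NormedAddCommGroup F] [NormedSpace ℝ F]
    {Y : ℝ × ℝ → F} {t₀ s₀ : ℝ} (hY : ContDiffAt ℝ 2 Y (t₀, s₀)) {W u : ℝ → F}
    (hW : ∀ᶠ s in 𝓝 s₀, HasDerivAt (fun t => Y (t, s)) (W s) t₀)
    (hu : ∀ᶠ t in 𝓝 t₀, HasDerivAt (fun s => Y (t, s)) (u t) s₀) :
    ∃ w, HasDerivAt W w s₀ ∧ HasDerivAt u w t₀ := by
  have hd : ∀ᶠ q in 𝓝 (t₀, s₀), DifferentiableAt ℝ Y q :=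
    (hY.eventually (by norm_num)).mono fun q hq => hq.differentiableAt (by norm_num)
  have hD : HasFDerivAt (fderiv ℝ Y) (fderiv ℝ (fderiv ℝ Y) (t₀, s₀)) (t₀, s₀) :=
    ((hY.fderiv_right (m := 1) (by norm_num)).differentiableAt (by norm_num)).hasFDerivAt
  have c1 : HasDerivAt (fun s : ℝ => (t₀, s)) ((0 : ℝ), (1 : ℝ)) s₀ :=
    (hasDerivAt_const s₀ t₀).prodMk (hasDerivAt_id s₀)
  have c2 : HasDerivAt (fun t : ℝ => (t, s₀)) ((1 : ℝ), (0 : ℝ)) t₀ :=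
    (hasDerivAt_id t₀).prodMk (hasDerivAt_const t₀ s₀)
  have eW : W =ᶠ[𝓝 s₀] fun s => fderiv ℝ Y (t₀, s) (1, 0) := by
    filter_upwards [hW, c1.continuousAt.eventually hd] with s h1 h2
    have c2' : HasDerivAt (fun t : ℝ => (t, s)) ((1 : ℝ), (0 : ℝ)) t₀ :=
      (hasDerivAt_id t₀).prodMk (hasDerivAt_const t₀ s)
    exact h1.unique (h2.hasFDerivAt.comp_hasDerivAt t₀ c2')
  have eu : u =ᶠ[𝓝 t₀] fun t => fderiv ℝ Y (t, s₀) (0, 1) := by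
    filter_upwards [hu, c2.continuousAt.eventually hd] with t h1 h2
    have c1' : HasDerivAt (fun s : ℝ => (t, s)) ((0 : ℝ), (1 : ℝ)) s₀ :=
      (hasDerivAt_const s₀ t).prodMk (hasDerivAt_id s₀)
    exact h1.unique (h2.hasFDerivAt.comp_hasDerivAt s₀ c1')
  have hsymm : fderiv ℝ (fderiv ℝ Y) (t₀, s₀) (0, 1) (1, 0) =
      fderiv ℝ (fderiv ℝ Y) (t₀, s₀) (1, 0) (0, 1) :=
    (hY.isSymmSndFDerivAt (by simp)).eq _ _
  refine ⟨fderiv ℝ (fderiv ℝ Y) (t₀, s₀) (0, 1) (1, 0), ?_, ?_⟩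
  · have hc : HasDerivAt (fun s => fderiv ℝ Y (t₀, s))
        (fderiv ℝ (fderiv ℝ Y) (t₀, s₀) (0, 1)) s₀ := hD.comp_hasDerivAt s₀ c1
    have h := hc.clm_apply (hasDerivAt_const s₀ ((1 : ℝ), (0 : ℝ)))
    rw [map_zero, add_zero] at h
    exact h.congr_of_eventuallyEq eW
  · have hc : HasDerivAt (fun t => fderiv ℝ Y (t, s₀))
        (fderiv ℝ (fderiv ℝ Y) (t₀, s₀) (1, 0)) t₀ := hD.comp_hasDerivAt t₀ c2
    have h := hc.clm_apply (hasDerivAt_const t₀ ((0 : ℝ), (1 : ℝ)))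
    rw [map_zero, add_zero, ← hsymm] at h
    exact h.congr_of_eventuallyEq eu

section Flow

variable {n : ℕ} {M : Type*} [TopologicalSpace M] [ChartedSpace (EuclideanSpace ℝ (Fin n)) M]

/-- The straight line through the centre of a chart. -/
noncomputable def chartLine (x : M) (v : EuclideanSpace ℝ (Fin n)) (s : ℝ) : M :=
  (extChartAt (𝓡 n) x).symm (extChartAt (𝓡 n) x x + s • v)

theorem chartLine_zero (x : M) (v : EuclideanSpace ℝ (Fin n)) : chartLine x v 0 = x := by
  rw [chartLine, zero_smul, add_zero, extChartAt_to_inv]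

variable {α : M → EuclideanSpace ℝ (Fin n) →L[ℝ] ℝ} {φ : ℝ → M → M}

theorem IsReebFlow.mdifferentiableAt (hφ : IsReebFlow (n := n) α φ) (t : ℝ) (x : M) :
    MDifferentiableAt (𝓡 n) (𝓡 n) (φ t) x :=
  ((hφ.smooth (t, x)).mdifferentiableAt (by norm_num)).comp x
    (mdifferentiableAt_const.prodMk mdifferentiableAt_id)

variable [IsManifold (𝓡 n) ∞ M]

theorem contMDiffAt_chartLine (x : M) (v : EuclideanSpace ℝ (Fin n)) :
    ContMDiffAt 𝓘(ℝ, ℝ) (𝓡 n) ∞ (chartLine x v) 0 := by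
  have h1 : ContDiff ℝ ∞ fun s : ℝ => extChartAt (𝓡 n) x x + s • v := by fun_prop
  refine ContMDiffAt.comp (0 : ℝ) ?_ h1.contMDiff.contMDiffAt
  refine (contMDiffOn_extChartAt_symm (n := ∞) x).contMDiffAt ?_
  rw [zero_smul, add_zero]
  exact extChartAt_target_mem_nhds_self x

theorem hasVelocityAt_chartLine (x : M) (v : EuclideanSpace ℝ (Fin n)) :
    HasVelocityAt (chartLine x v) v 0 := by
  obtain ⟨w, h⟩ : ∃ w, HasVelocityAt (chartLine x v) w 0 := ⟨_, HasVelocityAt.of_mdifferentiableAt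
    ((contMDiffAt_chartLine x v).mdifferentiableAt (by norm_num))⟩
  have h1 : HasDerivAt (fun s => extChartAt (𝓡 n) x (chartLine x v s)) _ 0 :=
    h.chart (by rw [chartLine_zero]; exact mem_extChartAt_source x)
  have h2 : HasDerivAt (fun s => extChartAt (𝓡 n) x (chartLine x v s)) v 0 := by
    have h3 : HasDerivAt (fun s : ℝ => extChartAt (𝓡 n) x x + s • v) v 0 := by
      simpa using ((hasDerivAt_id (0 : ℝ)).smul_const v).const_add (extChartAt (𝓡 n) x x)
    refine h3.congr_of_eventuallyEq ?_
    have h4 : (extChartAt (𝓡 n) x).target ∈ 𝓝 (extChartAt (𝓡 n) x x + (0 : ℝ) • v) := by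
      rw [zero_smul, add_zero]
      exact extChartAt_target_mem_nhds_self x
    filter_upwards [h3.continuousAt h4] with s hs
    exact (extChartAt (𝓡 n) x).right_inv hs
  have h5 := h1.unique h2
  rw [chartLine_zero, chartD_self] at h5
  rwa [h5] at h

namespace IsReebFlow

theorem contMDiffAt_chartLine (hφ : IsReebFlow (n := n) α φ) (x : M)
    (v : EuclideanSpace ℝ (Fin n)) (t : ℝ) :
    ContMDiffAt 𝓘(ℝ, ℝ × ℝ) (𝓡 n) ∞ (fun q : ℝ × ℝ => φ q.1 (chartLine x v q.2)) (t, 0) := by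
  have h0 : ContMDiffAt 𝓘(ℝ, ℝ × ℝ) 𝓘(ℝ, ℝ) ∞ (fun q : ℝ × ℝ => q.2) (t, 0) :=
    contDiff_snd.contMDiff.contMDiffAt
  have h2 : ContMDiffAt 𝓘(ℝ, ℝ × ℝ) (𝓡 n) ∞ (fun q : ℝ × ℝ => chartLine x v q.2) (t, 0) :=
    ContMDiffAt.comp (g := chartLine x v) (t, (0 : ℝ)) (_root_.contMDiffAt_chartLine x v) h0
  have h1 : ContMDiffAt 𝓘(ℝ, ℝ × ℝ) (𝓘(ℝ, ℝ).prod (𝓡 n)) ∞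
      (fun q : ℝ × ℝ => (q.1, chartLine x v q.2)) (t, 0) :=
    contDiff_fst.contMDiff.contMDiffAt.prodMk h2
  exact (hφ.smooth _).comp (t, (0 : ℝ)) h1

theorem hasVelocityAt_chartLine (hφ : IsReebFlow (n := n) α φ) (x : M)
    (v : EuclideanSpace ℝ (Fin n)) (t : ℝ) :
    HasVelocityAt (fun s => φ t (chartLine x v s)) (manD (n := n) (m := n) (φ t) x v) 0 := by
  have h := (_root_.hasVelocityAt_chartLine x v).manD_comp (hφ.mdifferentiableAt t _)
  rwa [chartLine_zero] at h

/-- The Reeb flow preserves the contact form. -/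
theorem apply_manD (hφ : IsReebFlow (n := n) α φ) (hα : IsSmoothOneForm (n := n) (M := M) α)
    (x : M) (v : EuclideanSpace ℝ (Fin n)) (t : ℝ) :
    α (φ t x) (manD (n := n) (m := n) (φ t) x v) = α x v := by
  have hderiv : ∀ t₀, HasDerivAt (fun t => α (φ t x) (manD (n := n) (m := n) (φ t) x v)) 0 t₀ := by
    intro t₀
    set z := φ t₀ x with hz
    set a := formInChart α z with ha
    set e := extChartAt (𝓡 n) z with he
    set K : ℝ × ℝ → M := fun q => φ q.1 (chartLine x v q.2) with hK
    have hKz : K (t₀, 0) = z := by simp only [hK, chartLine_zero, hz]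
    have hKs := hφ.contMDiffAt_chartLine x v t₀
    have hKc : ContinuousAt K (t₀, 0) := hKs.continuousAt
    have hsrc : ∀ᶠ q in 𝓝 (t₀, (0 : ℝ)), K q ∈ e.source :=
      hKc (by rw [hKz]; exact extChartAt_source_mem_nhds (I := 𝓡 n) z)
    have hY : ContDiffAt ℝ ∞ (fun q => e (K q)) (t₀, 0) := by
      rw [← contMDiffAt_iff_contDiffAt]
      refine ContMDiffAt.comp (t₀, (0 : ℝ)) ?_ hKs
      rw [hKz]
      exact contMDiffAt_extChartAt
    have c1 : ContinuousAt (fun s : ℝ => (t₀, s)) 0 := by fun_prop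
    have c2 : ContinuousAt (fun t : ℝ => (t, (0 : ℝ))) t₀ := by fun_prop
    obtain ⟨R, hR, hRvel⟩ : ∃ R : ℝ → EuclideanSpace ℝ (Fin n),
        (∀ s, α (K (t₀, s)) (R s) = 1 ∧ ∀ ξ, extD α (K (t₀, s)) (R s) ξ = 0) ∧
        ∀ s, HasVelocityAt (fun t => K (t, s)) (R s) t₀ := by
      choose R hR hRvel using fun s => hφ.curve (chartLine x v s) t₀
      exact ⟨R, hR, hRvel⟩
    have hW : ∀ᶠ s in 𝓝 (0 : ℝ), HasDerivAt (fun t => e (K (t, s)))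
        (chartD z (K (t₀, s)) (R s)) t₀ := by
      filter_upwards [c1.eventually hsrc] with s hs
      exact HasVelocityAt.chart (hRvel s) hs
    have hu : ∀ᶠ t in 𝓝 t₀, HasDerivAt (fun s => e (K (t, s)))
        (chartD z (φ t x) (manD (n := n) (m := n) (φ t) x v)) 0 := by
      filter_upwards [c2.eventually hsrc] with t ht
      have h := HasVelocityAt.chart (hφ.hasVelocityAt_chartLine x v t) ht
      simpa only [chartLine_zero] using h
    obtain ⟨w, hw1, hw2⟩ := exists_hasDerivAt_mixed (hY.of_le two_le_infty) hW hu
    have happ : ∀ y ∈ e.source, ∀ ξ : EuclideanSpace ℝ (Fin n), a (e y) (chartD z y ξ) = α y ξ := by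
      intro y hy ξ
      rw [ha, formInChart_apply, chartSymmD_chartD hy, e.left_inv hy]
    have hW0 : chartD z (K (t₀, 0)) (R 0) = R 0 := by rw [hKz]; exact chartD_self z _
    have hu0 : chartD z (φ t₀ x) (manD (n := n) (m := n) (φ t₀) x v)
      = manD (n := n) (m := n) (φ t₀) x v := chartD_self z _
    have had : HasFDerivAt a (fderiv ℝ a (e z)) (e z) :=
      (((hα z).contDiffAt (extChartAt_target_mem_nhds_self z)).differentiableAt
        (by norm_num)).hasFDerivAt
    have hYt := hW.self_of_nhds
    have hYs := hu.self_of_nhds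
    rw [hW0] at hYt
    rw [hu0] at hYs
    have had1 : HasFDerivAt a (fderiv ℝ a (e z)) (e (K (t₀, 0))) := by rw [hKz]; exact had
    have b1 : HasDerivAt (fun s => a (e (K (t₀, s))))
        (fderiv ℝ a (e z) (manD (n := n) (m := n) (φ t₀) x v)) 0 :=
      HasFDerivAt.comp_hasDerivAt (f := fun s => e (K (t₀, s))) (0 : ℝ) had1 hYs
    have b2 : HasDerivAt (fun t => a (e (K (t, 0)))) (fderiv ℝ a (e z) (R 0)) t₀ :=
      HasFDerivAt.comp_hasDerivAt (f := fun t => e (K (t, 0))) t₀ had1 hYt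
    have d1 := b1.clm_apply hw1
    have d2 := b2.clm_apply hw2
    have e1 : (fun _ : ℝ => (1 : ℝ)) =ᶠ[𝓝 0]
        fun s => a (e (K (t₀, s))) (chartD z (K (t₀, s)) (R s)) := by
      filter_upwards [c1.eventually hsrc] with s hs
      rw [happ _ hs]
      exact (hR s).1.symm
    have e2 : (fun t => α (φ t x) (manD (n := n) (m := n) (φ t) x v)) =ᶠ[𝓝 t₀]
        fun t => a (e (K (t, 0)))
          (chartD z (φ t x) (manD (n := n) (m := n) (φ t) x v)) := by
      filter_upwards [c2.eventually hsrc] with t ht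
      have h1 : K (t, 0) = φ t x := by simp only [hK, chartLine_zero]
      rw [h1] at ht
      rw [h1, happ _ ht]
    -- Let `Y(t, s)` be the coordinates of the flow applied to a line. Then `∂_t(a(Y) ∂_s Y) -
    -- ∂_s(a(Y) ∂_t Y)` equals `dα(∂_t Y, ∂_s Y)`, the mixed derivatives cancelling. It vanishes
    -- because `∂_t Y` is the Reeb vector, and `a(Y) ∂_t Y = 1` removes the second term.
    have d3 := (d1.congr_of_eventuallyEq e1).unique (hasDerivAt_const (0 : ℝ) (1 : ℝ))
    have d4 := d2.congr_of_eventuallyEq e2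
    refine d4.congr_deriv ?_
    have hreeb : extD α z (R 0) (manD (n := n) (m := n) (φ t₀) x v) = 0 := by
      have h1 := (hR 0).2
      rw [hKz] at h1
      exact h1 _
    rw [extD_eq] at hreeb
    change fderiv ℝ a (e z) (R 0) _ - fderiv ℝ a (e z) _ (R 0) = 0 at hreeb
    rw [hW0] at d3
    rw [hu0]
    linarith
  have h := is_const_of_deriv_eq_zero (fun s => (hderiv s).differentiableAt)
    (fun s => (hderiv s).deriv) t 0
  rw [h]
  have h0 : φ 0 = id := funext hφ.zero
  rw [h0]
  exact congrArg (α x) (DFunLike.congr_fun (mfderiv_id (I := 𝓡 n)) v)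

end IsReebFlow

end Flow

/-! ## Linear algebra at a critical point -/

section Hessian

variable {B : Type*} [TopologicalSpace B] [ChartedSpace (EuclideanSpace ℝ (Fin 2)) B]
  {σ : B → EuclideanSpace ℝ (Fin 2) →L[ℝ] EuclideanSpace ℝ (Fin 2) →L[ℝ] ℝ} {H : B → ℝ}

theorem hessianAt_symm {n : ℕ} {M : Type*} [TopologicalSpace M]
    [ChartedSpace (EuclideanSpace ℝ (Fin n)) M] [IsManifold (𝓡 n) ∞ M] {H : M → ℝ}
    (hH : ContMDiff (𝓡 n) 𝓘(ℝ, ℝ) ∞ H) (p : M) (v w : EuclideanSpace ℝ (Fin n)) :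
    hessianAt (n := n) H p v w = hessianAt (n := n) H p w v :=
  ((((contDiffOn_comp_chart_symm hH p).contDiffAt (extChartAt_target_mem_nhds_self p)).of_le
    two_le_infty).isSymmSndFDerivAt (by simp)).eq v w

/-- Linear combinations of two vectors. -/
noncomputable def frameVec (E : Fin 2 → EuclideanSpace ℝ (Fin 2)) (x : Fin 2 → ℝ) :
    EuclideanSpace ℝ (Fin 2) := x 0 • E 0 + x 1 • E 1

theorem area_swap (hσ : IsAreaForm (B := B) σ) (p : B) (v w : EuclideanSpace ℝ (Fin 2)) :
    σ p v w = - σ p w v := by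
  rw [alternating_apply (area_self hσ p), alternating_apply (area_self hσ p) w]
  ring

theorem eq_frameVec (hσ : IsAreaForm (B := B) σ) {p : B} {E : Fin 2 → EuclideanSpace ℝ (Fin 2)}
    (hE : σ p (E 0) (E 1) = 1) (u : EuclideanSpace ℝ (Fin 2)) :
    u = frameVec E ![σ p u (E 1), σ p (E 0) u] := by
  have h := alternating_apply (area_self hσ p)
  rw [h] at hE
  ext i
  simp only [frameVec, Matrix.cons_val_zero, Matrix.cons_val_one, PiLp.add_apply,
    PiLp.smul_apply, smul_eq_mul]
  rw [h u, h (E 0) u]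
  fin_cases i
  · simp only [Fin.zero_eta]
    linear_combination (-(u 0)) * hE
  · simp only [Fin.mk_one]
    linear_combination (-(u 1)) * hE

theorem area_frameVec (hσ : IsAreaForm (B := B) σ) {p : B} {E : Fin 2 → EuclideanSpace ℝ (Fin 2)}
    (hE : σ p (E 0) (E 1) = 1) (x : Fin 2 → ℝ) :
    σ p (frameVec E x) (E 1) = x 0 ∧ σ p (E 0) (frameVec E x) = x 1 := by
  simp [frameVec, hE, area_self hσ p]

theorem frameVec_injective (hσ : IsAreaForm (B := B) σ) {p : B}
    {E : Fin 2 → EuclideanSpace ℝ (Fin 2)} (hE : σ p (E 0) (E 1) = 1) :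
    Function.Injective (frameVec E) := fun x y h => by
  have h1 := area_frameVec hσ hE x
  have h2 := area_frameVec hσ hE y
  rw [h] at h1
  ext i
  fin_cases i
  · exact h1.1.symm.trans h2.1
  · exact h1.2.symm.trans h2.2

/-- The matrix of `κ` times the linearized Hamiltonian vector field in a unimodular basis. -/
noncomputable def hamMatrix (H : B → ℝ) (p : B) (E : Fin 2 → EuclideanSpace ℝ (Fin 2)) (κ : ℝ) :
    Matrix (Fin 2) (Fin 2) ℝ :=
  !![κ * hessianAt (n := 2) H p (E 0) (E 1), κ * hessianAt (n := 2) H p (E 1) (E 1);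
    -(κ * hessianAt (n := 2) H p (E 0) (E 0)), -(κ * hessianAt (n := 2) H p (E 0) (E 1))]

theorem trace_hamMatrix (p : B) (E : Fin 2 → EuclideanSpace ℝ (Fin 2)) (κ : ℝ) :
    (hamMatrix H p E κ).trace = 0 := by
  simp [hamMatrix, Matrix.trace_fin_two]

variable [IsManifold (𝓡 2) ∞ B]

theorem hamLin_frameVec (hσ : IsAreaForm (B := B) σ) (hH : ContMDiff (𝓡 2) 𝓘(ℝ, ℝ) ∞ H) {p : B}
    (hp : IsCritPoint (n := 2) H p) {E : Fin 2 → EuclideanSpace ℝ (Fin 2)}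
    (hE : σ p (E 0) (E 1) = 1) (κ : ℝ) (x : Fin 2 → ℝ) :
    κ • hamLin σ H p (frameVec E x) = frameVec E ((hamMatrix H p E κ).mulVec x) := by
  rw [eq_frameVec hσ hE (κ • hamLin σ H p (frameVec E x))]
  congr 1
  have hs := hessianAt_symm hH p (E 1) (E 0)
  ext i
  fin_cases i
  · simp [area_hamLin hσ hH hp, frameVec, hamMatrix, Matrix.mulVec, dotProduct, Fin.sum_univ_two]
    ring
  · simp [area_swap hσ p (E 0), area_hamLin hσ hH hp, frameVec, hamMatrix, Matrix.mulVec,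
      dotProduct, Fin.sum_univ_two, hs]
    ring

theorem omegaForm_hamMatrix (hH : ContMDiff (𝓡 2) 𝓘(ℝ, ℝ) ∞ H) (p : B)
    (E : Fin 2 → EuclideanSpace ℝ (Fin 2)) (κ : ℝ) (x : Fin 2 → ℝ) :
    κ * hessianQuadraticForm (n := 2) H p (frameVec E x) = - omegaForm (hamMatrix H p E κ) x := by
  have hs := hessianAt_symm hH p (E 1) (E 0)
  change κ * hessianAt (n := 2) H p (frameVec E x) (frameVec E x) = _
  rw [omegaForm_apply]
  simp only [frameVec, map_add, map_smul, add_apply, smul_apply, smul_eq_mul, hs, hamMatrix,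
    Matrix.of_apply, Matrix.cons_val]
  ring

/-- A kernel vector of the linearized Hamiltonian field lies in the radical of the Hessian, by
`area_hamLin`. -/
theorem det_hamMatrix_ne_zero (hσ : IsAreaForm (B := B) σ) (hH : IsMorse (n := 2) H) {p : B}
    (hp : IsCritPoint (n := 2) H p) {E : Fin 2 → EuclideanSpace ℝ (Fin 2)}
    (hE : σ p (E 0) (E 1) = 1) {κ : ℝ} (hκ : κ ≠ 0) : (hamMatrix H p E κ).det ≠ 0 := by
  intro h0
  obtain ⟨x, hx, hAx⟩ := Matrix.exists_mulVec_eq_zero_iff.2 h0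
  have h1 := hamLin_frameVec hσ hH.smooth hp hE κ x
  rw [hAx] at h1
  have hz : frameVec E 0 = 0 := by simp [frameVec]
  rw [hz] at h1
  have h2 : hamLin σ H p (frameVec E x) = 0 := (smul_eq_zero.1 h1).resolve_left hκ
  have h3 := hH.nondegenerate p hp (frameVec E x) fun w => by
    rw [← area_hamLin hσ hH.smooth hp, h2, map_zero, zero_apply]
  exact hx (frameVec_injective hσ hE (h3.trans hz.symm))

/-- The Morse index in terms of the linearized Hamiltonian vector field. -/
theorem morseIndex_eq (hσ : IsAreaForm (B := B) σ) (hH : IsMorse (n := 2) H) {p : B}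
    (hp : IsCritPoint (n := 2) H p) {E : Fin 2 → EuclideanSpace ℝ (Fin 2)}
    (hE : σ p (E 0) (E 1) = 1) {κ : ℝ} (hκ : 0 < κ) :
    (morseIndex (n := 2) H p : ℤ) = 1 + if 0 < (hamMatrix H p E κ).det then
      (SignType.sign ((hamMatrix H p E κ) 1 0) : ℤ) else 0 := by
  have hdet := det_hamMatrix_ne_zero hσ hH hp hE hκ.ne'
  have htr := trace_hamMatrix (H := H) p E κ
  -- The form `ω₀(x, A x)` is `-κ` times the Hessian: `det A > 0` means a definite Hessian, and `A 1
  -- 0 = -κ Hess(E₀, E₀)` is negative at minima and positive at maxima, while `det A < 0` is a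
  -- saddle.
  have hQ := omegaForm_hamMatrix hH.smooth p E κ
  set A := hamMatrix H p E κ
  have hsurj : ∀ u, ∃ x, frameVec E x = u := fun u => ⟨_, (eq_frameVec hσ hE u).symm⟩
  have hne : ∀ {x}, frameVec E x ≠ 0 → x ≠ 0 := fun {x} hx h => hx (by simp [frameVec, h])
  unfold morseIndex
  by_cases hD : 0 < A.det
  · rw [if_pos hD]
    have hdef := fun {x} (hx : x ≠ 0) => omegaForm_definite htr hD hx
    have h10 : A 1 0 ≠ 0 := fun h => by
      have := hdef (x := ![1, 0]) (by simp)
      rw [h, zero_mul] at this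
      exact lt_irrefl _ this
    rcases lt_or_gt_of_ne h10 with h | h
    · have : sigNeg (hessianQuadraticForm (n := 2) H p) = 0 := by
        refine sigNeg_eq_zero_of_nonneg fun u => ?_
        obtain ⟨x, rfl⟩ := hsurj u
        rcases eq_or_ne (frameVec E x) 0 with hx | hx
        · rw [hx, map_zero]
        · have h1 := neg_of_mul_pos_right (hdef (hne hx)) h.le
          have h2 := hQ x
          exact (pos_of_mul_pos_right (by linarith) hκ.le).le
      rw [this, sign_neg h]
      rfl
    · have : sigNeg (hessianQuadraticForm (n := 2) H p) = 2 := by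
        rw [sigNeg_eq_finrank_of_negDef, finrank_euclideanSpace_fin]
        intro u hu
        obtain ⟨x, rfl⟩ := hsurj u
        have h1 := pos_of_mul_pos_right (hdef (hne hu)) h.le
        have h2 := hQ x
        exact neg_of_mul_neg_right (by linarith) hκ.le
      rw [this, sign_pos h]
      rfl
  · rw [if_neg hD]
    obtain ⟨⟨x, hx⟩, y, hy⟩ := omegaForm_indefinite htr (lt_of_le_of_ne (not_lt.1 hD) hdet)
    have h1 := hQ x
    have h2 := hQ y
    have := (sig_eq_one_of_indefinite finrank_euclideanSpace_fin
      (pos_of_mul_pos_right (by linarith) hκ.le) (neg_of_mul_neg_right (by linarith) hκ.le)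
      (Q := hessianQuadraticForm (n := 2) H p) (v := frameVec E y) (w := frameVec E x)).2
    rw [this]; rfl

end Hessian

section Hessian

variable {B : Type*} [TopologicalSpace B] [ChartedSpace (EuclideanSpace ℝ (Fin 2)) B]
  [IsManifold (𝓡 2) ∞ B]
  {σ : B → EuclideanSpace ℝ (Fin 2) →L[ℝ] EuclideanSpace ℝ (Fin 2) →L[ℝ] ℝ} {H : B → ℝ}

/-- A uniform bound on the rotation speed at critical points. -/
theorem sqrt_det_hamMatrix_le {F : Type*} [NormedAddCommGroup F] [NormedSpace ℝ F] {ψ : B → F}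
    {C : ℝ} (hσ : IsAreaForm (B := B) σ) (hH : ContMDiff (𝓡 2) 𝓘(ℝ, ℝ) ∞ H)
    (hψ : ContMDiff (𝓡 2) 𝓘(ℝ, F) ∞ ψ) (hinj : ∀ x, Function.Injective (vecD (n := 2) ψ x))
    (hC0 : 0 ≤ C) (hC : ∀ (x : B) (v : EuclideanSpace ℝ (Fin 2)),
      ‖vecD (hamDeriv σ H ψ) x v‖ ≤ C * ‖vecD ψ x v‖) {p : B}
    (hp : IsCritPoint (n := 2) H p) {E : Fin 2 → EuclideanSpace ℝ (Fin 2)}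
    (hE : σ p (E 0) (E 1) = 1) {κ : ℝ} (hκ : 0 ≤ κ) : √|(hamMatrix H p E κ).det| ≤ κ * C := by
  set A := hamMatrix H p E κ with hA
  have hstep : ∀ w, ‖vecD ψ p (κ • hamLin σ H p w)‖ ≤ κ * C * ‖vecD ψ p w‖ := fun w => by
    rw [map_smul, ← vecD_hamLin hσ hH hψ hp, norm_smul, Real.norm_eq_abs, abs_of_nonneg hκ,
      mul_assoc]
    exact mul_le_mul_of_nonneg_left (hC p w) hκ
  set u := frameVec E ![1, 0] with hu
  -- Because `A² = -det A`, applying the one-step bound twice to any nonzero vector yields `|det A|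
  -- ≤ (κC)²`.
  have hsq : κ • hamLin σ H p (κ • hamLin σ H p u) = (-A.det) • u := by
    rw [hu, hamLin_frameVec hσ hH hp hE, hamLin_frameVec hσ hH hp hE, Matrix.mulVec_mulVec,
      sq_of_trace_eq_zero (trace_hamMatrix p E κ), Matrix.smul_mulVec, Matrix.one_mulVec]
    simp [frameVec, hA]
  have hu0 : u ≠ 0 := fun h => by
    have h1 := (area_frameVec hσ hE ![1, 0]).1
    rw [← hu, h] at h1
    simp at h1
  have hju : 0 < ‖vecD ψ p u‖ := norm_pos_iff.2 fun h => hu0 (hinj p (by rw [h, map_zero]))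
  have h1 := (hstep (κ • hamLin σ H p u)).trans
    (mul_le_mul_of_nonneg_left (hstep u) (by positivity))
  rw [hsq, map_smul, norm_smul, Real.norm_eq_abs, abs_neg, ← mul_assoc] at h1
  refine Real.sqrt_le_iff.2 ⟨by positivity, ?_⟩
  rw [sq]
  exact le_of_mul_le_mul_right h1 hju

/-- Solutions of the linearized Hamiltonian system. -/
theorem eq_frameVec_of_hasDerivAt (hσ : IsAreaForm (B := B) σ) (hH : ContMDiff (𝓡 2) 𝓘(ℝ, ℝ) ∞ H)
    {p : B} (hp : IsCritPoint (n := 2) H p) {E : Fin 2 → EuclideanSpace ℝ (Fin 2)}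
    (hE : σ p (E 0) (E 1) = 1) {κ : ℝ} {Φ : ℝ → Matrix (Fin 2) (Fin 2) ℝ}
    (hΦ : IsOneParam (hamMatrix H p E κ) Φ)
    (hcomm : ∀ t, Φ t * hamMatrix H p E κ = hamMatrix H p E κ * Φ t)
    {u : ℝ → EuclideanSpace ℝ (Fin 2)} (hu : ∀ t, HasDerivAt u (κ • hamLin σ H p (u t)) t)
    {x : Fin 2 → ℝ} (h0 : u 0 = frameVec E x) (t : ℝ) : u t = frameVec E ((Φ t).mulVec x) := by
  have hw : ∀ t, HasDerivAt (fun t => frameVec E ((Φ t).mulVec x))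
      (κ • hamLin σ H p (frameVec E ((Φ t).mulVec x))) t := fun t => by
    rw [hamLin_frameVec hσ hH hp hE, Matrix.mulVec_mulVec, ← hcomm]
    have hi : ∀ i, HasDerivAt (fun t => (Φ t).mulVec x i)
        ((Φ t * hamMatrix H p E κ).mulVec x i) t := fun i => by
      simp only [Matrix.mulVec, dotProduct, Fin.sum_univ_two]
      exact ((hΦ.hasDerivAt t i 0).mul_const _).add ((hΦ.hasDerivAt t i 1).mul_const _)
    exact ((hi 0).smul_const (E 0)).add ((hi 1).smul_const (E 1))
  have h := eq_zero_of_norm_deriv_le (f := fun t => u t - frameVec E ((Φ t).mulVec x))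
    (K := ‖κ • hamLin σ H p‖) (fun t => (hu t).sub (hw t))
    (by rw [h0, hΦ.zero, Matrix.one_mulVec, sub_self]) (fun t => by
      rw [← smul_sub, ← map_sub]
      exact (κ • hamLin σ H p).le_opNorm _) t
  exact sub_eq_zero.1 h

end Hessian

/-! ### The linearized Reeb flow projected to the surface -/

section LinearizedFlow

variable {B V : Type*} [TopologicalSpace B] [ChartedSpace (EuclideanSpace ℝ (Fin 2)) B]
  [TopologicalSpace V] [ChartedSpace (EuclideanSpace ℝ (Fin 3)) V] [MulAction Circle V]
  {σ : B → EuclideanSpace ℝ (Fin 2) →L[ℝ] EuclideanSpace ℝ (Fin 2) →L[ℝ] ℝ}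
  {proj : V → B} {lam : V → EuclideanSpace ℝ (Fin 3) →L[ℝ] ℝ} {H : B → ℝ} {ε : ℝ}
  [IsManifold (𝓡 3) ∞ V] [IsManifold (𝓡 2) ∞ B]

namespace IsPrequantizationBundle

/-- The projection of the linearized Reeb flow over a critical point. -/
theorem hasDerivAt_projD_flow (hV : IsPrequantizationBundle σ proj lam)
    (hH : ContMDiff (𝓡 2) 𝓘(ℝ, ℝ) ∞ H) (hpos : ∀ b, 0 < 1 + ε * H b) {φ : ℝ → V → V}
    (hφ : IsReebFlow (n := 3) (pertForm proj H lam ε) φ) {N : ℕ}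
    {ψ : B → EuclideanSpace ℝ (Fin N)}
    (hψ : ContMDiff (𝓡 2) 𝓘(ℝ, EuclideanSpace ℝ (Fin N)) ∞ ψ)
    (hinj : ∀ x, Function.Injective (vecD (n := 2) ψ x)) {x : V} {p : B}
    (hp : IsCritPoint (n := 2) H p) (hx : ∀ t, proj (φ t x) = p)
    (v : EuclideanSpace ℝ (Fin 3)) (t₀ : ℝ) :
    HasDerivAt (fun t => projD proj (φ t x) (manD (n := 3) (m := 3) (φ t) x v))
      ((ε / (1 + ε * H p) ^ 2) •
        hamLin σ H p (projD proj (φ t₀ x) (manD (n := 3) (m := 3) (φ t₀) x v))) t₀ := by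
  set u : ℝ → EuclideanSpace ℝ (Fin 2) :=
    fun t => projD proj (φ t x) (manD (n := 3) (m := 3) (φ t) x v) with hu
  set K : ℝ × ℝ → V := fun q => φ q.1 (chartLine x v q.2) with hK
  have hKs := hφ.contMDiffAt_chartLine x v t₀
  have hK0 : ∀ t, proj (K (t, 0)) = p := fun t => by simp only [hK, chartLine_zero, hx]
  have hY : ContDiffAt ℝ ∞ (fun q => ψ (proj (K q))) (t₀, 0) := by
    rw [← contMDiffAt_iff_contDiffAt]
    exact (hψ.comp hV.smooth_proj).contMDiffAt.comp (t₀, (0 : ℝ)) hKs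
  have hvel : ∀ t, HasVelocityAt (n := 2) (fun s => proj (K (t, s))) (u t) 0 := fun t => by
    have h := (hφ.hasVelocityAt_chartLine x v t).manD_comp (hV.mdifferentiableAt_proj _)
    simpa only [chartLine_zero] using h
  have hcomp : ∀ {F : Type} [NormedAddCommGroup F] [NormedSpace ℝ F] {g : B → F},
      ContMDiff (𝓡 2) 𝓘(ℝ, F) ∞ g → ∀ t,
      HasDerivAt (fun s => g (proj (K (t, s)))) (vecD g p (u t)) 0 := by
    intro F _ _ g hg t
    have h := (hvel t).vecD_comp ((hg _).mdifferentiableAt (by norm_num))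
    rwa [hK0] at h
  set k : ℝ → ℝ := fun s => ε / (1 + ε * H (proj (K (t₀, s)))) ^ 2 with hk
  have hW : ∀ s, HasDerivAt (fun t => ψ (proj (K (t, s))))
      (k s • hamDeriv σ H ψ (proj (K (t₀, s)))) t₀ := fun s => by
    have h := hV.hasDerivAt_comp_proj hH hpos (hφ.curve (chartLine x v s)) hψ t₀
    have h1 := hV.ham_proj_eq hH hpos (hφ.curve (chartLine x v s)) t₀
    rwa [← h1] at h
  -- Interchanging derivatives turns the time derivative of the linearized flow into the
  -- `s`-derivative of the velocity `k(s) dψ(X)`. At `s = 0` the field vanishes, so the variation of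
  -- the speed factor `k` contributes nothing and only the linearization of `X` remains.
  obtain ⟨w, hw1, hw2⟩ := exists_hasDerivAt_mixed (hY.of_le two_le_infty)
    (Filter.Eventually.of_forall hW) (Filter.Eventually.of_forall fun t => hcomp hψ t)
  have hkd : DifferentiableAt ℝ k 0 := by
    have h1 := (hcomp hH t₀).differentiableAt
    refine (differentiableAt_const ε).div (((h1.const_mul ε).const_add 1).pow 2) ?_
    exact pow_ne_zero 2 (hpos _).ne'
  have hw3 := hkd.hasDerivAt.smul (hcomp (contMDiff_hamDeriv hV.areaForm hH hψ) t₀)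
  have hz : hamDeriv σ H ψ (proj (K (t₀, 0))) = 0 := by
    rw [hK0, hamDeriv, (hamField_eq_zero_iff hV.areaForm).2 hp, map_zero]
  have hk0 : k 0 = ε / (1 + ε * H p) ^ 2 := by simp only [hk, hK0]
  rw [hz, smul_zero, add_zero, hk0, vecD_hamLin hV.areaForm hH hψ hp] at hw3
  rw [hw1.unique hw3, ← map_smul] at hw2
  -- The base point is fixed at `p`, so one left inverse of `dψ` at `p` carries the equation back to
  -- the tangent plane for all times.
  obtain ⟨L, hL⟩ := (vecD ψ p).toLinearMap.exists_leftInverse_of_injective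
    (LinearMap.ker_eq_bot.2 (hinj p))
  have hL' : ∀ y, L.toContinuousLinearMap (vecD ψ p y) = y := fun y => LinearMap.congr_fun hL y
  have h := L.toContinuousLinearMap.hasFDerivAt.comp_hasDerivAt t₀ hw2
  simpa only [Function.comp_def, hL'] using h

end IsPrequantizationBundle

end LinearizedFlow

/-! ## Frames over the fibres -/

theorem IsSpPath.comp_div {T c : ℝ} {Ψ : ℝ → Matrix (Fin 2) (Fin 2) ℝ} (h : IsSpPath T Ψ)
    (hc : 0 < c) : IsSpPath (T * c) fun t => Ψ (t / c) := by
  have hm : MapsTo (fun t => t / c) (Icc 0 (T * c)) (Icc 0 T) := fun t ht =>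
    ⟨div_nonneg ht.1 hc.le, (div_le_iff₀ hc).2 ht.2⟩
  exact ⟨mul_pos h.pos hc, h.continuousOn.comp (by fun_prop) hm, fun t ht => h.det _ (hm ht),
    by simpa using h.zero⟩

theorem IsAngleLift.comp_div {T c : ℝ} {Ψ : ℝ → Matrix (Fin 2) (Fin 2) ℝ} {θ : ℝ → ℝ}
    (h : IsAngleLift T Ψ θ) (hc : 0 < c) :
    IsAngleLift (T * c) (fun t => Ψ (t / c)) fun t => θ (t / c) := by
  have hm : MapsTo (fun t => t / c) (Icc 0 (T * c)) (Icc 0 T) := fun t ht =>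
    ⟨div_nonneg ht.1 hc.le, (div_le_iff₀ hc).2 ht.2⟩
  exact ⟨h.continuousOn.comp (by fun_prop) hm, by simpa using h.zero,
    fun t ht => h.isAngle _ (hm ht)⟩

section TransitionMatrix

variable {B : Type*} [TopologicalSpace B] [ChartedSpace (EuclideanSpace ℝ (Fin 2)) B]
  {σ : B → EuclideanSpace ℝ (Fin 2) →L[ℝ] EuclideanSpace ℝ (Fin 2) →L[ℝ] ℝ} {p : B}
  {D E : Fin 2 → EuclideanSpace ℝ (Fin 2)}

/-- The matrix expressing the basis `D` in the unimodular basis `E`. -/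
noncomputable def transMatrix (τ : EuclideanSpace ℝ (Fin 2) →L[ℝ] EuclideanSpace ℝ (Fin 2) →L[ℝ] ℝ)
    (D E : Fin 2 → EuclideanSpace ℝ (Fin 2)) : Matrix (Fin 2) (Fin 2) ℝ :=
  Matrix.of ![fun j => τ (D j) (E 1), fun j => τ (E 0) (D j)]

theorem frameVec_transMatrix (hσ : IsAreaForm (B := B) σ) (hE : σ p (E 0) (E 1) = 1)
    (x : Fin 2 → ℝ) : frameVec E ((transMatrix (σ p) D E).mulVec x) = frameVec D x := by
  rw [eq_frameVec hσ hE (frameVec D x)]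
  congr 1
  ext i
  fin_cases i <;>
  · simp [transMatrix, frameVec, Matrix.mulVec, dotProduct, Fin.sum_univ_two]
    ring

theorem eq_sum_transMatrix (hσ : IsAreaForm (B := B) σ) (hE : σ p (E 0) (E 1) = 1) (j : Fin 2) :
    D j = transMatrix (σ p) D E 0 j • E 0 + transMatrix (σ p) D E 1 j • E 1 := by
  conv_lhs => rw [eq_frameVec hσ hE (D j)]
  rfl

theorem transMatrix_self (hσ : IsAreaForm (B := B) σ) (hE : σ p (E 0) (E 1) = 1) :
    transMatrix (σ p) E E = 1 := by
  ext i j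
  fin_cases i <;> fin_cases j <;> simp [transMatrix, hE, area_self hσ p]

theorem det_transMatrix (hσ : IsAreaForm (B := B) σ) (hD : σ p (D 0) (D 1) = 1)
    (hE : σ p (E 0) (E 1) = 1) : (transMatrix (σ p) D E).det = 1 := by
  have h := hD
  rw [eq_sum_transMatrix (D := D) hσ hE 0, eq_sum_transMatrix (D := D) hσ hE 1] at h
  simp only [map_add, add_apply, map_smul, smul_apply, smul_eq_mul, area_self hσ p, hE,
    area_swap hσ p (E 1) (E 0)] at h
  rw [Matrix.det_fin_two]
  linarith

theorem frameVec_single (E : Fin 2 → EuclideanSpace ℝ (Fin 2)) (j : Fin 2) :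
    frameVec E (Pi.single j 1) = E j := by
  fin_cases j <;> simp [frameVec]

theorem frameVec_mulVec_single (E : Fin 2 → EuclideanSpace ℝ (Fin 2))
    (M : Matrix (Fin 2) (Fin 2) ℝ) (j : Fin 2) :
    frameVec E (M.mulVec (Pi.single j 1)) = M 0 j • E 0 + M 1 j • E 1 := by
  simp [frameVec]

end TransitionMatrix

section Frames

variable {B V : Type*} [TopologicalSpace B] [ChartedSpace (EuclideanSpace ℝ (Fin 2)) B]
  [TopologicalSpace V] [ChartedSpace (EuclideanSpace ℝ (Fin 3)) V] [MulAction Circle V]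
  {σ : B → EuclideanSpace ℝ (Fin 2) →L[ℝ] EuclideanSpace ℝ (Fin 2) →L[ℝ] ℝ}
  {proj : V → B} {lam : V → EuclideanSpace ℝ (Fin 3) →L[ℝ] ℝ} {H : B → ℝ} {ε : ℝ}
  [IsManifold (𝓡 3) ∞ V]

/-- Multiples of continuous vector fields. -/
theorem continuousOn_smul_section {n : ℕ} {M : Type*} [TopologicalSpace M]
    [ChartedSpace (EuclideanSpace ℝ (Fin n)) M] [IsManifold (𝓡 n) ∞ M] {S : Set M} {f : M → ℝ}
    {e : (x : M) → TangentSpace (𝓡 n) x} (hf : ContinuousOn f S)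
    (he : ContinuousOn (fun x => (⟨x, e x⟩ : TangentBundle (𝓡 n) M)) S) :
    ContinuousOn (fun x => (⟨x, f x • e x⟩ : TangentBundle (𝓡 n) M)) S := by
  have := isManifold_one n M
  have h1 : ContMDiffOn (𝓡 n) 𝓘(ℝ, ℝ) 0 f S := contMDiffOn_zero_iff.2 hf
  have h2 : ContMDiffOn (𝓡 n) ((𝓡 n).prod 𝓘(ℝ, EuclideanSpace ℝ (Fin n))) 0
      (fun x => (⟨x, e x⟩ : TangentBundle (𝓡 n) M)) S := contMDiffOn_zero_iff.2 he
  exact contMDiffOn_zero_iff.1 (ContMDiffOn.smul_section h1 h2)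

namespace IsPrequantizationBundle

/-- The projected curve stays at the single point `p`, so continuity in the tangent bundle of the
surface is continuity in one fixed tangent plane. -/
theorem continuous_projD_frame [IsManifold (𝓡 2) ∞ B]
    (hV : IsPrequantizationBundle σ proj lam)
    {e : V → EuclideanSpace ℝ (Fin 3)} {S : Set V} {p : B}
    (he : ContinuousOn (fun x => (⟨x, e x⟩ : TangentBundle (𝓡 3) V)) S) {γ : ℝ → V}
    (hγ : Continuous γ) (hS : ∀ t, γ t ∈ S) (hp : ∀ t, proj (γ t) = p) :
    Continuous fun t => projD proj (γ t) (e (γ t)) := by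
  have := isManifold_one 3 V
  have := isManifold_one 2 B
  have h1 : Continuous fun t => (⟨γ t, e (γ t)⟩ : TangentBundle (𝓡 3) V) :=
    he.comp_continuous hγ hS
  have h2 := (hV.smooth_proj.continuous_tangentMap (by norm_num)).comp h1
  have h3 : (tangentMap (𝓡 3) (𝓡 2) proj ∘ fun t => (⟨γ t, e (γ t)⟩ : TangentBundle (𝓡 3) V)) =
      fun t => (⟨p, projD proj (γ t) (e (γ t))⟩ : TangentBundle (𝓡 2) B) := by
    funext t
    exact congrArg (fun b => (⟨b, projD proj (γ t) (e (γ t))⟩ : TangentBundle (𝓡 2) B)) (hp t)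
  rw [h3] at h2
  exact (FiberBundle.totalSpaceMk_isInducing (EuclideanSpace ℝ (Fin 2))
    (TangentSpace (𝓡 2) : B → Type _) p).continuous_iff.2 h2

variable {e : Fin 2 → V → EuclideanSpace ℝ (Fin 3)} {p : B}

theorem area_projD_frame (hV : IsPrequantizationBundle σ proj lam)
    (he : IsSymplecticFrame (V := V) lam (proj ⁻¹' {p}) e) {x : V} (hx : proj x = p) :
    σ p (projD proj x (e 0 x)) (projD proj x (e 1 x)) = 1 := by
  have h : extD lam x (e 0 x) (e 1 x) = 1 := he.area x hx
  rwa [hV.extD_lam, hx] at h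

/-- The rescaled frame is symplectic for the perturbed form. -/
theorem isSymplecticFrame_rescaledFrame (hV : IsPrequantizationBundle σ proj lam)
    (hH : ContMDiff (𝓡 2) 𝓘(ℝ, ℝ) ∞ H) (hpos : ∀ b, 0 < 1 + ε * H b)
    (he : IsSymplecticFrame (V := V) lam (proj ⁻¹' {p}) e) {S : Set V}
    (hS : S ⊆ proj ⁻¹' {p}) :
    IsSymplecticFrame (V := V) (pertForm proj H lam ε) S (rescaledFrame proj H ε e) where
  continuousOn i := by
    refine continuousOn_smul_section ?_ ((he.continuousOn i).mono hS)
    refine (ContinuousOn.inv₀ ?_ fun x _ => (Real.sqrt_pos.2 (hpos (proj x))).ne')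
    exact (hV.contMDiff_factor hH ε).continuous.sqrt.continuousOn
  mem_ker i x hx := by
    change pertForm proj H lam ε x ((√(1 + ε * H (proj x)))⁻¹ • e i x) = 0
    have h : lam x (e i x) = 0 := he.mem_ker i x (hS hx)
    rw [pertForm_apply, map_smul, h, smul_zero, mul_zero]
  area x hx := by
    change extD (pertForm proj H lam ε) x ((√(1 + ε * H (proj x)))⁻¹ • e 0 x)
      ((√(1 + ε * H (proj x)))⁻¹ • e 1 x) = 1
    have h : ∀ i, lam x (e i x) = 0 := fun i => he.mem_ker i x (hS hx)
    have hx' : proj x = p := hS hx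
    have h1 := hV.area_projD_frame he hx'
    rw [← hx'] at h1
    rw [hV.extD_pertForm hH]
    simp only [map_smul, h, smul_apply, h1, smul_eq_mul, mul_zero, sub_zero, zero_add, mul_one]
    rw [← mul_inv, Real.mul_self_sqrt (hpos _).le, mul_inv_cancel₀ (hpos _).ne']

end IsPrequantizationBundle

end Frames

/-! ## The index formula -/

section Index

variable {B V : Type*} [TopologicalSpace B] [ChartedSpace (EuclideanSpace ℝ (Fin 2)) B]
  [TopologicalSpace V] [ChartedSpace (EuclideanSpace ℝ (Fin 3)) V] [MulAction Circle V]
  {σ : B → EuclideanSpace ℝ (Fin 2) →L[ℝ] EuclideanSpace ℝ (Fin 2) →L[ℝ] ℝ}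
  {proj : V → B} {lam : V → EuclideanSpace ℝ (Fin 3) →L[ℝ] ℝ} {H : B → ℝ} {ε : ℝ}
  [IsManifold (𝓡 3) ∞ V] {p : B}

namespace IsPrequantizationBundle

/-- The projection of a frame over the fibre through `x`. -/
noncomputable def fibreFrame (proj : V → B) (e : Fin 2 → V → EuclideanSpace ℝ (Fin 3)) (x : V)
    (t : ℝ) (i : Fin 2) : EuclideanSpace ℝ (Fin 2) :=
  projD proj (Circle.exp t • x) (e i (Circle.exp t • x))

/-- The linearized circle action over a fibre in a frame. -/
noncomputable def fibreMatrix (σ : B → EuclideanSpace ℝ (Fin 2) →L[ℝ] EuclideanSpace ℝ (Fin 2) →L[ℝ] ℝ)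
    (proj : V → B) (p : B) (e : Fin 2 → V → EuclideanSpace ℝ (Fin 3)) (x : V) (t : ℝ) :
    Matrix (Fin 2) (Fin 2) ℝ :=
  transMatrix (σ p) (fibreFrame proj e x 0) (fibreFrame proj e x t)

variable {e : Fin 2 → V → EuclideanSpace ℝ (Fin 3)} {x : V}

theorem area_fibreFrame (hV : IsPrequantizationBundle σ proj lam)
    (he : IsSymplecticFrame (V := V) lam (proj ⁻¹' {p}) e) (hx : proj x = p) (t : ℝ) :
    σ p (fibreFrame proj e x t 0) (fibreFrame proj e x t 1) = 1 :=
  hV.area_projD_frame he ((hV.proj_smul _ x).trans hx)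

theorem fibreMatrix_eq_one (hV : IsPrequantizationBundle σ proj lam)
    (he : IsSymplecticFrame (V := V) lam (proj ⁻¹' {p}) e) (hx : proj x = p) {t : ℝ}
    (ht : Circle.exp t = 1) : fibreMatrix σ proj p e x t = 1 := by
  have h : fibreFrame proj e x 0 = fibreFrame proj e x t := by
    funext i
    simp only [fibreFrame, ht, Circle.exp_zero]
  rw [fibreMatrix, h]
  exact transMatrix_self hV.areaForm (hV.area_fibreFrame he hx t)

/-- The action covers the identity of the surface, so a transported contact vector keeps its
projection. Its coordinates change only because the projected frame moves, which is what the
transition matrix records. -/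
theorem isLinearizedFlow_smul (hV : IsPrequantizationBundle σ proj lam)
    (he : IsSymplecticFrame (V := V) lam (proj ⁻¹' {p}) e) (hx : proj x = p) (T : ℝ) :
    IsLinearizedFlow (V := V) (fun t x => Circle.exp t • x) (fun t => Circle.exp t • x) T e
      (fibreMatrix σ proj p e x) := by
  intro t _ j
  change manD (n := 3) (m := 3) (fun y : V => Circle.exp t • y) (Circle.exp 0 • x)
    (e j (Circle.exp 0 • x)) = ∑ i, fibreMatrix σ proj p e x t i j • e i (Circle.exp t • x)
  have hker : ∀ s i, lam (Circle.exp s • x) (e i (Circle.exp s • x)) = 0 := fun s i =>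
    he.mem_ker i _ ((hV.proj_smul _ x).trans hx)
  have h0 := hker 0 j
  have h1 := eq_sum_transMatrix (D := fibreFrame proj e x 0) hV.areaForm
    (hV.area_fibreFrame he hx t) j
  simp only [fibreFrame] at h1
  rw [Circle.exp_zero, one_smul] at h0 h1 ⊢
  rw [Fin.sum_univ_two]
  refine hV.eq_of_projD_eq (x := Circle.exp t • x) ?_ ?_
  · rw [hV.projD_manD_smul, h1]
    simp only [map_add, map_smul, fibreMatrix]
  · rw [hV.lam_manD_smul, h0]
    simp only [map_add, map_smul, hker, smul_zero, add_zero]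

variable [IsManifold (𝓡 2) ∞ B]

theorem isSpPath_fibreMatrix (hV : IsPrequantizationBundle σ proj lam)
    (he : IsSymplecticFrame (V := V) lam (proj ⁻¹' {p}) e) (hx : proj x = p) {T : ℝ}
    (hT : 0 < T) : IsSpPath T (fibreMatrix σ proj p e x) where
  pos := hT
  continuousOn := by
    have hc : ∀ i, Continuous fun t => fibreFrame proj e x t i := fun i =>
      hV.continuous_projD_frame (he.continuousOn i)
        (continuous_iff_continuousAt.2 fun t => (hV.hasVelocityAt_smul x t).continuousAt)
        (fun t => (hV.proj_smul _ x).trans hx) fun t => (hV.proj_smul _ x).trans hx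
    refine (continuous_matrix fun i j => ?_).continuousOn
    fin_cases i
    · exact (σ p (fibreFrame proj e x 0 j)).continuous.comp (hc 1)
    · exact ((σ p).flip (fibreFrame proj e x 0 j)).continuous.comp (hc 0)
  det t _ := det_transMatrix hV.areaForm (hV.area_fibreFrame he hx 0) (hV.area_fibreFrame he hx t)
  zero := hV.fibreMatrix_eq_one he hx Circle.exp_zero

/-- The linearized Reeb flow of the perturbed form over a critical point. -/
theorem projD_flow_eq (hV : IsPrequantizationBundle σ proj lam)
    (hH : ContMDiff (𝓡 2) 𝓘(ℝ, ℝ) ∞ H) (hpos : ∀ b, 0 < 1 + ε * H b) {φ : ℝ → V → V}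
    (hφ : IsReebFlow (n := 3) (pertForm proj H lam ε) φ) {N : ℕ}
    {ψ : B → EuclideanSpace ℝ (Fin N)}
    (hψ : ContMDiff (𝓡 2) 𝓘(ℝ, EuclideanSpace ℝ (Fin N)) ∞ ψ)
    (hinj : ∀ x, Function.Injective (vecD (n := 2) ψ x))
    (hp : IsCritPoint (n := 2) H p) (hx : ∀ t, proj (φ t x) = p)
    {E : Fin 2 → EuclideanSpace ℝ (Fin 2)} (hE : σ p (E 0) (E 1) = 1)
    {Φ : ℝ → Matrix (Fin 2) (Fin 2) ℝ}
    (hΦ : IsOneParam (hamMatrix H p E (ε / (1 + ε * H p) ^ 2)) Φ)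
    (hcomm : ∀ t, Φ t * hamMatrix H p E (ε / (1 + ε * H p) ^ 2)
      = hamMatrix H p E (ε / (1 + ε * H p) ^ 2) * Φ t)
    {v : EuclideanSpace ℝ (Fin 3)} {y : Fin 2 → ℝ} (hv : projD proj x v = frameVec E y) (t : ℝ) :
    projD proj (φ t x) (manD (n := 3) (m := 3) (φ t) x v) = frameVec E ((Φ t).mulVec y) := by
  refine eq_frameVec_of_hasDerivAt (u := fun t => projD proj (φ t x)
    (manD (n := 3) (m := 3) (φ t) x v)) hV.areaForm hH hp hE hΦ hcomm
    (hV.hasDerivAt_projD_flow hH hpos hφ hψ hinj hp hx v) ?_ t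
  have h0 : φ 0 = id := funext hφ.zero
  have h1 : manD (n := 3) (m := 3) (id : V → V) x v = v :=
    DFunLike.congr_fun (mfderiv_id (I := 𝓡 3)) v
  rw [h0, h1]
  exact hv

/-- Closed orbits over critical points are nondegenerate. -/
theorem isNondegenerateOrbit (hV : IsPrequantizationBundle σ proj lam)
    (hH : IsMorse (n := 2) H) (hpos : ∀ b, 0 < 1 + ε * H b) (hε : 0 < ε) {φ : ℝ → V → V}
    (hφ : IsReebFlow (n := 3) (pertForm proj H lam ε) φ) {N : ℕ}
    {ψ : B → EuclideanSpace ℝ (Fin N)}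
    (hψ : ContMDiff (𝓡 2) 𝓘(ℝ, EuclideanSpace ℝ (Fin N)) ∞ ψ)
    (hinj : ∀ x, Function.Injective (vecD (n := 2) ψ x)) {C : ℝ} (hC0 : 0 ≤ C)
    (hC : ∀ (x : B) (v : EuclideanSpace ℝ (Fin 2)),
      ‖vecD (hamDeriv σ H ψ) x v‖ ≤ C * ‖vecD ψ x v‖)
    (hp : IsCritPoint (n := 2) H p) {γ : ℝ → V} (hx : ∀ t, proj (φ t (γ 0)) = p)
    {P : ℝ} (hP : 0 < P) (hγP : φ P (γ 0) = γ 0)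
    (hsmall : ε / (1 + ε * H p) ^ 2 * C * P < 2 * Real.pi) :
    IsNondegenerateOrbit (n := 3) (pertForm proj H lam ε) φ γ P := by
  have hκ : 0 < ε / (1 + ε * H p) ^ 2 := div_pos hε (pow_pos (hpos p) 2)
  set κ := ε / (1 + ε * H p) ^ 2 with hκdef
  intro (v : EuclideanSpace ℝ (Fin 3)) hv hret
  change manD (n := 3) (m := 3) (φ P) (γ 0) v = v at hret
  have hv' : lam (γ 0) v = 0 := by
    have h : pertForm proj H lam ε (γ 0) v = 0 := hv
    rw [pertForm_apply] at h
    exact (mul_eq_zero.1 h).resolve_left (hpos _).ne'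
  have hs := alternating_ne_zero (area_self hV.areaForm p) (area_nondegenerate hV.areaForm p)
  obtain ⟨E, hE⟩ : ∃ E : Fin 2 → EuclideanSpace ℝ (Fin 2), σ p (E 0) (E 1) = 1 :=
    ⟨![stdE0, (σ p stdE0 stdE1)⁻¹ • stdE1], by
      simp only [Matrix.cons_val_zero, Matrix.cons_val_one, map_smul, smul_eq_mul]
      exact inv_mul_cancel₀ hs⟩
  have htr := trace_hamMatrix (H := H) p E κ
  have hdet := det_hamMatrix_ne_zero hV.areaForm hH hp hE hκ.ne'
  obtain ⟨Φ, hΦ, hcomm, hcross⟩ := exists_isOneParam htr hdet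
  have hle := sqrt_det_hamMatrix_le hV.areaForm hH.smooth hψ hinj hC0 hC hp hE hκ.le
  have hne := hcross P hP ((mul_le_mul_of_nonneg_right hle hP.le).trans_lt hsmall)
  have hflow := hV.projD_flow_eq hH.smooth hpos hφ hψ hinj hp hx hE hΦ hcomm
    (eq_frameVec hV.areaForm hE (projD proj (γ 0) v)) P
  rw [hret, hγP] at hflow
  set y : Fin 2 → ℝ := ![σ p (projD proj (γ 0) v) (E 1), σ p (E 0) (projD proj (γ 0) v)]
  have hy := eq_frameVec hV.areaForm hE (projD proj (γ 0) v)
  have h1 : (Φ P).mulVec y = y :=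
    frameVec_injective hV.areaForm hE (hflow.symm.trans hy)
  -- A contact vector fixed by the return map projects to a vector fixed by `Φ P`, which is excluded
  -- because the trace of `Φ P` is not `2`.
  have h2 : (Φ P - 1).mulVec y = 0 := by rw [Matrix.sub_mulVec, h1, Matrix.one_mulVec, sub_self]
  have h3 : y = 0 := by
    by_contra hy0
    have h4 := Matrix.exists_mulVec_eq_zero_iff.1 ⟨y, hy0, h2⟩
    rw [det_sub_one (hΦ.det P), sub_eq_zero] at h4
    exact hne h4.symm
  refine hV.eq_of_projD_eq (x := γ 0) (v := v) (w := 0) ?_ (by rw [hv', map_zero])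
  rw [hy, map_zero]
  change frameVec E y = 0
  rw [h3]
  simp [frameVec]

/-- The index formula. -/
theorem exists_index (hV : IsPrequantizationBundle σ proj lam)
    (hH : IsMorse (n := 2) H) (hpos : ∀ b, 0 < 1 + ε * H b) (hε : 0 < ε) {φ : ℝ → V → V}
    (hφ : IsReebFlow (n := 3) (pertForm proj H lam ε) φ) {N : ℕ}
    {ψ : B → EuclideanSpace ℝ (Fin N)}
    (hψ : ContMDiff (𝓡 2) 𝓘(ℝ, EuclideanSpace ℝ (Fin N)) ∞ ψ)
    (hinj : ∀ x, Function.Injective (vecD (n := 2) ψ x)) {C : ℝ} (hC0 : 0 ≤ C)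
    (hC : ∀ (x : B) (v : EuclideanSpace ℝ (Fin 2)),
      ‖vecD (hamDeriv σ H ψ) x v‖ ≤ C * ‖vecD ψ x v‖)
    (hp : IsCritPoint (n := 2) H p) {γ : ℝ → V} (hγp : ∀ t, proj (γ t) = p)
    (hγ : ∀ t, γ t = Circle.exp (t / (1 + ε * H p)) • γ 0)
    (hφγ : ∀ t, φ t (γ 0) = γ t) {k : ℕ} (hk : 1 ≤ k)
    (hsmall : ε / (1 + ε * H p) ^ 2 * C * (k * (2 * Real.pi) * (1 + ε * H p)) < 2 * Real.pi)
    (he : IsSymplecticFrame (V := V) lam (proj ⁻¹' {p}) e) :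
    ∃ (mRS : ℚ) (mCZ : ℤ),
      IsOrbitRSIndex (V := V) lam (fun t x => Circle.exp t • x) (fun t => Circle.exp t • γ 0)
        (k * (2 * Real.pi)) e mRS ∧
      IsOrbitCZIndex (V := V) (pertForm proj H lam ε) φ γ (k * (2 * Real.pi) * (1 + ε * H p))
        (rescaledFrame proj H ε e) mCZ ∧
      (mCZ : ℚ) = mRS - 1 + (morseIndex (n := 2) H p : ℚ) := by
  have hc : 0 < 1 + ε * H p := hpos p
  have hκ : 0 < ε / (1 + ε * H p) ^ 2 := div_pos hε (pow_pos (hpos p) 2)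
  set c := 1 + ε * H p with hcdef
  set κ := ε / c ^ 2 with hκdef
  have hT : 0 < (k : ℝ) * (2 * Real.pi) :=
    mul_pos (by exact_mod_cast hk) (by positivity)
  set T := (k : ℝ) * (2 * Real.pi) with hTdef
  have hexpT : Circle.exp T = 1 := Circle.exp_eq_one.2 ⟨k, by simp [hTdef]⟩
  have hx := hγp 0
  set x := γ 0 with hxdef
  set M := fibreMatrix σ proj p e x with hM
  have hsp : IsSpPath T M := hV.isSpPath_fibreMatrix he hx hT
  obtain ⟨m, θ, hθ, hθT, hRS⟩ := exists_isRSIndex_of_loop hsp (hV.fibreMatrix_eq_one he hx hexpT)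
  set E := fibreFrame proj e x 0 with hEdef
  have hE : σ p (E 0) (E 1) = 1 := hV.area_fibreFrame he hx 0
  have htr := trace_hamMatrix (H := H) p E κ
  have hdet := det_hamMatrix_ne_zero hV.areaForm hH hp hE hκ.ne'
  obtain ⟨Φ, hΦ, hcomm, hcross⟩ := exists_isOneParam htr hdet
  have hle := sqrt_det_hamMatrix_le hV.areaForm hH.smooth hψ hinj hC0 hC hp hE hκ.le
  have hsm : √|(hamMatrix H p E κ).det| * (T * c) < 2 * Real.pi :=
    (mul_le_mul_of_nonneg_right hle (by positivity)).trans_lt hsmall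
  have hTc : T * c / c = T := mul_div_cancel_right₀ T hc.ne'
  -- In the rescaled frame the linearized flow is `M(t/c) Φ(t)`: the loop `M` of the unperturbed
  -- orbit, run at speed `1/c`, times the linearized slow Hamiltonian flow. Reparametrization keeps
  -- the winding number `m`, so the index `2m` of the unperturbed orbit reappears.
  have hCZ := isCZIndex_mul (hsp.comp_div hc)
    (by rw [hTc]; exact hV.fibreMatrix_eq_one he hx hexpT) (hθ.comp_div hc) (m := m)
    (by rw [hTc]; exact hθT) hΦ htr hdet hsm
    fun t ht htT => hcross t ht ((mul_le_mul_of_nonneg_left htT (Real.sqrt_nonneg _)).trans_lt hsm)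
  refine ⟨2 * m, _, ⟨?_, M, hV.isLinearizedFlow_smul he hx T, hRS⟩,
    ⟨hV.isSymplecticFrame_rescaledFrame hH.smooth hpos he ?_, _, ?_, hCZ⟩, ?_⟩
  · have hsub : range (fun t : ℝ => Circle.exp t • x) ⊆ proj ⁻¹' {p} := by
      rintro _ ⟨t, rfl⟩
      exact (hV.proj_smul _ x).trans hx
    exact ⟨fun i => (he.continuousOn i).mono hsub, fun i y hy => he.mem_ker i y (hsub hy),
      fun y hy => he.area y (hsub hy)⟩
  · rintro _ ⟨t, rfl⟩
    exact hγp t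
  · intro t _ j
    have hr : ∀ s, (√(1 + ε * H (proj (γ s))))⁻¹ = (√c)⁻¹ := fun s => by rw [hγp]
    set r := (√c)⁻¹
    change manD (n := 3) (m := 3) (φ t) x ((√(1 + ε * H (proj (γ 0))))⁻¹ • e j x) =
      ∑ i, (M (t / c) * Φ t) i j • ((√(1 + ε * H (proj (γ t))))⁻¹ • e i (γ t))
    -- The scaling factor is constant on the fibre, so it cancels from the matrix of the linearized
    -- flow.
    rw [hr, hr, map_smul, Fin.sum_univ_two, smul_comm _ r, smul_comm _ r, ← smul_add]
    congr 1
    have hφt := hφγ t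
    have hker : ∀ s i, lam (γ s) (e i (γ s)) = 0 := fun s i => he.mem_ker i _ (hγp s)
    refine hV.eq_of_projD_eq (x := γ t) ?_ ?_
    · have h1 : projD proj x (e j x) = frameVec E (Pi.single j 1) := by
        rw [frameVec_single, hEdef]
        simp only [fibreFrame, Circle.exp_zero, one_smul]
      have h2 := hV.projD_flow_eq hH.smooth hpos hφ hψ hinj hp
        (fun s => by rw [hφγ]; exact hγp s) hE hΦ hcomm h1 t
      rw [hφt, ← frameVec_transMatrix hV.areaForm (hV.area_fibreFrame he hx (t / c)),
        Matrix.mulVec_mulVec] at h2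
      rw [h2]
      change frameVec _ ((M (t / c) * Φ t).mulVec _) = _
      rw [frameVec_mulVec_single, map_add, map_smul, map_smul]
      simp only [fibreFrame, ← hγ t]
    -- The flow preserves the perturbed form, so the transported vector stays in the contact plane
    -- and is determined by its projection.
    · have h1 := hφ.apply_manD (hV.isContactForm_pertForm hH.smooth hpos).smooth x (e j x) t
      rw [hφt, pertForm_apply, pertForm_apply, hker 0 j, mul_zero] at h1
      rw [(mul_eq_zero.1 h1).resolve_left (hpos _).ne']
      simp only [map_add, map_smul, hker, smul_zero, add_zero]
  · have h := morseIndex_eq hV.areaForm hH hp hE hκ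
    have h' : (morseIndex (n := 2) H p : ℚ) = ((morseIndex (n := 2) H p : ℤ) : ℚ) := by simp
    rw [h', h]
    push_cast
    ring

end IsPrequantizationBundle

end Index

/-- The period of a simple Reeb orbit over a critical point. -/
theorem IsPrequantizationBundle.period_eq {B V : Type*}
    [TopologicalSpace B] [ChartedSpace (EuclideanSpace ℝ (Fin 2)) B]
    [TopologicalSpace V] [ChartedSpace (EuclideanSpace ℝ (Fin 3)) V] [MulAction Circle V]
    {σ : B → EuclideanSpace ℝ (Fin 2) →L[ℝ] EuclideanSpace ℝ (Fin 2) →L[ℝ] ℝ}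
    {proj : V → B} {lam α : V → EuclideanSpace ℝ (Fin 3) →L[ℝ] ℝ}
    (hV : IsPrequantizationBundle σ proj lam) {γ : ℝ → V} {P c : ℝ} (hc : 0 < c)
    (hγ : IsSimpleReebOrbit (n := 3) α γ P) (h : ∀ t, γ t = Circle.exp (t / c) • γ 0) :
    P = 2 * Real.pi * c := by
  have hs : IsSimpleReebOrbit (n := 3) α γ (2 * Real.pi * c) := by
    have h1 := hγ.curve
    rw [show γ = fun t => Circle.exp (t / c) • γ 0 from funext h] at h1
    have h2 := hV.isSimple hc h1
    rwa [← show γ = fun t => Circle.exp (t / c) • γ 0 from funext h] at h2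
  rcases lt_trichotomy P (2 * Real.pi * c) with hlt | heq | hgt
  · exact absurd hγ.periodic (hs.minimal P hγ.pos hlt)
  · exact heq
  · exact absurd hs.periodic (hγ.minimal _ hs.pos hgt)

/-! ### The choice of `ε₀` and the main theorem -/

theorem mainTheorem10 {B V : Type*}
    [TopologicalSpace B] [ChartedSpace (EuclideanSpace ℝ (Fin 2)) B] [IsManifold (𝓡 2) ∞ B]
    [T2Space B] [CompactSpace B]
    [TopologicalSpace V] [ChartedSpace (EuclideanSpace ℝ (Fin 3)) V] [IsManifold (𝓡 3) ∞ V]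
    [T2Space V] [MulAction Circle V]
    (σ : (b : B) → TangentSpace (𝓡 2) b →L[ℝ] TangentSpace (𝓡 2) b →L[ℝ] ℝ)
    (proj : V → B) (lam : (x : V) → TangentSpace (𝓡 3) x →L[ℝ] ℝ)
    (hV : IsPrequantizationBundle σ proj lam)
    (H : B → ℝ) (hH : IsMorse (n := 2) H) (T : ℝ) (hT : 0 < T) :
    ∃ ε₀ > 0, ∀ ε : ℝ, 0 < ε → ε < ε₀ →
      -- the perturbed form is a (positively scaled) contact form
      (∀ b, 0 < 1 + ε * H b) ∧ IsContactForm (perturbedForm proj H lam ε) ∧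
      -- closed orbits of action less than `T` project to critical points
      (∀ (γ : ℝ → V) (P : ℝ), IsReebOrbit (perturbedForm proj H lam ε) γ P →
        orbitAction (perturbedForm proj H lam ε) γ P < T →
        ∃ p, IsCritPoint (n := 2) H p ∧ ∀ t, proj (γ t) = p) ∧
      -- the flow of the unperturbed Reeb field is the circle action, with simple orbits of period 2π
      IsReebFlow lam (fun t x => Circle.exp t • x) ∧
      (∀ x : V, IsSimpleReebOrbit lam (fun t => Circle.exp t • x) (2 * Real.pi)) ∧
      -- each fibre over a critical point is a simple orbit of the perturbed form
      (∀ x : V, IsCritPoint (n := 2) H (proj x) →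
        IsSimpleReebOrbit (perturbedForm proj H lam ε)
          (fun t => Circle.exp (t / (1 + ε * H (proj x))) • x)
          (2 * Real.pi * (1 + ε * H (proj x)))) ∧
      -- for the flow `φ` of the perturbed Reeb field:
      ∀ φ : ℝ → V → V, IsReebFlow (perturbedForm proj H lam ε) φ →
        -- closed orbits of action less than `T` are nondegenerate
        (∀ (γ : ℝ → V) (P : ℝ), IsReebOrbit (perturbedForm proj H lam ε) γ P →
          orbitAction (perturbedForm proj H lam ε) γ P < T →
          IsNondegenerateOrbit (perturbedForm proj H lam ε) φ γ P) ∧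
        -- index formula for the `k`-fold iterate of the simple orbit `γ` over `p`, in any
        -- symplectic trivialization `e` of the contact planes over the fibre
        ∀ (p : B), IsCritPoint (n := 2) H p → ∀ (γ : ℝ → V) (P : ℝ),
          IsSimpleReebOrbit (perturbedForm proj H lam ε) γ P → (∀ t, proj (γ t) = p) →
          ∀ k : ℕ, 1 ≤ k → orbitAction (perturbedForm proj H lam ε) γ (k * P) < T →
          ∀ e : Fin 2 → (x : V) → TangentSpace (𝓡 3) x,
            IsSymplecticFrame lam (proj ⁻¹' {p}) e →
            ∃ (mRS : ℚ) (mCZ : ℤ),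
              IsOrbitRSIndex lam (fun t x => Circle.exp t • x) (fun t => Circle.exp t • γ 0)
                (k * (2 * Real.pi)) e mRS ∧
              IsOrbitCZIndex (perturbedForm proj H lam ε) φ γ (k * P)
                (rescaledFrame proj H ε e) mCZ ∧
              (mCZ : ℚ) = mRS - 1 + (morseIndex (n := 2) H p : ℚ) := by
  obtain ⟨N, ψ, hψ, -, hinj⟩ := exists_embedding_euclidean_of_compact (I := 𝓡 2) (M := B)
  have hinj' : ∀ x, Function.Injective (vecD (n := 2) ψ x) := hinj
  obtain ⟨C, hC0, hC⟩ := exists_vecD_le hψ (contMDiff_hamDeriv hV.areaForm hH.smooth hψ) hinj'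
  obtain ⟨K, hK0, hK⟩ : ∃ K > 0, ∀ b, |H b| ≤ K := by
    obtain ⟨K, hK⟩ := isCompact_univ.exists_bound_of_continuousOn
      hH.smooth.continuous.continuousOn
    exact ⟨|K| + 1, by positivity, fun b =>
      (hK b trivial).trans ((le_abs_self K).trans (by linarith))⟩
  -- The first bound gives `1 + εH > 1/2`, hence `ε/(1 + εH)² ≤ 4ε`; the second then gives `κCP < 1`
  -- for every period `P < T`. This suffices for localization, and being less than `2π` also for
  -- nondegeneracy and the index.
  refine ⟨min (1 / (2 * K)) (1 / (4 * C * T)), by positivity, fun ε hε hεlt => ?_⟩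
  have hε1 : ε * K < 1 / 2 := by
    have h1 := (lt_div_iff₀ (by positivity)).1 (hεlt.trans_le (min_le_left _ _))
    linarith
  have hε2 : 4 * ε * C * T < 1 := by
    have h1 := (lt_div_iff₀ (by positivity)).1 (hεlt.trans_le (min_le_right _ _))
    linarith
  have hhalf : ∀ b, 1 / 2 < 1 + ε * H b := fun b => by
    have h1 := (abs_le.1 (hK b)).1
    nlinarith
  have hpos : ∀ b, 0 < 1 + ε * H b := fun b => by linarith [hhalf b]
  have hsmall : ∀ b P, 0 < P → P < T → ε / (1 + ε * H b) ^ 2 * C * P < 1 := fun b P hP hPT => by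
    have h1 : ε / (1 + ε * H b) ^ 2 ≤ 4 * ε := by
      rw [div_le_iff₀ (pow_pos (hpos b) 2)]
      have h2 : 1 / 4 ≤ (1 + ε * H b) ^ 2 := by nlinarith [hhalf b]
      nlinarith
    calc ε / (1 + ε * H b) ^ 2 * C * P ≤ 4 * ε * C * T := by gcongr
      _ < 1 := hε2
  have hpi : (1 : ℝ) < 2 * Real.pi := by linarith [Real.pi_gt_three]
  have hcrit : ∀ (γ : ℝ → V) (P : ℝ), IsReebOrbit (n := 3) (pertForm proj H lam ε) γ P →
      orbitAction (n := 3) (pertForm proj H lam ε) γ P < T →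
      P < T ∧ IsCritPoint (n := 2) H (proj (γ 0)) ∧ ∀ t, proj (γ t) = proj (γ 0) := by
    intro γ P hγ hact
    rw [orbitAction_eq hγ.curve] at hact
    exact ⟨hact, hV.crit_of_periodic hH.smooth hpos hγ hψ hinj' hε hC (hsmall _ P hγ.pos hact)⟩
  refine ⟨hpos, hV.isContactForm_pertForm hH.smooth hpos,
    fun γ P hγ hact => ⟨_, (hcrit γ P hγ hact).2⟩, hV.isReebFlow, fun x => ?_, fun x hx => ?_,
    fun φ hφ => ⟨fun γ P hγ hact => ?_, fun p hp γ P hγ hγp k hk hact e he => ?_⟩⟩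
  · have h := hV.isSimple (x := x) one_pos (by simpa only [div_one] using hV.isReebFlow.curve x)
    simpa only [div_one, mul_one] using h
  · exact hV.isSimple (hpos _) (hV.isReebCurve_smul hH.smooth hpos hx)
  · obtain ⟨hPT, hp, hconst⟩ := hcrit γ P hγ hact
    have hz := hφ.zero (γ 0)
    have hp' : IsCritPoint (n := 2) H (proj (φ 0 (γ 0))) := by rwa [hz]
    have hflow := hV.proj_eq_of_crit hH.smooth hpos (hφ.curve (γ 0)) hψ hinj' hε.le hC hp'
    have e1 := hV.eq_smul_of_proj_eq hH.smooth hpos (hφ.curve (γ 0)) hp' hflow P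
    have e2 := hV.eq_smul_of_proj_eq hH.smooth hpos hγ.curve hp hconst P
    simp only [hz] at hflow e1
    refine hV.isNondegenerateOrbit hH hpos hε hφ hψ hinj' hC0.le hC hp hflow hγ.pos ?_
      -- The prescribed flow line through `γ 0` and the given orbit are both the fibre run at the
      -- same speed, so `φ P` fixes `γ 0`.
      ((hsmall _ P hγ.pos hPT).trans hpi)
    rw [e1, ← e2, ← zero_add P, hγ.periodic 0]
  · have hp0 : IsCritPoint (n := 2) H (proj (γ 0)) := by rwa [hγp]
    have hz := hφ.zero (γ 0)
    have hp' : IsCritPoint (n := 2) H (proj (φ 0 (γ 0))) := by rwa [hz]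
    have hflow := hV.proj_eq_of_crit hH.smooth hpos (hφ.curve (γ 0)) hψ hinj' hε.le hC hp'
    have e1 := hV.eq_smul_of_proj_eq hH.smooth hpos (hφ.curve (γ 0)) hp' hflow
    have e2 := hV.eq_smul_of_proj_eq hH.smooth hpos hγ.curve hp0 fun t => by rw [hγp, hγp]
    simp only [hz] at e1
    -- Minimality fixes the period as `2π(1 + εH(p))`, so the time `k P` of the iterate is exactly
    -- `k` turns of the circle, rescaled.
    have hPc := hV.period_eq (hpos _) hγ e2
    rw [hγp] at e2 hPc
    have hk0 : (0 : ℝ) < k := by exact_mod_cast hk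
    have hact' : (k : ℝ) * P < T := by
      have := orbitAction_eq (n := 3) (α := pertForm proj H lam ε) hγ.curve (k * P)
      rw [← this]
      exact hact
    have hkP : (k : ℝ) * P = k * (2 * Real.pi) * (1 + ε * H p) := by rw [hPc]; ring
    have hs := (hsmall p _ (mul_pos hk0 hγ.pos) hact').trans hpi
    rw [hkP] at hs ⊢
    exact hV.exists_index hH hpos hε hφ hψ hinj' hC0.le hC hp hγp e2
      (fun t => by rw [e1, hγp, ← e2]) hk hs he
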